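/- Let $n\ge 1$ be an integer and $\theta>0$. For a real symmetric $n\times n$ matrix $A$ put $$g_\theta(A)=\tfrac1\theta\log\operatorname{tr}(e^{\theta A})+\tfrac1\theta\log\operatorname{tr}(e^{-\theta A}),\qquad G_\theta(A)=\frac{e^{\theta A}}{\operatorname{tr}(e^{\theta A})}-\frac{e^{-\theta A}}{\operatorname{tr}(e^{-\theta A})}.$$ Let $\Sigma_0,\Sigma_1$ be real symmetric positive definite $n\times n$ matrices with $\det\Sigma_0=\det\Sigma_1$. Call $(A_\cdot,\Sigma_\cdot)$ admissible if $A_\cdot\in L^2([0,1])$ takes values in the traceless symmetric matrices, $\Sigma_\cdot\in H^1([0,1])$ takes values in the positive definite matrices, $\dot\Sigma_t=A_t\Sigma_t+\Sigma_tA_t$ for almost every $t\in[0,1]$, and $\Sigma_\cdot$ equals $\Sigma_0$ at $t=0$ and $\Sigma_1$ at $t=1$. A minimizer is an admissible pair that minimizes $J_\theta(A_\cdot)=\int_0^1 g_\theta(A_t)^2\,dt$ among all admissible pairs. Then a minimizer exists. Moreover, for every minimizer $(A_\cdot,\Sigma_\cdot)$ there is a matrix $L_0=\Lambda_0\Sigma_0$,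 with $\Lambda_0$ symmetric, such that the system on $[0,1]$ $$\dot\Sigma_t=A_t\Sigma_t+\Sigma_tA_t,\qquad \dot M_t=\Omega_tA_t-A_t\Omega_t,\qquad \dot\Omega_t=0,$$ with $A_t$ traceless symmetric and determined from $M_t=-g_\theta(A_t)G_\theta(A_t)$ for all $t\in[0,1]$, and with initial values $\Sigma_0$, $M_0=\tfrac12(L_0+L_0^\top)-\tfrac1n\operatorname{tr}(L_0)I$ and $\Omega_0=\tfrac12(L_0-L_0^\top)$, has exactly one solution $(A_\cdot,\Sigma_\cdot,M_\cdot,\Omega_\cdot)$, and the $\Sigma$- and $A$-components of this solution are those of the minimizer ($A$ up to equality almost everywhere). -/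

import Mathlib

open MeasureTheory Set

namespace MinShear

noncomputable section

/-- The smooth surrogate of the spectral diameter,
`g_θ(A) = θ⁻¹ log tr e^{θA} + θ⁻¹ log tr e^{-θA}`. -/
def g {n : ℕ} (θ : ℝ) (A : Matrix (Fin n) (Fin n) ℝ) : ℝ :=
  (1 / θ) * Real.log (NormedSpace.exp (θ • A)).trace
    + (1 / θ) * Real.log (NormedSpace.exp (-(θ • A))).trace

/-- The gradient of `g_θ`, `G_θ(A) = e^{θA} / tr e^{θA} - e^{-θA} / tr e^{-θA}`. -/
def G {n : ℕ} (θ : ℝ) (A : Matrix (Fin n) (Fin n) ℝ) : Matrix (Fin n) (Fin n) ℝ :=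
  (NormedSpace.exp (θ • A)).trace⁻¹ • NormedSpace.exp (θ • A)
    - (NormedSpace.exp (-(θ • A))).trace⁻¹ • NormedSpace.exp (-(θ • A))

/-- The cost `J_θ(A) = ∫₀¹ g_θ(A_t)² dt`. -/
def cost {n : ℕ} (θ : ℝ) (A : ℝ → Matrix (Fin n) (Fin n) ℝ) : ℝ :=
  ∫ t in (0 : ℝ)..1, g θ (A t) ^ 2

/-- A scalar function belongs to `H¹([0,1])` (through its continuous representative): it is
absolutely continuous on `[0,1]` and its derivative is square integrable there. -/
def IsH1 (f : ℝ → ℝ) : Prop :=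
  AbsolutelyContinuousOnInterval f 0 1 ∧
    MemLp (deriv f) 2 (volume.restrict (Icc (0 : ℝ) 1))

/-- The pair `(A, S)` of control and state is admissible for the boundary data `S₀, S₁`:
`A ∈ L²([0,1]; traceless symmetric)`, `S ∈ H¹([0,1]; positive definite)`,
`S' = A S + S A` almost everywhere on `[0,1]`, and `S 0 = S₀`, `S 1 = S₁`. -/
structure IsAdmissible {n : ℕ} (S₀ S₁ : Matrix (Fin n) (Fin n) ℝ)
    (A S : ℝ → Matrix (Fin n) (Fin n) ℝ) : Prop where
  memLp : ∀ i j, MemLp (fun t => A t i j) 2 (volume.restrict (Icc (0 : ℝ) 1))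
  symm : ∀ᵐ t ∂volume.restrict (Icc (0 : ℝ) 1), (A t).IsSymm
  traceless : ∀ᵐ t ∂volume.restrict (Icc (0 : ℝ) 1), (A t).trace = 0
  memH1 : ∀ i j, IsH1 (fun t => S t i j)
  posDef : ∀ t ∈ Icc (0 : ℝ) 1, (S t).PosDef
  dynamics : ∀ᵐ t ∂volume.restrict (Icc (0 : ℝ) 1), ∀ i j,
    HasDerivAt (fun s => S s i j) ((A t * S t + S t * A t) i j) t
  initial : S 0 = S₀
  terminal : S 1 = S₁

/-- `(A, S)` is a minimizer of the minimum-shear covariance steering problem. -/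
def IsMinimizer {n : ℕ} (θ : ℝ) (S₀ S₁ : Matrix (Fin n) (Fin n) ℝ)
    (A S : ℝ → Matrix (Fin n) (Fin n) ℝ) : Prop :=
  IsAdmissible S₀ S₁ A S ∧
    ∀ B T : ℝ → Matrix (Fin n) (Fin n) ℝ, IsAdmissible S₀ S₁ B T → cost θ A ≤ cost θ B

/-- `F` is differentiable on `[0,1]` (one-sidedly at the end points) with derivative `F'`. -/
def HasDerivOnUnit {n : ℕ} (F F' : ℝ → Matrix (Fin n) (Fin n) ℝ) : Prop :=
  ∀ t ∈ Icc (0 : ℝ) 1, ∀ i j,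
    HasDerivWithinAt (fun s => F s i j) (F' t i j) (Icc (0 : ℝ) 1) t

/-- The traceless symmetric part of a matrix. -/
def tracelessSymPart {n : ℕ} (L : Matrix (Fin n) (Fin n) ℝ) : Matrix (Fin n) (Fin n) ℝ :=
  (1 / 2 : ℝ) • (L + L.transpose) - (L.trace / n) • 1

/-- The antisymmetric part of a matrix. -/
def skewPart {n : ℕ} (L : Matrix (Fin n) (Fin n) ℝ) : Matrix (Fin n) (Fin n) ℝ :=
  (1 / 2 : ℝ) • (L - L.transpose)

/-- `(A, S, M, Ω)` solves the extremal system on `[0,1]` with initial value `(S₀, L₀)`: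
`S' = A S + S A`, `M' = Ω A - A Ω`, `Ω' = 0`, where `A` is traceless symmetric and tied to `M`
by `M = - g_θ(A) G_θ(A)`, and where `S 0 = S₀` and `M 0`, `Ω 0` are the traceless symmetric and
the antisymmetric part of `L₀`. -/
structure IsExtremal {n : ℕ} (θ : ℝ) (S₀ L₀ : Matrix (Fin n) (Fin n) ℝ)
    (A S M Ω : ℝ → Matrix (Fin n) (Fin n) ℝ) : Prop where
  symm : ∀ t ∈ Icc (0 : ℝ) 1, (A t).IsSymm
  traceless : ∀ t ∈ Icc (0 : ℝ) 1, (A t).trace = 0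
  momentum : ∀ t ∈ Icc (0 : ℝ) 1, M t = -(g θ (A t) • G θ (A t))
  deriv_S : HasDerivOnUnit S (fun t => A t * S t + S t * A t)
  deriv_M : HasDerivOnUnit M (fun t => Ω t * A t - A t * Ω t)
  deriv_Ω : HasDerivOnUnit Ω (fun _ => 0)
  init_S : S 0 = S₀
  init_M : M 0 = tracelessSymPart L₀
  init_Ω : Ω 0 = skewPart L₀

end

end MinShear

/-!
Write `gradSq θ A = g_θ(A) G_θ(A)`, half the gradient of `g_θ²`.

*Convexity.* The log-partition function `A ↦ log tr e^A` lies above its tangents (the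
Peierls–Bogoliubov inequality). Here this is proved by Jensen's inequality for the exponential,
applied to the eigenvalue differences `b_j - a_i` of two symmetric matrices under the weights
formed by the Gibbs state and the squared overlaps of the eigenbases; keeping the variance term of
Jensen's inequality gives a quadratic remainder (`exists_logPart_strong`). Hence `g_θ²` lies above
its tangents (`g_sq_ge`), grows at least like `‖A‖² / n` on traceless symmetric matrices
(`norm_sq_le_g_sq`), and `gradSq θ` is proper and has a locally Lipschitz inverse there
(`exists_norm_le_of_norm_gradSq_le`, `exists_norm_sub_le_gradSq`).

*Existence of a minimizer.* This is the direct method. A minimizing sequence has bounded energy, so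
the controls converge weakly in `L²` along an ultrafilter, and the states, being equicontinuous,
converge uniformly. The state equation passes to the limit because a weakly convergent sequence is
multiplied by a uniformly convergent one, the limit state stays positive definite because the
determinant is constant, and the cost is weakly lower semicontinuous by the tangent inequality
(`exists_isRelaxed_cost_le`). Linear interpolation of the boundary data provides a competitor.

*The extremal system.* Since `g_θ` ignores multiples of the identity and the boundary determinants
agree, the trace constraint may be dropped (`IsRelaxed.exists_isAdmissible`). A minimizer is
compared with the states `S + ε H`, whose control is exactly `A + ε X` for the solution `X` of a
Lyapunov equation (`IsMinimizer.integral_gradSq_mul_lyap`). A du Bois-Reymond argument then shows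
that the symmetric solution `Λ` of `Λ S + S Λ = gradSq θ A` is absolutely continuous with
`Λ' = -(A Λ + Λ A)` (`IsMinimizer.exists_costate`). So `gradSq θ A` is continuous, hence so is `A`
after a change on a null set (`exists_continuous_control`), and `M = -(Λ S + S Λ)` and
`Ω = S Λ - Λ S` solve the extremal system with `Λ₀ = -2 Λ(0)`. Here `Ω` is conserved because
`gradSq θ A` commutes with `A`, and the trace correction in the initial value of `M` vanishes
because `gradSq θ A` is traceless.

*Uniqueness.* The momentum determines the control in a locally Lipschitz way, so that Grönwall's
inequality applies in turn to `Ω`, `M` and `S` (`IsExtremal.unique`).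
-/

namespace MinShear

noncomputable section

open Matrix Filter Topology
open scoped Matrix.Norms.Frobenius

variable {n : ℕ} {θ : ℝ}

section LogPartition

open Finset

/-! ### Trace pairing and Frobenius norm -/

theorem norm_sq_eq_sum (A : Matrix (Fin n) (Fin n) ℝ) : ‖A‖ ^ 2 = ∑ i, ∑ j, A i j ^ 2 := by
  rw [Matrix.frobenius_norm_def, ← Real.sqrt_eq_rpow, Real.sq_sqrt]
  · simp
  · positivity

theorem norm_sq_eq_trace {A : Matrix (Fin n) (Fin n) ℝ} (hA : A.IsSymm) :
    ‖A‖ ^ 2 = (A * A).trace := by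
  rw [norm_sq_eq_sum]
  simp only [Matrix.trace, Matrix.diag, Matrix.mul_apply]
  refine sum_congr rfl fun i _ => sum_congr rfl fun j _ => ?_
  rw [hA.apply i j]; ring

theorem abs_apply_le_norm (A : Matrix (Fin n) (Fin n) ℝ) (i j : Fin n) : |A i j| ≤ ‖A‖ := by
  refine abs_le_of_sq_le_sq ?_ (norm_nonneg A)
  rw [norm_sq_eq_sum]
  calc A i j ^ 2 ≤ ∑ j, A i j ^ 2 :=
        single_le_sum (f := fun j => A i j ^ 2) (fun _ _ => sq_nonneg _) (mem_univ j)
    _ ≤ _ := single_le_sum (f := fun i => ∑ j, A i j ^ 2)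
        (fun _ _ => sum_nonneg fun _ _ => sq_nonneg _) (mem_univ i)

theorem abs_trace_mul_le (A B : Matrix (Fin n) (Fin n) ℝ) : |(A * B).trace| ≤ ‖A‖ * ‖B‖ := by
  have h : (A * B).trace = ∑ p : Fin n × Fin n, A p.1 p.2 * B p.2 p.1 := by
    simp [Matrix.trace, Matrix.mul_apply, Fintype.sum_prod_type]
  refine abs_le_of_sq_le_sq ?_ (by positivity)
  rw [h, mul_pow]
  refine (sum_mul_sq_le_sq_mul_sq _ _ _).trans (le_of_eq ?_)
  rw [norm_sq_eq_sum, norm_sq_eq_sum, Fintype.sum_prod_type, Fintype.sum_prod_type,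
    sum_comm (f := fun i j => B i j ^ 2)]

/-! ### A quantitative Jensen inequality for the exponential -/

/-- The quadratic lower bound `1 + y + y² / (2K) ≤ e^y`, valid on `[-K, ∞)` only. -/
theorem one_add_add_sq_le_exp {K y : ℝ} (hK : 2 ≤ K) (hy : -K ≤ y) :
    1 + y + y ^ 2 / (2 * K) ≤ Real.exp y := by
  have hK0 : 0 < 2 * K := by linarith
  by_cases h : -2 ≤ y
  · have h1 : (1 + y / 2) ^ 2 ≤ Real.exp (y / 2) ^ 2 :=
      pow_le_pow_left₀ (by linarith) (by linarith [Real.add_one_le_exp (y / 2)]) 2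
    rw [← Real.exp_nat_mul] at h1
    have h2 : y ^ 2 / (2 * K) ≤ y ^ 2 / 4 := by gcongr; linarith
    have h3 : ((2 : ℕ) : ℝ) * (y / 2) = y := by push_cast; ring
    rw [h3] at h1
    nlinarith
  · push Not at h
    have h1 : y ^ 2 / (2 * K) ≤ -y / 2 := by
      rw [div_le_iff₀ hK0]; nlinarith
    linarith [Real.exp_pos y]

/-- Jensen's inequality for `exp` with a variance remainder. -/
theorem log_sum_exp_ge {ι : Type*} [Fintype ι] (w x : ι → ℝ) (hw : ∀ i, 0 ≤ w i)
    (hw1 : ∑ i, w i = 1) {K : ℝ} (hK : 2 ≤ K) (hx : ∀ i, |x i - ∑ k, w k * x k| ≤ K) :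
    ∑ k, w k * x k + (∑ i, w i * (x i - ∑ k, w k * x k) ^ 2) / (K * (K + 2))
      ≤ Real.log (∑ i, w i * Real.exp (x i)) := by
  set m := ∑ k, w k * x k with hm
  set V := ∑ i, w i * (x i - m) ^ 2 with hV
  have hV0 : 0 ≤ V := sum_nonneg fun i _ => mul_nonneg (hw i) (sq_nonneg _)
  have hVK : V ≤ K ^ 2 := by
    calc V ≤ ∑ i, w i * K ^ 2 := by
          refine sum_le_sum fun i _ => mul_le_mul_of_nonneg_left ?_ (hw i)
          rw [← sq_abs]; exact pow_le_pow_left₀ (abs_nonneg _) (hx i) 2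
      _ = K ^ 2 := by rw [← sum_mul, hw1, one_mul]
  have h1 : Real.exp m * (1 + V / (2 * K)) ≤ ∑ i, w i * Real.exp (x i) := by
    have : ∀ i, Real.exp m * (w i * (1 + (x i - m) + (x i - m) ^ 2 / (2 * K)))
        ≤ w i * Real.exp (x i) := by
      intro i
      have h2 := one_add_add_sq_le_exp hK (abs_le.1 (hx i)).1
      have h3 : Real.exp (x i) = Real.exp m * Real.exp (x i - m) := by
        rw [← Real.exp_add]; ring_nf
      rw [h3]
      have := mul_le_mul_of_nonneg_left h2 (mul_nonneg (hw i) (Real.exp_pos m).le)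
      nlinarith
    refine le_trans (le_of_eq ?_) (sum_le_sum fun i _ => this i)
    rw [← mul_sum]
    congr 1
    have h4 : ∀ i, w i * (1 + (x i - m) + (x i - m) ^ 2 / (2 * K))
        = w i * (1 - m) + w i * x i + w i * (x i - m) ^ 2 / (2 * K) := fun i => by ring
    simp only [h4, sum_add_distrib, ← sum_mul, ← sum_div, hw1]
    rw [← hm, ← hV]; ring
  have hpos : 0 < 1 + V / (2 * K) := by positivity
  have h2 := Real.log_le_log (by positivity) h1
  rw [Real.log_mul (Real.exp_pos m).ne' hpos.ne', Real.log_exp] at h2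
  have h3 := Real.one_sub_inv_le_log_of_pos hpos
  have h4 : V / (K * (K + 2)) ≤ 1 - (1 + V / (2 * K))⁻¹ := by
    have hK0 : 0 < K := by linarith
    have e : 1 - (1 + V / (2 * K))⁻¹ = V / (2 * K + V) := by
      have : 2 * K + V ≠ 0 := by positivity
      field_simp
      ring
    rw [e]
    apply div_le_div_of_nonneg_left hV0 (by positivity)
    nlinarith
  linarith

/-! ### Diagonalisation of a pair of symmetric matrices -/

theorem exists_orthogonal_diagonalization {A : Matrix (Fin n) (Fin n) ℝ} (hA : A.IsSymm) :
    ∃ (U : Matrix (Fin n) (Fin n) ℝ) (a : Fin n → ℝ),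
      U * Uᵀ = 1 ∧ Uᵀ * U = 1 ∧ A = U * diagonal a * Uᵀ := by
  have hH : A.IsHermitian := by
    rw [Matrix.IsHermitian, Matrix.conjTranspose_eq_transpose_of_trivial]; exact hA
  refine ⟨hH.eigenvectorUnitary, hH.eigenvalues, ?_, ?_, ?_⟩
  · have := Unitary.coe_mul_star_self hH.eigenvectorUnitary
    rwa [Unitary.coe_star, Matrix.star_eq_conjTranspose,
      Matrix.conjTranspose_eq_transpose_of_trivial] at this
  · have := Unitary.coe_star_mul_self hH.eigenvectorUnitary
    rwa [Matrix.star_eq_conjTranspose, Matrix.conjTranspose_eq_transpose_of_trivial] at this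
  · have := hH.spectral_theorem
    rw [Unitary.conjStarAlgAut_apply, Matrix.star_eq_conjTranspose,
      Matrix.conjTranspose_eq_transpose_of_trivial] at this
    exact this

theorem exp_conj_diagonal {U : Matrix (Fin n) (Fin n) ℝ} (h : U * Uᵀ = 1) (a : Fin n → ℝ) :
    NormedSpace.exp (U * diagonal a * Uᵀ) = U * diagonal (fun i => Real.exp (a i)) * Uᵀ := by
  have hinv : U⁻¹ = Uᵀ := Matrix.inv_eq_right_inv h
  have hu : IsUnit U := IsUnit.of_mul_eq_one _ h
  rw [← hinv, Matrix.exp_conj U _ hu, Matrix.exp_diagonal]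
  congr 3
  funext i
  rw [Pi.coe_exp, Real.exp_eq_exp_ℝ]

theorem trace_conj_diagonal {U : Matrix (Fin n) (Fin n) ℝ} (h : Uᵀ * U = 1) (a : Fin n → ℝ) :
    (U * diagonal a * Uᵀ).trace = ∑ i, a i := by
  rw [Matrix.trace_mul_comm, ← Matrix.mul_assoc, h, Matrix.one_mul, Matrix.trace_diagonal]

theorem trace_conj_diagonal_mul_self {U : Matrix (Fin n) (Fin n) ℝ} (h : Uᵀ * U = 1)
    (a b : Fin n → ℝ) :
    ((U * diagonal a * Uᵀ) * (U * diagonal b * Uᵀ)).trace = ∑ i, a i * b i := by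
  rw [show U * diagonal a * Uᵀ * (U * diagonal b * Uᵀ) = U * (diagonal a * (Uᵀ * U) * diagonal b) * Uᵀ
      by simp only [Matrix.mul_assoc], h, Matrix.mul_one, Matrix.diagonal_mul_diagonal,
    trace_conj_diagonal h]

theorem trace_conj_diagonal_mul (U V : Matrix (Fin n) (Fin n) ℝ) (a b : Fin n → ℝ) :
    ((U * diagonal a * Uᵀ) * (V * diagonal b * Vᵀ)).trace
      = ∑ i, ∑ j, a i * b j * (Uᵀ * V) i j ^ 2 := by
  have h : ((U * diagonal a * Uᵀ) * (V * diagonal b * Vᵀ)).trace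
      = (diagonal a * ((Uᵀ * V) * (diagonal b * (Uᵀ * V)ᵀ))).trace := by
    rw [show (U * diagonal a * Uᵀ) * (V * diagonal b * Vᵀ)
      = U * (diagonal a * Uᵀ * (V * diagonal b * Vᵀ)) by simp only [Matrix.mul_assoc],
      Matrix.trace_mul_comm, Matrix.transpose_mul, Matrix.transpose_transpose]
    simp only [Matrix.mul_assoc]
  rw [h]
  simp only [Matrix.trace, Matrix.diag, Matrix.diagonal_mul]
  refine sum_congr rfl fun i _ => ?_
  rw [Matrix.mul_apply, mul_sum]
  refine sum_congr rfl fun j _ => ?_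
  rw [Matrix.diagonal_mul, Matrix.transpose_apply]; ring

/-- The squared overlaps of two orthonormal bases form a doubly stochastic matrix. -/
theorem sum_overlap {U V : Matrix (Fin n) (Fin n) ℝ} (hU : Uᵀ * U = 1) (hV : V * Vᵀ = 1)
    (i : Fin n) : ∑ j, (Uᵀ * V) i j ^ 2 = 1 := by
  have h : ((Uᵀ * V) * (Uᵀ * V)ᵀ) = 1 := by
    rw [Matrix.transpose_mul, Matrix.transpose_transpose,
      show Uᵀ * V * (Vᵀ * U) = Uᵀ * (V * Vᵀ) * U by simp only [Matrix.mul_assoc], hV,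
      Matrix.mul_one, hU]
  have := congrFun (congrFun h i) i
  rw [Matrix.mul_apply, Matrix.one_apply_eq] at this
  rw [← this]
  exact sum_congr rfl fun j _ => by rw [Matrix.transpose_apply]; ring

theorem sum_overlap' {U V : Matrix (Fin n) (Fin n) ℝ} (hU : U * Uᵀ = 1) (hV : Vᵀ * V = 1)
    (j : Fin n) : ∑ i, (Uᵀ * V) i j ^ 2 = 1 := by
  rw [← sum_overlap hV hU j]
  refine sum_congr rfl fun i _ => ?_
  rw [← Matrix.transpose_apply (Uᵀ * V), Matrix.transpose_mul, Matrix.transpose_transpose]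

theorem abs_le_norm_conj_diagonal {U : Matrix (Fin n) (Fin n) ℝ}
    (h' : Uᵀ * U = 1) (a : Fin n → ℝ) (i : Fin n) : |a i| ≤ ‖U * diagonal a * Uᵀ‖ := by
  have hs : (U * diagonal a * Uᵀ).IsSymm := by
    simp [Matrix.IsSymm, Matrix.transpose_mul, Matrix.mul_assoc]
  refine abs_le_of_sq_le_sq ?_ (norm_nonneg _)
  rw [norm_sq_eq_trace hs, trace_conj_diagonal_mul_self h', sq]
  exact single_le_sum (f := fun i => a i * a i) (fun _ _ => mul_self_nonneg _) (mem_univ i)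

/-! ### The log-partition function and its Gibbs gradient -/

/-- The log-partition function `log tr e^A`. -/
def logPart (A : Matrix (Fin n) (Fin n) ℝ) : ℝ := Real.log (NormedSpace.exp A).trace

/-- The Gibbs state `e^A / tr e^A`, the gradient of `logPart` at a symmetric matrix. -/
def gibbs (A : Matrix (Fin n) (Fin n) ℝ) : Matrix (Fin n) (Fin n) ℝ :=
  (NormedSpace.exp A).trace⁻¹ • NormedSpace.exp A

theorem trace_exp_pos [NeZero n] {A : Matrix (Fin n) (Fin n) ℝ} (hA : A.IsSymm) :
    0 < (NormedSpace.exp A).trace := by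
  obtain ⟨U, a, hU, hU', rfl⟩ := exists_orthogonal_diagonalization hA
  rw [exp_conj_diagonal hU, trace_conj_diagonal hU']
  exact sum_pos (fun i _ => Real.exp_pos _) univ_nonempty

theorem gibbs_isSymm {A : Matrix (Fin n) (Fin n) ℝ} (hA : A.IsSymm) : (gibbs A).IsSymm :=
  hA.exp.smul _

theorem trace_gibbs [NeZero n] {A : Matrix (Fin n) (Fin n) ℝ} (hA : A.IsSymm) :
    (gibbs A).trace = 1 := by
  rw [gibbs, Matrix.trace_smul, smul_eq_mul, inv_mul_cancel₀ (trace_exp_pos hA).ne']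

theorem norm_gibbs_le {A : Matrix (Fin n) (Fin n) ℝ} (hA : A.IsSymm) : ‖gibbs A‖ ≤ 1 := by
  rcases Nat.eq_zero_or_pos n with rfl | hn
  · rw [Subsingleton.elim (gibbs A) 0, norm_zero]; exact zero_le_one
  have : NeZero n := ⟨hn.ne'⟩
  have hZ := trace_exp_pos hA
  rw [gibbs, norm_smul, Real.norm_of_nonneg (inv_nonneg.2 hZ.le), inv_mul_le_one₀ hZ]
  refine abs_le_of_sq_le_sq' ?_ hZ.le |>.2
  rw [norm_sq_eq_trace hA.exp]
  obtain ⟨U, a, hU, hU', rfl⟩ := exists_orthogonal_diagonalization hA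
  rw [exp_conj_diagonal hU, trace_conj_diagonal_mul_self hU', trace_conj_diagonal hU', sq, sum_mul]
  refine sum_le_sum fun i _ => mul_le_mul_of_nonneg_left ?_ (Real.exp_pos _).le
  exact single_le_sum (f := fun i => Real.exp (a i)) (fun _ _ => (Real.exp_pos _).le) (mem_univ i)

/-- The Peierls–Bogoliubov inequality with a quadratic remainder: Jensen's inequality for the
exponential, applied to the differences `b j - a i` of eigenvalues under the weights formed by the
Gibbs state of `A` and the squared overlaps of the two eigenbases. -/
theorem logPart_ge_aux [NeZero n] {U V : Matrix (Fin n) (Fin n) ℝ} {a b : Fin n → ℝ}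
    (hU : U * Uᵀ = 1) (hU' : Uᵀ * U = 1) (hV : V * Vᵀ = 1) (hV' : Vᵀ * V = 1) {R : ℝ}
    (ha : ∀ i, |a i| ≤ R) (hb : ∀ i, |b i| ≤ R) :
    ∃ m : ℝ, logPart (U * diagonal a * Uᵀ)
      + (gibbs (U * diagonal a * Uᵀ) * (V * diagonal b * Vᵀ - U * diagonal a * Uᵀ)).trace
      + Real.exp (-(2 * R)) / (n * ((4 * R + 2) * (4 * R + 2 + 2))) *
        ∑ i, ∑ j, (b j - a i - m) ^ 2 * (Uᵀ * V) i j ^ 2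
      ≤ logPart (V * diagonal b * Vᵀ) := by
  have hR : 0 ≤ R := (abs_nonneg _).trans (ha 0)
  set p : Fin n → Fin n → ℝ := fun i j => (Uᵀ * V) i j ^ 2 with hp
  have hp1 : ∀ i, ∑ j, p i j = 1 := sum_overlap hU' hV
  have hp2 : ∀ j, ∑ i, p i j = 1 := sum_overlap' hU hV'
  have hp0 : ∀ i j, 0 ≤ p i j := fun i j => sq_nonneg _
  set Z := ∑ i, Real.exp (a i) with hZ
  have hZ0 : 0 < Z := sum_pos (fun i _ => Real.exp_pos _) univ_nonempty
  set w : Fin n × Fin n → ℝ := fun q => Z⁻¹ * Real.exp (a q.1) * p q.1 q.2 with hw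
  set x : Fin n × Fin n → ℝ := fun q => b q.2 - a q.1 with hx
  have hw0 : ∀ q, 0 ≤ w q := fun q =>
    mul_nonneg (mul_nonneg (inv_nonneg.2 hZ0.le) (Real.exp_pos _).le) (hp0 _ _)
  have hw1 : ∑ q, w q = 1 := by
    simp only [hw, Fintype.sum_prod_type, ← mul_sum, hp1, mul_one]
    rw [← hZ]; exact inv_mul_cancel₀ hZ0.ne'
  have hxR : ∀ q, |x q| ≤ 2 * R := fun q => by
    have := abs_sub (b q.2) (a q.1); linarith [ha q.1, hb q.2]
  set m := ∑ q, w q * x q with hm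
  have hmR : |m| ≤ 2 * R := by
    calc |m| ≤ ∑ q, |w q * x q| := abs_sum_le_sum_abs _ _
      _ ≤ ∑ q, w q * (2 * R) := sum_le_sum fun q _ => by
          rw [abs_mul, abs_of_nonneg (hw0 q)]
          exact mul_le_mul_of_nonneg_left (hxR q) (hw0 q)
      _ = 2 * R := by rw [← sum_mul, hw1, one_mul]
  refine ⟨m, ?_⟩
  have key := log_sum_exp_ge w x hw0 hw1 (K := 4 * R + 2) (by linarith) (fun q => by
    have := abs_sub (x q) m; rw [← hm]; linarith [hxR q])
  rw [← hm] at key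
  have hE : ∑ q, w q * Real.exp (x q) = Z⁻¹ * ∑ j, Real.exp (b j) := by
    have : ∀ q, w q * Real.exp (x q) = Z⁻¹ * (Real.exp (b q.2) * p q.1 q.2) := fun q => by
      simp only [hw, hx, Real.exp_sub]
      have := (Real.exp_pos (a q.1)).ne'
      field_simp
    simp only [this, ← mul_sum, Fintype.sum_prod_type]
    rw [sum_comm]
    simp only [← mul_sum, hp2, mul_one]
  have hlogA : logPart (U * diagonal a * Uᵀ) = Real.log Z := by
    rw [logPart, exp_conj_diagonal hU, trace_conj_diagonal hU']
  have hlogB : logPart (V * diagonal b * Vᵀ) = Real.log (∑ j, Real.exp (b j)) := by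
    rw [logPart, exp_conj_diagonal hV, trace_conj_diagonal hV']
  have hbpos : 0 < ∑ j, Real.exp (b j) := sum_pos (fun i _ => Real.exp_pos _) univ_nonempty
  rw [hE, Real.log_mul (inv_ne_zero hZ0.ne') hbpos.ne', Real.log_inv] at key
  have htr : (gibbs (U * diagonal a * Uᵀ) * (V * diagonal b * Vᵀ - U * diagonal a * Uᵀ)).trace
      = m := by
    rw [Matrix.mul_sub, Matrix.trace_sub, gibbs, exp_conj_diagonal hU, trace_conj_diagonal hU',
      Matrix.smul_mul, Matrix.trace_smul, Matrix.smul_mul, Matrix.trace_smul,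
      trace_conj_diagonal_mul, trace_conj_diagonal_mul_self hU', ← hZ]
    simp only [hm, hw, hx, Fintype.sum_prod_type, smul_eq_mul]
    rw [← mul_sub, ← sum_sub_distrib, mul_sum]
    refine sum_congr rfl fun i _ => ?_
    have h2 := hp1 i
    calc Z⁻¹ * (∑ j, Real.exp (a i) * b j * (Uᵀ * V) i j ^ 2 - Real.exp (a i) * a i)
        = Z⁻¹ * (∑ j, Real.exp (a i) * b j * p i j - Real.exp (a i) * a i * ∑ j, p i j) := by
          rw [h2, mul_one]
      _ = _ := by
          rw [mul_sum, ← sum_sub_distrib, mul_sum]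
          exact sum_congr rfl fun j _ => by ring
  rw [hlogA, hlogB, htr]
  have hn : (0 : ℝ) < n := Nat.cast_pos.2 (NeZero.pos n)
  have hZle : Z ≤ n * Real.exp R := by
    calc Z ≤ ∑ _i : Fin n, Real.exp R :=
          sum_le_sum fun i _ => Real.exp_le_exp.2 (abs_le.1 (ha i)).2
      _ = n * Real.exp R := by simp
  have hwlow : ∀ i, Real.exp (-(2 * R)) / n ≤ Z⁻¹ * Real.exp (a i) := fun i => by
    rw [inv_mul_eq_div, div_le_div_iff₀ hn hZ0]
    calc Real.exp (-(2 * R)) * Z ≤ Real.exp (-(2 * R)) * (n * Real.exp R) :=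
          mul_le_mul_of_nonneg_left hZle (Real.exp_pos _).le
      _ = Real.exp (-R) * n := by
          rw [show -(2 * R) = -R + -R by ring, Real.exp_add, Real.exp_neg R]
          have := (Real.exp_pos R).ne'
          field_simp
      _ ≤ _ := mul_le_mul_of_nonneg_right
          (Real.exp_le_exp.2 (abs_le.1 (ha i)).1) hn.le
  have hvar : Real.exp (-(2 * R)) / n * ∑ i, ∑ j, (b j - a i - m) ^ 2 * p i j
      ≤ ∑ q, w q * (x q - m) ^ 2 := by
    rw [Fintype.sum_prod_type, mul_sum]
    refine sum_le_sum fun i _ => ?_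
    rw [mul_sum]
    refine sum_le_sum fun j _ => ?_
    have := mul_le_mul_of_nonneg_right (hwlow i) (mul_nonneg (sq_nonneg (b j - a i - m)) (hp0 i j))
    simp only [hw, hx]
    linarith
  have hK : 0 < (4 * R + 2) * (4 * R + 2 + 2) := by positivity
  have h5 := div_le_div_of_nonneg_right hvar hK.le
  have h6 : Real.exp (-(2 * R)) / (n * ((4 * R + 2) * (4 * R + 2 + 2))) *
        ∑ i, ∑ j, (b j - a i - m) ^ 2 * p i j = Real.exp (-(2 * R)) / n *
        (∑ i, ∑ j, (b j - a i - m) ^ 2 * p i j) / ((4 * R + 2) * (4 * R + 2 + 2)) := by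
    field_simp
  rw [h6]
  linarith

theorem logPart_ge {A B : Matrix (Fin n) (Fin n) ℝ} (hA : A.IsSymm) (hB : B.IsSymm) :
    logPart A + (gibbs A * (B - A)).trace ≤ logPart B := by
  rcases Nat.eq_zero_or_pos n with rfl | hn
  · rw [Subsingleton.elim A B]; simp
  have : NeZero n := ⟨hn.ne'⟩
  obtain ⟨U, a, hU, hU', rfl⟩ := exists_orthogonal_diagonalization hA
  obtain ⟨V, b, hV, hV', rfl⟩ := exists_orthogonal_diagonalization hB
  obtain ⟨m, hm⟩ := logPart_ge_aux hU hU' hV hV'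
    (R := ‖U * diagonal a * Uᵀ‖ + ‖V * diagonal b * Vᵀ‖)
    (fun i => (abs_le_norm_conj_diagonal hU' a i).trans (le_add_of_nonneg_right (norm_nonneg _)))
    (fun i => (abs_le_norm_conj_diagonal hV' b i).trans (le_add_of_nonneg_left (norm_nonneg _)))
  refine le_trans (le_add_of_nonneg_right ?_) hm
  exact mul_nonneg (by positivity)
    (sum_nonneg fun i _ => sum_nonneg fun j _ => mul_nonneg (sq_nonneg _) (sq_nonneg _))

/-- Local strong convexity of the log-partition function modulo the multiples of the identity. -/
theorem exists_logPart_strong (R : ℝ) : ∃ c : ℝ, 0 < c ∧ ∀ A B : Matrix (Fin n) (Fin n) ℝ,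
    A.IsSymm → B.IsSymm → ‖A‖ ≤ R → ‖B‖ ≤ R → A.trace = B.trace →
    logPart A + (gibbs A * (B - A)).trace + c * ‖B - A‖ ^ 2 ≤ logPart B := by
  rcases Nat.eq_zero_or_pos n with rfl | hn
  · exact ⟨1, one_pos, fun A B _ _ _ _ _ => by rw [Subsingleton.elim A B]; simp⟩
  have : NeZero n := ⟨hn.ne'⟩
  by_cases hR : R < 0
  · exact ⟨1, one_pos, fun A B _ _ h => absurd (h.trans_lt hR) (norm_nonneg _).not_gt⟩
  push Not at hR
  have hn' : (0 : ℝ) < n := Nat.cast_pos.2 hn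
  refine ⟨Real.exp (-(2 * R)) / (n * ((4 * R + 2) * (4 * R + 2 + 2))), by positivity, ?_⟩
  intro A B hA hB hAR hBR htr
  have hBA : (B - A).IsSymm := hB.sub hA
  obtain ⟨U, a, hU, hU', rfl⟩ := exists_orthogonal_diagonalization hA
  obtain ⟨V, b, hV, hV', rfl⟩ := exists_orthogonal_diagonalization hB
  obtain ⟨m, hm⟩ := logPart_ge_aux hU hU' hV hV' (R := R)
    (fun i => (abs_le_norm_conj_diagonal hU' a i).trans hAR)
    (fun i => (abs_le_norm_conj_diagonal hV' b i).trans hBR)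
  refine le_trans ?_ hm
  gcongr
  rw [trace_conj_diagonal hU', trace_conj_diagonal hV'] at htr
  have hp1 : ∀ i, ∑ j, (Uᵀ * V) i j ^ 2 = 1 := sum_overlap hU' hV
  have hp2 : ∀ j, ∑ i, (Uᵀ * V) i j ^ 2 = 1 := sum_overlap' hU hV'
  have e1 : ‖V * diagonal b * Vᵀ - U * diagonal a * Uᵀ‖ ^ 2
      = ∑ j, b j ^ 2 + ∑ i, a i ^ 2 - 2 * ∑ i, ∑ j, a i * b j * (Uᵀ * V) i j ^ 2 := by
    rw [norm_sq_eq_trace hBA, Matrix.sub_mul, Matrix.mul_sub, Matrix.mul_sub]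
    simp only [Matrix.trace_sub]
    rw [Matrix.trace_mul_comm (V * diagonal b * Vᵀ) (U * diagonal a * Uᵀ),
      trace_conj_diagonal_mul U V, trace_conj_diagonal_mul_self hU',
      trace_conj_diagonal_mul_self hV']
    simp only [sq]; ring
  -- As the traces agree, centring at `m` only adds `n m²` to the remainder.
  have e2 : ∑ i, ∑ j, (b j - a i - m) ^ 2 * (Uᵀ * V) i j ^ 2
      = ∑ j, b j ^ 2 + ∑ i, a i ^ 2 - 2 * ∑ i, ∑ j, a i * b j * (Uᵀ * V) i j ^ 2
        - 2 * m * (∑ j, b j - ∑ i, a i) + n * m ^ 2 := by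
    have s1 : ∑ j, b j ^ 2 = ∑ i, ∑ j, b j ^ 2 * (Uᵀ * V) i j ^ 2 := by
      rw [sum_comm]; simp only [← mul_sum, hp2, mul_one]
    have s2 : ∑ j, b j = ∑ i, ∑ j, b j * (Uᵀ * V) i j ^ 2 := by
      rw [sum_comm]; simp only [← mul_sum, hp2, mul_one]
    have s3 : ∑ i, a i ^ 2 = ∑ i, ∑ j, a i ^ 2 * (Uᵀ * V) i j ^ 2 := by
      simp only [← mul_sum, hp1, mul_one]
    have s4 : ∑ i, a i = ∑ i, ∑ j, a i * (Uᵀ * V) i j ^ 2 := by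
      simp only [← mul_sum, hp1, mul_one]
    have s5 : (n : ℝ) * m ^ 2 = ∑ i, ∑ j, m ^ 2 * (Uᵀ * V) i j ^ 2 := by
      simp only [← mul_sum, hp1, mul_one]; simp
    rw [s1, s2, s3, s4, s5]
    simp only [mul_sum, ← sum_add_distrib, ← sum_sub_distrib]
    exact sum_congr rfl fun i _ => sum_congr rfl fun j _ => by ring
  rw [e1, e2, htr]
  nlinarith [mul_nonneg hn'.le (sq_nonneg m)]

/-! ### Convexity of the smoothed shear and its gradient -/

theorem g_eq_logPart (θ : ℝ) (A : Matrix (Fin n) (Fin n) ℝ) :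
    g θ A = (1 / θ) * (logPart (θ • A) + logPart (-(θ • A))) := by
  rw [g, logPart, logPart]; ring

theorem G_eq_gibbs (θ : ℝ) (A : Matrix (Fin n) (Fin n) ℝ) :
    G θ A = gibbs (θ • A) - gibbs (-(θ • A)) := rfl

theorem G_isSymm {A : Matrix (Fin n) (Fin n) ℝ} (hA : A.IsSymm) : (G θ A).IsSymm := by
  rw [G_eq_gibbs]
  exact (gibbs_isSymm (hA.smul θ)).sub (gibbs_isSymm (hA.smul θ).neg)

theorem trace_G {A : Matrix (Fin n) (Fin n) ℝ} (hA : A.IsSymm) : (G θ A).trace = 0 := by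
  rcases Nat.eq_zero_or_pos n with rfl | hn
  · simp
  have : NeZero n := ⟨hn.ne'⟩
  rw [G_eq_gibbs, Matrix.trace_sub, trace_gibbs (hA.smul θ), trace_gibbs (hA.smul θ).neg, sub_self]

theorem norm_G_le {A : Matrix (Fin n) (Fin n) ℝ} (hA : A.IsSymm) : ‖G θ A‖ ≤ 2 := by
  rw [G_eq_gibbs]
  linarith [norm_sub_le (gibbs (θ • A)) (gibbs (-(θ • A))), norm_gibbs_le (hA.smul θ),
    norm_gibbs_le (hA.smul θ).neg]

theorem G_commute (θ : ℝ) (A : Matrix (Fin n) (Fin n) ℝ) : Commute (G θ A) A := by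
  have h1 : Commute (NormedSpace.exp (θ • A)) A := by
    have : Commute (θ • A) A := (Commute.refl A).smul_left θ
    exact this.exp_left
  have h2 : Commute (NormedSpace.exp (-(θ • A))) A := by
    have : Commute (-(θ • A)) A := ((Commute.refl A).smul_left θ).neg_left
    exact this.exp_left
  exact (h1.smul_left _).sub_left (h2.smul_left _)

/-- The gradient inequality for `g`, with the quadratic remainder inherited from that of the
log-partition function. -/
theorem g_ge_of_logPart_ge (hθ : 0 < θ) {c : ℝ} {A B : Matrix (Fin n) (Fin n) ℝ}
    (hA : A.IsSymm) (hB : B.IsSymm)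
    (h : logPart (θ • A) + (gibbs (θ • A) * (θ • B - θ • A)).trace + c * ‖θ • B - θ • A‖ ^ 2
      ≤ logPart (θ • B)) :
    g θ A + (G θ A * (B - A)).trace + c * θ * ‖B - A‖ ^ 2 ≤ g θ B := by
  have h2 := logPart_ge (hA.smul θ).neg (hB.smul θ).neg
  rw [show -(θ • B) - -(θ • A) = (-θ) • (B - A) by module, Matrix.mul_smul, Matrix.trace_smul,
    smul_eq_mul] at h2
  rw [← smul_sub, Matrix.mul_smul, Matrix.trace_smul, smul_eq_mul, norm_smul, mul_pow,
    Real.norm_of_nonneg hθ.le] at h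
  rw [g_eq_logPart, g_eq_logPart, G_eq_gibbs, Matrix.sub_mul, Matrix.trace_sub]
  have h3 := mul_le_mul_of_nonneg_left (add_le_add h h2) (one_div_pos.2 hθ).le
  refine le_trans (le_of_eq ?_) h3
  field_simp
  ring

theorem g_ge (hθ : 0 < θ) {A B : Matrix (Fin n) (Fin n) ℝ} (hA : A.IsSymm) (hB : B.IsSymm) :
    g θ A + (G θ A * (B - A)).trace ≤ g θ B := by
  have := g_ge_of_logPart_ge (c := 0) hθ hA hB
    (by simpa using logPart_ge (hA.smul θ) (hB.smul θ))
  simpa using this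

/-- `g` attains its minimum `2 log n / θ` at the zero matrix. -/
theorem two_mul_log_le_g (hθ : 0 < θ) {A : Matrix (Fin n) (Fin n) ℝ} (hA : A.IsSymm) :
    2 * Real.log n / θ ≤ g θ A := by
  have h0 : (0 : Matrix (Fin n) (Fin n) ℝ).IsSymm := Matrix.isSymm_zero
  have h := g_ge hθ h0 hA
  have hG : G θ (0 : Matrix (Fin n) (Fin n) ℝ) = 0 := by simp [G]
  have hg : g θ (0 : Matrix (Fin n) (Fin n) ℝ) = 2 * Real.log n / θ := by
    simp [g]; ring
  rw [hG, hg] at h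
  simpa using h

theorem g_nonneg (hθ : 0 < θ) {A : Matrix (Fin n) (Fin n) ℝ} (hA : A.IsSymm) : 0 ≤ g θ A :=
  le_trans (div_nonneg (mul_nonneg two_pos.le (Real.log_natCast_nonneg n)) hθ.le)
    (two_mul_log_le_g hθ hA)

/-- `g` is constant along the direction `1`, by convexity, since its gradient is traceless. -/
theorem g_sub_smul_one (hθ : 0 < θ) {A : Matrix (Fin n) (Fin n) ℝ} (hA : A.IsSymm) (c : ℝ) :
    g θ (A - c • 1) = g θ A := by
  have hA' : (A - c • (1 : Matrix (Fin n) (Fin n) ℝ)).IsSymm := hA.sub (Matrix.isSymm_one.smul c)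
  have h1 := g_ge hθ hA hA'
  have h2 := g_ge hθ hA' hA
  rw [sub_sub_cancel_left, Matrix.mul_neg, Matrix.mul_smul, Matrix.mul_one, Matrix.trace_neg,
    Matrix.trace_smul, trace_G hA] at h1
  rw [sub_sub_cancel, Matrix.mul_smul, Matrix.mul_one, Matrix.trace_smul, trace_G hA'] at h2
  simp only [smul_zero, neg_zero, add_zero] at h1 h2
  exact le_antisymm h2 h1

theorem g_le (hθ : 0 < θ) {A : Matrix (Fin n) (Fin n) ℝ} (hA : A.IsSymm) :
    g θ A ≤ g θ (0 : Matrix (Fin n) (Fin n) ℝ) + 2 * ‖A‖ := by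
  have h := g_ge hθ hA (Matrix.isSymm_zero)
  have h2 := abs_trace_mul_le (G θ A) (0 - A)
  rw [zero_sub, norm_neg] at h2
  rw [zero_sub] at h
  have h3 := mul_le_mul_of_nonneg_right (norm_G_le (θ := θ) hA) (norm_nonneg A)
  linarith [(abs_le.1 h2).1]

/-- On traceless symmetric matrices `g` dominates every eigenvalue, hence the norm. -/
theorem norm_sq_le_g_sq (hθ : 0 < θ) {A : Matrix (Fin n) (Fin n) ℝ} (hA : A.IsSymm)
    (htr : A.trace = 0) : ‖A‖ ^ 2 ≤ n * g θ A ^ 2 := by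
  rcases Nat.eq_zero_or_pos n with rfl | hn
  · rw [Subsingleton.elim A 0]; simp
  have hn' : (0 : ℝ) < n := Nat.cast_pos.2 hn
  obtain ⟨U, a, hU, hU', rfl⟩ := exists_orthogonal_diagonalization hA
  have hlog : ∀ (s : ℝ) (i : Fin n), s * a i ≤ logPart (s • (U * diagonal a * Uᵀ)) := by
    intro s i
    have e : s • (U * diagonal a * Uᵀ) = U * diagonal (s • a) * Uᵀ := by
      rw [Matrix.diagonal_smul, Matrix.mul_smul, Matrix.smul_mul]
    rw [e, logPart, exp_conj_diagonal hU, trace_conj_diagonal hU',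
      Real.le_log_iff_exp_le (sum_pos (fun i _ => Real.exp_pos _) ⟨i, mem_univ i⟩)]
    exact single_le_sum (f := fun i => Real.exp ((s • a) i)) (fun _ _ => (Real.exp_pos _).le)
      (mem_univ i)
  have hdiam : ∀ i j, a i - a j ≤ g θ (U * diagonal a * Uᵀ) := fun i j => by
    rw [g_eq_logPart, ← neg_smul, one_div, le_inv_mul_iff₀ hθ]
    have := hlog θ i; have := hlog (-θ) j
    linarith
  rw [trace_conj_diagonal hU'] at htr
  have habs : ∀ i, |a i| ≤ g θ (U * diagonal a * Uᵀ) := fun i => by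
    have h1 : ∑ j, (a i - a j) ≤ ∑ _j : Fin n, g θ (U * diagonal a * Uᵀ) :=
      sum_le_sum fun j _ => hdiam i j
    have h2 : ∑ j, (a j - a i) ≤ ∑ _j : Fin n, g θ (U * diagonal a * Uᵀ) :=
      sum_le_sum fun j _ => hdiam j i
    simp only [sum_sub_distrib, htr, sum_const, card_univ, Fintype.card_fin, nsmul_eq_mul] at h1 h2
    rw [abs_le]
    constructor <;> nlinarith
  rw [norm_sq_eq_trace hA, trace_conj_diagonal_mul_self hU']
  calc ∑ i, a i * a i ≤ ∑ _i : Fin n, g θ (U * diagonal a * Uᵀ) ^ 2 := sum_le_sum fun i _ => by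
        rw [← sq, ← sq_abs]; exact pow_le_pow_left₀ (abs_nonneg _) (habs i) 2
    _ = _ := by simp

/-- Half the gradient of `g²`. -/
def gradSq (θ : ℝ) (A : Matrix (Fin n) (Fin n) ℝ) : Matrix (Fin n) (Fin n) ℝ := g θ A • G θ A

theorem gradSq_isSymm {A : Matrix (Fin n) (Fin n) ℝ} (hA : A.IsSymm) : (gradSq θ A).IsSymm :=
  (G_isSymm hA).smul _

theorem trace_gradSq {A : Matrix (Fin n) (Fin n) ℝ} (hA : A.IsSymm) : (gradSq θ A).trace = 0 := by
  rw [gradSq, Matrix.trace_smul, trace_G hA, smul_zero]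

theorem gradSq_commute (θ : ℝ) (A : Matrix (Fin n) (Fin n) ℝ) : Commute (gradSq θ A) A :=
  (G_commute θ A).smul_left _

theorem norm_gradSq_le (hθ : 0 < θ) {A : Matrix (Fin n) (Fin n) ℝ} (hA : A.IsSymm) :
    ‖gradSq θ A‖ ≤ 2 * g θ A := by
  rw [gradSq, norm_smul, Real.norm_of_nonneg (g_nonneg hθ hA), mul_comm]
  exact mul_le_mul_of_nonneg_right (norm_G_le hA) (g_nonneg hθ hA)

/-- The gradient inequality for `g²`; it combines that for `g` with `g ≥ 0`. -/
theorem g_sq_ge (hθ : 0 < θ) {A B : Matrix (Fin n) (Fin n) ℝ} (hA : A.IsSymm) (hB : B.IsSymm) :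
    g θ A ^ 2 + 2 * (gradSq θ A * (B - A)).trace ≤ g θ B ^ 2 := by
  have h := g_ge hθ hA hB
  rw [gradSq, Matrix.smul_mul, Matrix.trace_smul, smul_eq_mul]
  nlinarith [sq_nonneg (g θ B - g θ A), mul_le_mul_of_nonneg_left h (g_nonneg hθ hA)]

/-- `gradSq` is strongly monotone on bounded sets of traceless symmetric matrices; in particular
it is injective there, with a locally Lipschitz inverse. -/
theorem exists_norm_sub_le_gradSq (hθ : 0 < θ) (R : ℝ) : ∃ c : ℝ, 0 < c ∧
    ∀ A B : Matrix (Fin n) (Fin n) ℝ, A.IsSymm → B.IsSymm → A.trace = 0 → B.trace = 0 →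
      ‖A‖ ≤ R → ‖B‖ ≤ R → ‖A - B‖ ≤ c * ‖gradSq θ A - gradSq θ B‖ := by
  -- For `n < 2` traceless matrices vanish; for `n ≥ 2` the minimum `2 log n / θ` of `g` is positive.
  rcases Nat.lt_or_ge n 2 with hn | hn
  · refine ⟨1, one_pos, fun A B hA hB htA htB _ _ => ?_⟩
    have : A = B := by
      interval_cases n
      · exact Subsingleton.elim _ _
      · ext i j
        simp only [Matrix.trace, Matrix.diag, Finset.univ_unique, sum_singleton] at htA htB
        rw [Subsingleton.elim i default, Subsingleton.elim j default, htA, htB]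
    rw [this]; simp
  obtain ⟨c, hc, H⟩ := exists_logPart_strong (n := n) (θ * R)
  set m : ℝ := 2 * Real.log n / θ with hm
  have hm0 : 0 < m := div_pos (mul_pos two_pos (Real.log_pos (by exact_mod_cast hn))) hθ
  have key : ∀ A B : Matrix (Fin n) (Fin n) ℝ, A.IsSymm → B.IsSymm → A.trace = 0 → B.trace = 0 →
      ‖A‖ ≤ R → ‖B‖ ≤ R →
      g θ A ^ 2 + 2 * (gradSq θ A * (B - A)).trace + 2 * (m * (c * θ)) * ‖B - A‖ ^ 2
        ≤ g θ B ^ 2 := by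
    intro A B hA hB htA htB hAR hBR
    have h := g_ge_of_logPart_ge hθ hA hB (H (θ • A) (θ • B) (hA.smul θ) (hB.smul θ)
      (by rw [norm_smul, Real.norm_of_nonneg hθ.le]; exact mul_le_mul_of_nonneg_left hAR hθ.le)
      (by rw [norm_smul, Real.norm_of_nonneg hθ.le]; exact mul_le_mul_of_nonneg_left hBR hθ.le)
      (by rw [Matrix.trace_smul, Matrix.trace_smul, htA, htB]))
    rw [gradSq, Matrix.smul_mul, Matrix.trace_smul, smul_eq_mul]
    have h1 : m * (c * θ * ‖B - A‖ ^ 2) ≤ g θ A * (c * θ * ‖B - A‖ ^ 2) :=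
      mul_le_mul_of_nonneg_right (two_mul_log_le_g hθ hA) (by positivity)
    nlinarith [sq_nonneg (g θ B - g θ A), mul_le_mul_of_nonneg_left h (g_nonneg hθ hA)]
  refine ⟨(2 * (m * (c * θ)))⁻¹, by positivity, fun A B hA hB htA htB hAR hBR => ?_⟩
  have h1 := key A B hA hB htA htB hAR hBR
  have h2 := key B A hB hA htB htA hBR hAR
  have h3 := abs_trace_mul_le (gradSq θ A - gradSq θ B) (A - B)
  rw [norm_sub_rev B A] at h1
  have h4 : ((gradSq θ A - gradSq θ B) * (A - B)).trace
      = -(gradSq θ A * (B - A)).trace - (gradSq θ B * (A - B)).trace := by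
    rw [Matrix.sub_mul, Matrix.trace_sub, ← neg_sub B A, Matrix.mul_neg, Matrix.trace_neg]
  have h5 : 2 * (m * (c * θ)) * ‖A - B‖ ^ 2 ≤ ‖gradSq θ A - gradSq θ B‖ * ‖A - B‖ := by
    have := (abs_le.1 h3).2
    linarith
  rw [le_inv_mul_iff₀ (by positivity)]
  rcases (norm_nonneg (A - B)).eq_or_lt with h0 | h0
  · rw [← h0, mul_zero]; exact norm_nonneg _
  · have : 2 * (m * (c * θ)) * ‖A - B‖ * ‖A - B‖ ≤ ‖gradSq θ A - gradSq θ B‖ * ‖A - B‖ := by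
      linarith
    exact le_of_mul_le_mul_right this h0

/-- `gradSq` is proper on traceless symmetric matrices. -/
theorem exists_norm_le_of_norm_gradSq_le (hθ : 0 < θ) (M : ℝ) : ∃ R : ℝ,
    ∀ A : Matrix (Fin n) (Fin n) ℝ, A.IsSymm → A.trace = 0 → ‖gradSq θ A‖ ≤ M → ‖A‖ ≤ R := by
  refine ⟨n * g θ (0 : Matrix (Fin n) (Fin n) ℝ) ^ 2 + 2 * n * |M| + 1, fun A hA htA hM => ?_⟩
  have h1 := g_sq_ge hθ hA Matrix.isSymm_zero
  have h2 := norm_sq_le_g_sq hθ hA htA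
  have h3 := abs_trace_mul_le (gradSq θ A) (0 - A)
  rw [zero_sub] at h1
  rw [zero_sub, norm_neg] at h3
  have h4 : ‖gradSq θ A‖ * ‖A‖ ≤ |M| * ‖A‖ :=
    mul_le_mul_of_nonneg_right (hM.trans (le_abs_self M)) (norm_nonneg A)
  have h5 : g θ A ^ 2 ≤ g θ (0 : Matrix (Fin n) (Fin n) ℝ) ^ 2 + 2 * (|M| * ‖A‖) := by
    linarith [(abs_le.1 h3).1]
  have h6 : ‖A‖ ^ 2 ≤ n * (g θ (0 : Matrix (Fin n) (Fin n) ℝ) ^ 2 + 2 * (|M| * ‖A‖)) :=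
    h2.trans (mul_le_mul_of_nonneg_left h5 (Nat.cast_nonneg n))
  by_contra hcon
  push Not at hcon
  have h7 : 0 ≤ n * g θ (0 : Matrix (Fin n) (Fin n) ℝ) ^ 2 := by positivity
  have h8 : 0 ≤ 2 * n * |M| := by positivity
  nlinarith [norm_nonneg A]

theorem continuousAt_logPart {A : Matrix (Fin n) (Fin n) ℝ} (hA : A.IsSymm) :
    ContinuousAt logPart A := by
  rcases Nat.eq_zero_or_pos n with rfl | hn
  · exact (continuous_of_const fun A B => by rw [Subsingleton.elim A B]).continuousAt
  have : NeZero n := ⟨hn.ne'⟩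
  have hc : Continuous fun A : Matrix (Fin n) (Fin n) ℝ => (NormedSpace.exp A).trace :=
    (NormedSpace.exp_continuous).matrix_trace
  exact hc.continuousAt.log (trace_exp_pos hA).ne'

theorem continuousAt_gibbs {A : Matrix (Fin n) (Fin n) ℝ} (hA : A.IsSymm) :
    ContinuousAt gibbs A := by
  rcases Nat.eq_zero_or_pos n with rfl | hn
  · exact (continuous_of_const fun A B => by rw [Subsingleton.elim A B]).continuousAt
  have : NeZero n := ⟨hn.ne'⟩
  have hc : Continuous fun A : Matrix (Fin n) (Fin n) ℝ => (NormedSpace.exp A).trace :=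
    (NormedSpace.exp_continuous).matrix_trace
  exact (hc.continuousAt.inv₀ (trace_exp_pos hA).ne').smul NormedSpace.exp_continuous.continuousAt

theorem continuousAt_g {A : Matrix (Fin n) (Fin n) ℝ} (hA : A.IsSymm) :
    ContinuousAt (g θ) A := by
  have h1 : ContinuousAt (fun A : Matrix (Fin n) (Fin n) ℝ => logPart (θ • A)) A :=
    ContinuousAt.comp (f := fun A => θ • A) (continuousAt_logPart (hA.smul θ))
      (continuous_const_smul θ).continuousAt
  have h2 : ContinuousAt (fun A : Matrix (Fin n) (Fin n) ℝ => logPart (-(θ • A))) A :=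
    ContinuousAt.comp (f := fun A => -(θ • A)) (continuousAt_logPart (hA.smul θ).neg)
      (continuous_const_smul θ).neg.continuousAt
  have : (g θ : Matrix (Fin n) (Fin n) ℝ → ℝ)
      = fun A => (1 / θ) * (logPart (θ • A) + logPart (-(θ • A))) := funext fun A => g_eq_logPart θ A
  rw [this]
  exact continuousAt_const.mul (h1.add h2)

theorem continuousAt_gradSq {A : Matrix (Fin n) (Fin n) ℝ} (hA : A.IsSymm) :
    ContinuousAt (gradSq θ) A := by
  have h1 : ContinuousAt (fun A : Matrix (Fin n) (Fin n) ℝ => gibbs (θ • A)) A :=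
    ContinuousAt.comp (f := fun A => θ • A) (continuousAt_gibbs (hA.smul θ))
      (continuous_const_smul θ).continuousAt
  have h2 : ContinuousAt (fun A : Matrix (Fin n) (Fin n) ℝ => gibbs (-(θ • A))) A :=
    ContinuousAt.comp (f := fun A => -(θ • A)) (continuousAt_gibbs (hA.smul θ).neg)
      (continuous_const_smul θ).neg.continuousAt
  exact (continuousAt_g hA).smul (h1.sub h2)

/-- A map continuous at symmetric matrices preserves measurability of almost everywhere symmetric
matrix functions. -/
theorem aestronglyMeasurable_comp_symm {E : Type*} [NormedAddCommGroup E]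
    {φ : Matrix (Fin n) (Fin n) ℝ → E}
    (hφ : ∀ A : Matrix (Fin n) (Fin n) ℝ, A.IsSymm → ContinuousAt φ A) {μ : Measure ℝ}
    {A : ℝ → Matrix (Fin n) (Fin n) ℝ} (hA : AEStronglyMeasurable A μ)
    (hs : ∀ᵐ t ∂μ, (A t).IsSymm) : AEStronglyMeasurable (fun t => φ (A t)) μ := by
  have hc : Continuous fun X : Matrix (Fin n) (Fin n) ℝ => φ ((1 / 2 : ℝ) • (X + Xᵀ)) := by
    rw [continuous_iff_continuousAt]
    intro X
    refine ContinuousAt.comp (f := fun X : Matrix (Fin n) (Fin n) ℝ => (1 / 2 : ℝ) • (X + Xᵀ))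
      (hφ _ ?_) ?_
    · exact (Matrix.isSymm_add_transpose_self X).smul _
    · have : Continuous fun X : Matrix (Fin n) (Fin n) ℝ => (1 / 2 : ℝ) • (X + Xᵀ) := by fun_prop
      exact this.continuousAt
  refine (hc.comp_aestronglyMeasurable hA).congr ?_
  filter_upwards [hs] with t ht
  have : (1 / 2 : ℝ) • (A t + (A t)ᵀ) = A t := by
    rw [ht.eq, ← two_smul ℝ, smul_smul]; norm_num
  rw [this]

end LogPartition

/-! ### Absolutely continuous functions with a given derivative -/

/-- Lebesgue measure on `[0,1]`. -/
abbrev unitMeasure : Measure ℝ := volume.restrict (Icc (0 : ℝ) 1)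

/-- `f` is absolutely continuous on `[0,1]` with almost everywhere derivative `f'`. -/
structure HasACDeriv (f f' : ℝ → ℝ) : Prop where
  ac : AbsolutelyContinuousOnInterval f 0 1
  deriv : ∀ᵐ t ∂unitMeasure, HasDerivAt f (f' t) t

theorem ae_unitMeasure_iff {p : ℝ → Prop} :
    (∀ᵐ t ∂unitMeasure, p t) ↔ ∀ᵐ t, t ∈ Icc (0 : ℝ) 1 → p t :=
  ae_restrict_iff' measurableSet_Icc

theorem intervalIntegrable_iff_unitMeasure {f : ℝ → ℝ} :
    IntervalIntegrable f volume 0 1 ↔ Integrable f unitMeasure :=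
  intervalIntegrable_iff_integrableOn_Icc_of_le zero_le_one

theorem integral_zero_one_eq (f : ℝ → ℝ) : ∫ t in (0 : ℝ)..1, f t = ∫ t, f t ∂unitMeasure := by
  rw [intervalIntegral.integral_of_le zero_le_one, integral_Icc_eq_integral_Ioc]

theorem intervalIntegrable_of_integrable {f : ℝ → ℝ} (hf : Integrable f unitMeasure) {a b : ℝ}
    (ha : a ∈ Icc (0 : ℝ) 1) (hb : b ∈ Icc (0 : ℝ) 1) : IntervalIntegrable f volume a b := by
  refine (intervalIntegrable_iff_unitMeasure.2 hf).mono_set ?_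
  rw [uIcc_of_le zero_le_one]
  exact uIcc_subset_Icc ha hb

/-- Integrals over subintervals of `[0,1]` only see the integrand up to `unitMeasure`. -/
theorem intervalIntegral_congr_unit {f g : ℝ → ℝ} (h : ∀ᵐ t ∂unitMeasure, f t = g t) {a b : ℝ}
    (ha : a ∈ Icc (0 : ℝ) 1) (hb : b ∈ Icc (0 : ℝ) 1) :
    ∫ t in a..b, f t = ∫ t in a..b, g t := by
  refine intervalIntegral.integral_congr_ae ?_
  filter_upwards [ae_unitMeasure_iff.1 h] with t ht hm
  exact ht (uIcc_subset_Icc ha hb (uIoc_subset_uIcc hm))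

namespace HasACDeriv

variable {f f' h h' : ℝ → ℝ}

theorem continuousOn (hf : HasACDeriv f f') : ContinuousOn f (Icc 0 1) := by
  have := hf.ac.continuousOn
  rwa [uIcc_of_le zero_le_one] at this

theorem congr_deriv (hf : HasACDeriv f f') (e : ∀ᵐ t ∂unitMeasure, f' t = h' t) :
    HasACDeriv f h' := by
  refine ⟨hf.ac, ?_⟩
  filter_upwards [hf.deriv, e] with t h1 h2
  rwa [← h2]

theorem deriv_eq (hf : HasACDeriv f f') : ∀ᵐ t ∂unitMeasure, _root_.deriv f t = f' t := by
  filter_upwards [hf.deriv] with t ht using ht.deriv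

theorem integrable (hf : HasACDeriv f f') : Integrable f' unitMeasure :=
  (intervalIntegrable_iff_unitMeasure.1 hf.ac.intervalIntegrable_deriv).congr hf.deriv_eq

theorem integral_eq_sub (hf : HasACDeriv f f') {s t : ℝ} (hs : s ∈ Icc (0 : ℝ) 1)
    (ht : t ∈ Icc (0 : ℝ) 1) : ∫ u in s..t, f' u = f t - f s := by
  have h := (hf.ac.mono (c := s) (d := t)
    (by rw [uIcc_of_le zero_le_one]; exact uIcc_subset_Icc hs ht)).integral_deriv_eq_sub
  rw [← h]
  exact (intervalIntegral_congr_unit hf.deriv_eq hs ht).symm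

theorem of_integral (hf : Integrable f' unitMeasure) (c : ℝ) :
    HasACDeriv (fun t => c + ∫ s in (0 : ℝ)..t, f' s) f' := by
  have hi := intervalIntegrable_iff_unitMeasure.2 hf
  refine ⟨?_, ?_⟩
  · have hc : AbsolutelyContinuousOnInterval (fun _ : ℝ => c) 0 1 :=
      (contDiff_const.contDiffOn).absolutelyContinuousOnInterval
    exact hc.fun_add (hi.absolutelyContinuousOnInterval_intervalIntegral (by simp))
  · rw [ae_unitMeasure_iff]
    filter_upwards [hi.ae_hasDerivAt_integral] with t ht hm
    rw [uIcc_of_le zero_le_one] at ht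
    exact (ht hm 0 (by simp)).const_add c

theorem const (c : ℝ) : HasACDeriv (fun _ => c) (fun _ => 0) :=
  ⟨(contDiff_const.contDiffOn).absolutelyContinuousOnInterval,
    ae_of_all _ fun t => hasDerivAt_const t c⟩

theorem id : HasACDeriv (fun t => t) (fun _ => 1) :=
  ⟨(contDiff_id.contDiffOn).absolutelyContinuousOnInterval, ae_of_all _ fun t => hasDerivAt_id t⟩

theorem add (hf : HasACDeriv f f') (hh : HasACDeriv h h') :
    HasACDeriv (fun t => f t + h t) (fun t => f' t + h' t) := by
  refine ⟨hf.ac.fun_add hh.ac, ?_⟩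
  filter_upwards [hf.deriv, hh.deriv] with t h1 h2 using h1.add h2

theorem mul (hf : HasACDeriv f f') (hh : HasACDeriv h h') :
    HasACDeriv (fun t => f t * h t) (fun t => f' t * h t + f t * h' t) := by
  refine ⟨hf.ac.fun_mul hh.ac, ?_⟩
  filter_upwards [hf.deriv, hh.deriv] with t h1 h2 using h1.mul h2

theorem const_mul (c : ℝ) (hf : HasACDeriv f f') :
    HasACDeriv (fun t => c * f t) (fun t => c * f' t) := by
  simpa using (const c).mul hf

theorem sum {ι : Type*} (s : Finset ι) {f f' : ι → ℝ → ℝ} (hf : ∀ i ∈ s, HasACDeriv (f i) (f' i)) :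
    HasACDeriv (fun t => ∑ i ∈ s, f i t) (fun t => ∑ i ∈ s, f' i t) := by
  classical
  induction s using Finset.induction_on with
  | empty => simpa using const 0
  | insert a s ha ih =>
    simp only [Finset.sum_insert ha]
    exact (hf a (Finset.mem_insert_self a s)).add
      (ih fun i hi => hf i (Finset.mem_insert_of_mem hi))

theorem prod_ac {ι : Type*} (s : Finset ι) {f : ι → ℝ → ℝ}
    (hf : ∀ i ∈ s, AbsolutelyContinuousOnInterval (f i) 0 1) :
    AbsolutelyContinuousOnInterval (fun t => ∏ i ∈ s, f i t) 0 1 := by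
  classical
  induction s using Finset.induction_on with
  | empty => simpa using (const 1).ac
  | insert a s ha ih =>
    simp only [Finset.prod_insert ha]
    exact (hf a (Finset.mem_insert_self a s)).fun_mul
      (ih fun i hi => hf i (Finset.mem_insert_of_mem hi))

theorem exp (hf : HasACDeriv f f') :
    HasACDeriv (fun t => Real.exp (f t)) (fun t => Real.exp (f t) * f' t) := by
  refine ⟨?_, ?_⟩
  · obtain ⟨C, hC⟩ := hf.ac.exists_bound
    have hC' : ∀ t ∈ uIcc (0 : ℝ) 1, f t ≤ C := fun t ht => (le_abs_self _).trans (hC t ht)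
    have hlip : ∀ x y : ℝ, x ≤ C → y ≤ C →
        dist (Real.exp x) (Real.exp y) ≤ Real.exp C * dist x y := by
      have aux : ∀ x y : ℝ, x ≤ C → y ≤ x →
          dist (Real.exp x) (Real.exp y) ≤ Real.exp C * dist x y := by
        intro x y hx hyx
        rw [Real.dist_eq, Real.dist_eq, abs_of_nonneg (sub_nonneg.2 (Real.exp_le_exp.2 hyx)),
          abs_of_nonneg (sub_nonneg.2 hyx)]
        have h1 : Real.exp x - Real.exp y ≤ Real.exp x * (x - y) := by
          have h2 := Real.add_one_le_exp (y - x)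
          have h3 : Real.exp y = Real.exp x * Real.exp (y - x) := by rw [← Real.exp_add]; ring_nf
          rw [h3]
          nlinarith [Real.exp_pos x]
        exact h1.trans (mul_le_mul_of_nonneg_right (Real.exp_le_exp.2 hx) (sub_nonneg.2 hyx))
      intro x y hx hy
      rcases le_total y x with hyx | hxy
      · exact aux x y hx hyx
      · rw [dist_comm (Real.exp x), dist_comm x]; exact aux y x hy hxy
    have hf0 := hf.ac
    rw [absolutelyContinuousOnInterval_iff] at hf0 ⊢
    intro ε hε
    obtain ⟨δ, hδ, H⟩ := hf0 (ε / Real.exp C) (div_pos hε (Real.exp_pos C))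
    refine ⟨δ, hδ, fun E hE hlen => ?_⟩
    have h1 := H E hE hlen
    rw [lt_div_iff₀ (Real.exp_pos C), mul_comm, Finset.mul_sum] at h1
    refine lt_of_le_of_lt (Finset.sum_le_sum fun i hi => ?_) h1
    have hmem := hE.1 i (Finset.mem_range.1 hi |> fun h => by simpa using h)
    exact hlip _ _ (hC' _ hmem.1) (hC' _ hmem.2)
  · filter_upwards [hf.deriv] with t ht using ht.exp

theorem eq_of_deriv_zero (hf : HasACDeriv f f') (h0 : ∀ᵐ t ∂unitMeasure, f' t = 0) {t : ℝ}
    (ht : t ∈ Icc (0 : ℝ) 1) : f t = f 0 := by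
  have h1 := hf.integral_eq_sub (s := 0) (by simp) ht
  rw [intervalIntegral_congr_unit (g := fun _ => 0) h0 (by simp) ht,
    intervalIntegral.integral_zero] at h1
  linarith

theorem le_of_deriv_nonpos (hf : HasACDeriv f f') (h0 : ∀ᵐ t ∂unitMeasure, f' t ≤ 0) {t : ℝ}
    (ht : t ∈ Icc (0 : ℝ) 1) : f t ≤ f 0 := by
  have h1 := hf.integral_eq_sub (s := 0) (by simp) ht
  have h2 : 0 ≤ ∫ u in (0 : ℝ)..t, -f' u := by
    refine intervalIntegral.integral_nonneg_of_ae_restrict ht.1 ?_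
    have h3 := ae_unitMeasure_iff.1 h0
    rw [EventuallyLE, ae_restrict_iff' measurableSet_Icc]
    filter_upwards [h3] with u hu hm
    exact neg_nonneg.2 (hu ⟨hm.1, hm.2.trans ht.2⟩)
  rw [intervalIntegral.integral_neg] at h2
  linarith

theorem isH1 (hf : HasACDeriv f f') (hL : MemLp f' 2 unitMeasure) : IsH1 f :=
  ⟨hf.ac, hL.ae_eq (by filter_upwards [hf.deriv_eq] with t ht using ht.symm)⟩

end HasACDeriv

/-! ### Absolutely continuous matrix curves -/

/-- The matrix curve `X` is entrywise absolutely continuous on `[0,1]` with derivative `X'`. -/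
def MatHasACDeriv (X X' : ℝ → Matrix (Fin n) (Fin n) ℝ) : Prop :=
  ∀ i j, HasACDeriv (fun t => X t i j) (fun t => X' t i j)

namespace MatHasACDeriv

variable {X X' Y Y' : ℝ → Matrix (Fin n) (Fin n) ℝ}

theorem congr_deriv (hX : MatHasACDeriv X X') (e : ∀ᵐ t ∂unitMeasure, X' t = Y' t) :
    MatHasACDeriv X Y' := fun i j =>
  (hX i j).congr_deriv (by filter_upwards [e] with t ht using by rw [ht])

theorem continuousOn (hX : MatHasACDeriv X X') : ContinuousOn X (Icc 0 1) :=
  continuousOn_pi.2 fun i => continuousOn_pi.2 fun j => (hX i j).continuousOn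

theorem ae_deriv (hX : MatHasACDeriv X X') :
    ∀ᵐ t ∂unitMeasure, ∀ i j, HasDerivAt (fun s => X s i j) (X' t i j) t := by
  rw [ae_all_iff]; intro i
  rw [ae_all_iff]; intro j
  exact (hX i j).deriv

theorem const (C : Matrix (Fin n) (Fin n) ℝ) : MatHasACDeriv (fun _ => C) (fun _ => 0) :=
  fun i j => HasACDeriv.const (C i j)

theorem add (hX : MatHasACDeriv X X') (hY : MatHasACDeriv Y Y') :
    MatHasACDeriv (fun t => X t + Y t) (fun t => X' t + Y' t) :=
  fun i j => (hX i j).add (hY i j)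

theorem smul {f f' : ℝ → ℝ} (hf : HasACDeriv f f') (hX : MatHasACDeriv X X') :
    MatHasACDeriv (fun t => f t • X t) (fun t => f' t • X t + f t • X' t) :=
  fun i j => hf.mul (hX i j)

theorem const_smul (c : ℝ) (hX : MatHasACDeriv X X') :
    MatHasACDeriv (fun t => c • X t) (fun t => c • X' t) :=
  fun i j => (hX i j).const_mul c

theorem mul (hX : MatHasACDeriv X X') (hY : MatHasACDeriv Y Y') :
    MatHasACDeriv (fun t => X t * Y t) (fun t => X' t * Y t + X t * Y' t) := by
  intro i j
  have := HasACDeriv.sum Finset.univ fun k _ => (hX i k).mul (hY k j)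
  simpa only [Matrix.mul_apply, Matrix.add_apply, ← Finset.sum_add_distrib] using this

theorem trace (hX : MatHasACDeriv X X') :
    HasACDeriv (fun t => (X t).trace) (fun t => (X' t).trace) :=
  HasACDeriv.sum Finset.univ fun k _ => hX k k

theorem of_integral (hX : ∀ i j, Integrable (fun t => X' t i j) unitMeasure)
    (C : Matrix (Fin n) (Fin n) ℝ) :
    MatHasACDeriv (fun t => Matrix.of fun i j => C i j + ∫ s in (0 : ℝ)..t, X' s i j) X' :=
  fun i j => HasACDeriv.of_integral (hX i j) (C i j)

end MatHasACDeriv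

/-- Jacobi's formula along a solution of `X' = C X`. -/
theorem hasDerivAt_det {X : ℝ → Matrix (Fin n) (Fin n) ℝ} {C : Matrix (Fin n) (Fin n) ℝ} {t : ℝ}
    (hX : ∀ i j, HasDerivAt (fun s => X s i j) ((C * X t) i j) t) :
    HasDerivAt (fun s => (X s).det) (C.trace * (X t).det) t := by
  let D : ContinuousMultilinearMap ℝ (fun _ : Fin n => Fin n → ℝ) ℝ :=
    { toMultilinearMap := (Matrix.detRowAlternating (n := Fin n) (R := ℝ)).toMultilinearMap
      cont := Continuous.matrix_det (A := fun M : Matrix (Fin n) (Fin n) ℝ => M) continuous_id }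
  let x : ℝ → Fin n → Fin n → ℝ := fun s i j => X s i j
  have hx : HasDerivAt x (fun i j => (C * X t) i j) t :=
    hasDerivAt_pi.2 fun i => hasDerivAt_pi.2 fun j => hX i j
  have h1 := (D.hasFDerivAt (x t)).comp_hasDerivAt t hx
  rw [ContinuousMultilinearMap.linearDeriv_apply] at h1
  have h2 : ∑ i, D (Function.update (x t) i ((fun i j => (C * X t) i j) i))
      = C.trace * (X t).det := by
    rw [Matrix.trace, Finset.sum_mul]
    refine Finset.sum_congr rfl fun i _ => ?_
    have h3 := Matrix.det_updateRow_sum (X t) i (fun k => C i k)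
    have h4 : (∑ k, C i k • X t k) = (fun j => (C * X t) i j) := by
      funext j
      rw [Finset.sum_apply, Matrix.mul_apply]; rfl
    rw [h4] at h3
    exact h3
  rw [h2] at h1
  exact h1

theorem MatHasACDeriv.det {X C : ℝ → Matrix (Fin n) (Fin n) ℝ}
    (hX : MatHasACDeriv X fun t => C t * X t) :
    HasACDeriv (fun t => (X t).det) (fun t => (C t).trace * (X t).det) := by
  refine ⟨?_, ?_⟩
  · simp only [Matrix.det_apply']
    have : ∀ σ : Equiv.Perm (Fin n), AbsolutelyContinuousOnInterval
        (fun t => ((Equiv.Perm.sign σ : ℤ) : ℝ) * ∏ i, X t (σ i) i) 0 1 := fun σ =>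
      (HasACDeriv.const _).ac.fun_mul (HasACDeriv.prod_ac _ fun i _ => (hX (σ i) i).ac)
    have hs : ∀ s : Finset (Equiv.Perm (Fin n)), AbsolutelyContinuousOnInterval
        (fun t => ∑ σ ∈ s, ((Equiv.Perm.sign σ : ℤ) : ℝ) * ∏ i, X t (σ i) i) 0 1 := by
      intro s
      induction s using Finset.induction_on with
      | empty => simpa using (HasACDeriv.const 0).ac
      | insert a s ha ih =>
        simp only [Finset.sum_insert ha]
        exact (this a).fun_add ih
    exact hs Finset.univ
  · filter_upwards [hX.ae_deriv] with t ht using hasDerivAt_det ht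

/-- If `S' = A S + S A` with `S` invertible, then `(det S)' = 2 (tr A) det S`. -/
theorem MatHasACDeriv.det_of_lyapunov {A S : ℝ → Matrix (Fin n) (Fin n) ℝ}
    (hS : MatHasACDeriv S fun t => A t * S t + S t * A t)
    (hinv : ∀ t ∈ Icc (0 : ℝ) 1, IsUnit (S t).det) :
    HasACDeriv (fun t => (S t).det) (fun t => 2 * (A t).trace * (S t).det) := by
  have hmem : ∀ᵐ t ∂unitMeasure, t ∈ Icc (0 : ℝ) 1 := ae_restrict_mem measurableSet_Icc
  have h := MatHasACDeriv.det (X := S) (C := fun t => A t + S t * A t * (S t)⁻¹)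
    (hS.congr_deriv (by
      filter_upwards [hmem] with t ht
      rw [Matrix.add_mul, Matrix.mul_assoc (S t * A t), Matrix.nonsing_inv_mul _ (hinv t ht),
        Matrix.mul_one]))
  refine h.congr_deriv ?_
  filter_upwards [hmem] with t ht
  rw [Matrix.trace_add, Matrix.trace_mul_cycle, Matrix.nonsing_inv_mul _ (hinv t ht),
    Matrix.one_mul]
  ring

/-! ### The Lyapunov operator -/

/-- The matrix of the Lyapunov operator `X ↦ X S + S X` in the standard basis. -/
def lyapMat (S : Matrix (Fin n) (Fin n) ℝ) : Matrix (Fin n × Fin n) (Fin n × Fin n) ℝ :=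
  Matrix.of fun p q => (if p.1 = q.1 then S q.2 p.2 else 0) + (if p.2 = q.2 then S p.1 q.1 else 0)

/-- The solution `X` of the Lyapunov equation `X S + S X = Q`, for positive definite `S`. -/
def lyap (S Q : Matrix (Fin n) (Fin n) ℝ) : Matrix (Fin n) (Fin n) ℝ :=
  Matrix.of fun i j => ((lyapMat S)⁻¹ *ᵥ fun p => Q p.1 p.2) (i, j)

theorem lyapMat_mulVec (S X : Matrix (Fin n) (Fin n) ℝ) (p : Fin n × Fin n) :
    (lyapMat S *ᵥ fun q => X q.1 q.2) p = (X * S + S * X) p.1 p.2 := by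
  rw [mulVec, dotProduct, Fintype.sum_prod_type]
  simp only [lyapMat, Matrix.of_apply, add_mul, Finset.sum_add_distrib, ite_mul, zero_mul,
    Matrix.add_apply, Matrix.mul_apply]
  congr 1
  · rw [Finset.sum_comm]
    simp [mul_comm]
  · simp

/-- `S ≥ c I` as quadratic forms. -/
def BoundedBelow (c : ℝ) (S : Matrix (Fin n) (Fin n) ℝ) : Prop :=
  ∀ x : Fin n → ℝ, c * (x ⬝ᵥ x) ≤ x ⬝ᵥ S *ᵥ x

theorem BoundedBelow.two_mul_norm_le {c : ℝ} {S : Matrix (Fin n) (Fin n) ℝ}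
    (h : BoundedBelow c S) (X : Matrix (Fin n) (Fin n) ℝ) :
    2 * c * ‖X‖ ≤ ‖X * S + S * X‖ := by
  have h1 : c * ‖X‖ ^ 2 ≤ (Xᵀ * (X * S)).trace := by
    rw [norm_sq_eq_sum, Finset.mul_sum, ← Matrix.mul_assoc, Matrix.trace_mul_comm,
      ← Matrix.mul_assoc, Matrix.trace_mul_comm, ← Matrix.mul_assoc]
    simp only [Matrix.trace, Matrix.diag]
    refine Finset.sum_le_sum fun i _ => ?_
    have := h (X i)
    have e1 : X i ⬝ᵥ X i = ∑ j, X i j ^ 2 := by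
      rw [dotProduct]; exact Finset.sum_congr rfl fun j _ => (sq _).symm
    have e2 : X i ⬝ᵥ S *ᵥ X i = (X * S * Xᵀ) i i := by
      rw [Matrix.mul_assoc, Matrix.mul_apply, dotProduct]
      refine Finset.sum_congr rfl fun j _ => ?_
      rw [Matrix.mul_apply]; rfl
    rwa [e1, e2] at this
  have h2 : c * ‖X‖ ^ 2 ≤ (Xᵀ * (S * X)).trace := by
    rw [norm_sq_eq_sum, Finset.sum_comm, Finset.mul_sum]
    simp only [Matrix.trace, Matrix.diag]
    refine Finset.sum_le_sum fun j _ => ?_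
    have := h (Xᵀ j)
    have e1 : Xᵀ j ⬝ᵥ Xᵀ j = ∑ i, X i j ^ 2 := by
      rw [dotProduct]; exact Finset.sum_congr rfl fun j _ => (sq _).symm
    have e2 : Xᵀ j ⬝ᵥ S *ᵥ Xᵀ j = (Xᵀ * (S * X)) j j := by
      rw [Matrix.mul_apply, dotProduct]
      refine Finset.sum_congr rfl fun j _ => ?_
      rw [Matrix.mul_apply]; rfl
    rwa [e1, e2] at this
  have h3 := (le_abs_self _).trans (abs_trace_mul_le Xᵀ (X * S + S * X))
  rw [Matrix.mul_add, Matrix.trace_add, Matrix.frobenius_norm_transpose] at h3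
  rcases (norm_nonneg X).eq_or_lt with h0 | h0
  · rw [← h0, mul_zero]; exact norm_nonneg _
  · refine le_of_mul_le_mul_left ?_ h0
    linarith

theorem BoundedBelow.isUnit_lyapMat {c : ℝ} (hc : 0 < c) {S : Matrix (Fin n) (Fin n) ℝ}
    (h : BoundedBelow c S) : IsUnit (lyapMat S) := by
  rw [← Matrix.mulVec_injective_iff_isUnit]
  intro x y hxy
  have h0 : lyapMat S *ᵥ (x - y) = 0 := by rw [Matrix.mulVec_sub, sub_eq_zero]; exact hxy
  let X : Matrix (Fin n) (Fin n) ℝ := Matrix.of fun i j => (x - y) (i, j)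
  have hX : X * S + S * X = 0 := by
    ext i j
    rw [← lyapMat_mulVec S X (i, j)]
    exact congrFun h0 (i, j)
  have h1 := h.two_mul_norm_le X
  rw [hX, norm_zero] at h1
  have h2 : ‖X‖ ≤ 0 := by nlinarith [norm_nonneg X]
  have h3 : X = 0 := norm_le_zero_iff.1 h2
  funext p
  exact sub_eq_zero.1 (congrFun (congrFun h3 p.1) p.2)

theorem BoundedBelow.lyap_spec {c : ℝ} (hc : 0 < c) {S : Matrix (Fin n) (Fin n) ℝ}
    (h : BoundedBelow c S) (Q : Matrix (Fin n) (Fin n) ℝ) :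
    lyap S Q * S + S * lyap S Q = Q := by
  ext i j
  have h1 := lyapMat_mulVec S (lyap S Q) (i, j)
  have h2 : (fun q : Fin n × Fin n => lyap S Q q.1 q.2)
      = (lyapMat S)⁻¹ *ᵥ fun p => Q p.1 p.2 := rfl
  rw [h2, Matrix.mulVec_mulVec, Matrix.mul_nonsing_inv _
    ((Matrix.isUnit_iff_isUnit_det _).1 (h.isUnit_lyapMat hc)), Matrix.one_mulVec] at h1
  exact h1.symm

theorem BoundedBelow.eq_of_lyapunov {c : ℝ} (hc : 0 < c) {S : Matrix (Fin n) (Fin n) ℝ}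
    (h : BoundedBelow c S) {X Y : Matrix (Fin n) (Fin n) ℝ}
    (hXY : X * S + S * X = Y * S + S * Y) : X = Y := by
  have h1 := h.two_mul_norm_le (X - Y)
  rw [Matrix.sub_mul, Matrix.mul_sub, sub_add_sub_comm, hXY, sub_self, norm_zero] at h1
  have : ‖X - Y‖ ≤ 0 := by nlinarith [norm_nonneg (X - Y)]
  exact sub_eq_zero.1 (norm_le_zero_iff.1 this)

theorem BoundedBelow.norm_lyap_le {c : ℝ} (hc : 0 < c) {S : Matrix (Fin n) (Fin n) ℝ}
    (h : BoundedBelow c S) (Q : Matrix (Fin n) (Fin n) ℝ) :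
    ‖lyap S Q‖ ≤ (2 * c)⁻¹ * ‖Q‖ := by
  have := h.two_mul_norm_le (lyap S Q)
  rw [h.lyap_spec hc] at this
  rwa [le_inv_mul_iff₀ (by positivity)]

theorem BoundedBelow.lyap_isSymm {c : ℝ} (hc : 0 < c) {S : Matrix (Fin n) (Fin n) ℝ}
    (hS : S.IsSymm) (h : BoundedBelow c S) {Q : Matrix (Fin n) (Fin n) ℝ} (hQ : Q.IsSymm) :
    (lyap S Q).IsSymm := by
  refine h.eq_of_lyapunov hc ?_
  have h1 := h.lyap_spec hc Q
  have h2 := congrArg Matrix.transpose h1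
  rw [Matrix.transpose_add, Matrix.transpose_mul, Matrix.transpose_mul, hS.eq, hQ.eq] at h2
  rw [h1, add_comm, h2]

/-- A continuous curve of positive definite matrices is uniformly positive definite on `[0,1]`. -/
theorem exists_boundedBelow {S : ℝ → Matrix (Fin n) (Fin n) ℝ} (hS : ContinuousOn S (Icc 0 1))
    (hpos : ∀ t ∈ Icc (0 : ℝ) 1, (S t).PosDef) :
    ∃ c : ℝ, 0 < c ∧ ∀ t ∈ Icc (0 : ℝ) 1, BoundedBelow c (S t) := by
  have hK : IsCompact (Icc (0 : ℝ) 1 ×ˢ Metric.sphere (0 : Fin n → ℝ) 1) :=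
    isCompact_Icc.prod (isCompact_sphere _ _)
  have hcont : ContinuousOn (fun p : ℝ × (Fin n → ℝ) => p.2 ⬝ᵥ S p.1 *ᵥ p.2)
      (Icc (0 : ℝ) 1 ×ˢ Metric.sphere (0 : Fin n → ℝ) 1) := by
    have hS' : ContinuousOn (fun p : ℝ × (Fin n → ℝ) => S p.1)
        (Icc (0 : ℝ) 1 ×ˢ Metric.sphere (0 : Fin n → ℝ) 1) :=
      hS.comp continuousOn_fst fun p hp => hp.1
    have hm : Continuous fun q : Matrix (Fin n) (Fin n) ℝ × (Fin n → ℝ) => q.2 ⬝ᵥ q.1 *ᵥ q.2 :=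
      continuous_snd.dotProduct (continuous_fst.matrix_mulVec continuous_snd)
    exact hm.comp_continuousOn (hS'.prodMk continuousOn_snd)
  have hval : ∀ t ∈ Icc (0 : ℝ) 1, ∀ x : Fin n → ℝ, x ≠ 0 → 0 < x ⬝ᵥ S t *ᵥ x := by
    intro t ht x hx
    have := (Matrix.posDef_iff_dotProduct_mulVec.1 (hpos t ht)).2 hx
    simpa using this
  rcases Set.eq_empty_or_nonempty (Icc (0 : ℝ) 1 ×ˢ Metric.sphere (0 : Fin n → ℝ) 1) with he | hne
  · refine ⟨1, one_pos, fun t ht x => ?_⟩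
    by_cases hx : x = 0
    · simp [hx]
    · exfalso
      have : (t, ‖x‖⁻¹ • x) ∈ (Icc (0 : ℝ) 1 ×ˢ Metric.sphere (0 : Fin n → ℝ) 1) := by
        refine ⟨ht, ?_⟩
        rw [mem_sphere_zero_iff_norm, norm_smul, norm_inv, norm_norm,
          inv_mul_cancel₀ (norm_ne_zero_iff.2 hx)]
      rw [he] at this
      exact this
  · obtain ⟨p, hp, hmin⟩ := hK.exists_isMinOn hne hcont
    set m := p.2 ⬝ᵥ S p.1 *ᵥ p.2 with hm
    have hm0 : 0 < m := hval p.1 hp.1 p.2 (fun h0 => by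
      have := hp.2
      rw [h0, mem_sphere_zero_iff_norm, norm_zero] at this
      exact zero_ne_one this)
    refine ⟨m / (n + 1), by positivity, fun t ht x => ?_⟩
    by_cases hx : x = 0
    · simp [hx]
    have hnx : 0 < ‖x‖ := norm_pos_iff.2 hx
    have h1 : m ≤ (‖x‖⁻¹ • x) ⬝ᵥ S t *ᵥ (‖x‖⁻¹ • x) := by
      have hmem : (t, ‖x‖⁻¹ • x) ∈ (Icc (0 : ℝ) 1 ×ˢ Metric.sphere (0 : Fin n → ℝ) 1) := by
        refine ⟨ht, ?_⟩
        rw [mem_sphere_zero_iff_norm, norm_smul, norm_inv, norm_norm, inv_mul_cancel₀ hnx.ne']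
      exact hmin hmem
    rw [Matrix.mulVec_smul, dotProduct_smul, smul_dotProduct, smul_eq_mul, smul_eq_mul,
      ← mul_assoc, ← mul_inv, inv_mul_eq_div, le_div_iff₀ (by positivity)] at h1
    have h2 : x ⬝ᵥ x ≤ n * (‖x‖ * ‖x‖) := by
      calc x ⬝ᵥ x ≤ ∑ _i : Fin n, ‖x‖ * ‖x‖ := by
            refine Finset.sum_le_sum fun i _ => ?_
            rw [← abs_mul_abs_self]
            exact mul_self_le_mul_self (abs_nonneg _) (norm_le_pi_norm x i)
        _ = _ := by simp
    refine le_trans ?_ h1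
    rw [div_mul_eq_mul_div, div_le_iff₀ (by positivity)]
    have h3 : 0 ≤ m * (‖x‖ * ‖x‖) := by positivity
    nlinarith

theorem BoundedBelow.posDef {c : ℝ} (hc : 0 < c) {S : Matrix (Fin n) (Fin n) ℝ} (hS : S.IsSymm)
    (h : BoundedBelow c S) : S.PosDef := by
  rw [Matrix.posDef_iff_dotProduct_mulVec]
  refine ⟨?_, fun x hx => ?_⟩
  · rw [Matrix.IsHermitian, Matrix.conjTranspose_eq_transpose_of_trivial]; exact hS
  · have h1 : 0 < x ⬝ᵥ x := by
      have : 0 ≤ x ⬝ᵥ x := Finset.sum_nonneg fun i _ => mul_self_nonneg _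
      refine this.lt_of_ne' fun h0 => hx (dotProduct_self_eq_zero.1 h0)
    simpa using (mul_pos hc h1).trans_le (h x)

/-- Adding a matrix of norm at most `c / 2` to `S ≥ c I` leaves a matrix `≥ (c / 2) I`. -/
theorem BoundedBelow.add {c : ℝ} {S H : Matrix (Fin n) (Fin n) ℝ} (h : BoundedBelow c S)
    (hH : ‖H‖ ≤ c / 2) : BoundedBelow (c / 2) (S + H) := by
  intro x
  have h1 := h x
  have h2 : |x ⬝ᵥ H *ᵥ x| ≤ c / 2 * (x ⬝ᵥ x) := by
    have e : x ⬝ᵥ H *ᵥ x = (H * Matrix.vecMulVec x x).trace := by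
      rw [Matrix.trace, dotProduct]
      refine Finset.sum_congr rfl fun i _ => ?_
      rw [Matrix.diag, Matrix.mul_apply, mulVec, dotProduct, Finset.mul_sum]
      exact Finset.sum_congr rfl fun j _ => by rw [Matrix.vecMulVec_apply]; ring
    have e2 : ‖Matrix.vecMulVec x x‖ = x ⬝ᵥ x := by
      have h0 : 0 ≤ x ⬝ᵥ x := Finset.sum_nonneg fun i _ => mul_self_nonneg _
      rw [← sq_eq_sq₀ (norm_nonneg _) h0, norm_sq_eq_sum, sq (x ⬝ᵥ x), dotProduct,
        Finset.sum_mul_sum]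
      exact Finset.sum_congr rfl fun i _ => Finset.sum_congr rfl fun j _ => by
        rw [Matrix.vecMulVec_apply]; ring
    rw [e]
    refine (abs_trace_mul_le _ _).trans ?_
    rw [e2]
    exact mul_le_mul_of_nonneg_right hH (Finset.sum_nonneg fun i _ => mul_self_nonneg _)
  rw [Matrix.add_mulVec, dotProduct_add]
  linarith [(abs_le.1 h2).1]

theorem isSymm_of_posDef {S : Matrix (Fin n) (Fin n) ℝ} (hS : S.PosDef) : S.IsSymm := by
  have := hS.isHermitian
  rwa [Matrix.IsHermitian, Matrix.conjTranspose_eq_transpose_of_trivial] at this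

/-- A Lyapunov solution depends Lipschitz continuously on the coefficient matrix. -/
theorem BoundedBelow.norm_lyap_sub_le {c : ℝ} (hc : 0 < c) {S T : Matrix (Fin n) (Fin n) ℝ}
    (h : BoundedBelow c S) (h' : BoundedBelow c T)
    (Q : Matrix (Fin n) (Fin n) ℝ) :
    ‖lyap T Q - lyap S Q‖ ≤ c⁻¹ * (‖T - S‖ * ‖lyap S Q‖) := by
  have h1 := h'.two_mul_norm_le (lyap T Q - lyap S Q)
  have e : (lyap T Q - lyap S Q) * T + T * (lyap T Q - lyap S Q)
      = -(lyap S Q * (T - S) + (T - S) * lyap S Q) := by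
    have e1 := h'.lyap_spec hc Q
    have e2 := h.lyap_spec hc Q
    calc _ = (lyap T Q * T + T * lyap T Q) - (lyap S Q * S + S * lyap S Q)
          - (lyap S Q * (T - S) + (T - S) * lyap S Q) := by noncomm_ring
      _ = _ := by rw [e1, e2, sub_self, zero_sub]
  rw [e, norm_neg] at h1
  have h2 := (norm_add_le (lyap S Q * (T - S)) ((T - S) * lyap S Q)).trans
    (add_le_add (norm_mul_le _ _) (norm_mul_le _ _))
  rw [le_inv_mul_iff₀ hc]
  linarith

/-! ### Measurability and integrability of matrix functions -/

theorem aestronglyMeasurable_of_entries {X : ℝ → Matrix (Fin n) (Fin n) ℝ} {μ : Measure ℝ}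
    (h : ∀ i j, AEStronglyMeasurable (fun t => X t i j) μ) : AEStronglyMeasurable X μ := by
  have e : X = fun t => ∑ i, ∑ j, X t i j • Matrix.single i j (1 : ℝ) := by
    funext t
    conv_lhs => rw [Matrix.matrix_eq_sum_single (X t)]
    exact Finset.sum_congr rfl fun i _ => Finset.sum_congr rfl fun j _ => by
      rw [Matrix.smul_single, smul_eq_mul, mul_one]
  rw [e]
  exact Finset.aestronglyMeasurable_fun_sum _ fun i _ =>
    Finset.aestronglyMeasurable_fun_sum _ fun j _ => (h i j).smul_const _

theorem norm_le_sum_abs (X : Matrix (Fin n) (Fin n) ℝ) : ‖X‖ ≤ ∑ p : Fin n × Fin n, |X p.1 p.2| := by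
  have h0 : 0 ≤ ∑ p : Fin n × Fin n, |X p.1 p.2| := Finset.sum_nonneg fun _ _ => abs_nonneg _
  refine (abs_le_of_sq_le_sq' ?_ h0).2
  rw [norm_sq_eq_sum, ← Fintype.sum_prod_type' (f := fun i j => X i j ^ 2),
    sq (∑ p : Fin n × Fin n, _), Finset.sum_mul]
  refine Finset.sum_le_sum fun p _ => ?_
  rw [← sq_abs, sq]
  exact mul_le_mul_of_nonneg_left (Finset.single_le_sum (f := fun p : Fin n × Fin n => |X p.1 p.2|)
    (fun _ _ => abs_nonneg _) (Finset.mem_univ p)) (abs_nonneg _)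

theorem memLp_matrix_iff {X : ℝ → Matrix (Fin n) (Fin n) ℝ} {μ : Measure ℝ} :
    MemLp X 2 μ ↔ ∀ i j, MemLp (fun t => X t i j) 2 μ := by
  constructor
  · intro h i j
    refine h.mono ?_ (ae_of_all _ fun t => abs_apply_le_norm (X t) i j)
    have hc : Continuous fun M : Matrix (Fin n) (Fin n) ℝ => M i j :=
      (continuous_apply j).comp (continuous_apply i)
    exact hc.comp_aestronglyMeasurable h.1
  · intro h
    have h1 : MemLp (fun t => ∑ p : Fin n × Fin n, ‖X t p.1 p.2‖) 2 μ :=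
      memLp_finsetSum _ fun p _ => (h p.1 p.2).norm
    refine h1.mono (aestronglyMeasurable_of_entries fun i j => (h i j).1) (ae_of_all _ fun t => ?_)
    exact (norm_le_sum_abs (X t)).trans (le_abs_self _)

theorem aestronglyMeasurable_lyap {S Q : ℝ → Matrix (Fin n) (Fin n) ℝ}
    (hS : ContinuousOn S (Icc 0 1)) (hQ : AEStronglyMeasurable Q unitMeasure) :
    AEStronglyMeasurable (fun t => lyap (S t) (Q t)) unitMeasure := by
  refine aestronglyMeasurable_of_entries fun i j => ?_
  have hM : ContinuousOn (fun t => lyapMat (S t)) (Icc 0 1) := by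
    have : Continuous (lyapMat : Matrix (Fin n) (Fin n) ℝ → _) := by
      refine continuous_matrix fun p q => ?_
      have hent : ∀ a b : Fin n, Continuous fun M : Matrix (Fin n) (Fin n) ℝ => M a b :=
        fun a b => (continuous_apply b).comp (continuous_apply a)
      refine Continuous.add ?_ ?_
      · split_ifs
        exacts [hent _ _, continuous_const]
      · split_ifs
        exacts [hent _ _, continuous_const]
    exact this.comp_continuousOn hS
  have hdet : AEStronglyMeasurable (fun t => ((lyapMat (S t)).det)⁻¹) unitMeasure := by
    have : ContinuousOn (fun t => (lyapMat (S t)).det) (Icc 0 1) :=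
      (Continuous.matrix_det continuous_id).comp_continuousOn hM
    exact (this.aestronglyMeasurable measurableSet_Icc).aemeasurable.inv.aestronglyMeasurable
  have hadj : ∀ p q, AEStronglyMeasurable (fun t => (lyapMat (S t)).adjugate p q) unitMeasure := by
    intro p q
    have h1 : Continuous fun M : Matrix (Fin n × Fin n) (Fin n × Fin n) ℝ => M.adjugate p q :=
      (continuous_apply q).comp ((continuous_apply p).comp (Continuous.matrix_adjugate continuous_id))
    exact (h1.comp_continuousOn hM).aestronglyMeasurable measurableSet_Icc
  have hq : ∀ a b : Fin n, AEStronglyMeasurable (fun t => Q t a b) unitMeasure := fun a b =>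
    ((continuous_apply b).comp (continuous_apply a) :
      Continuous fun M : Matrix (Fin n) (Fin n) ℝ => M a b).comp_aestronglyMeasurable hQ
  have e : ∀ t, lyap (S t) (Q t) i j = ∑ p : Fin n × Fin n,
      ((lyapMat (S t)).det)⁻¹ * (lyapMat (S t)).adjugate (i, j) p * Q t p.1 p.2 := by
    intro t
    rw [lyap, Matrix.of_apply, mulVec, dotProduct, Matrix.inv_def, Ring.inverse_eq_inv']
    exact Finset.sum_congr rfl fun p _ => by rw [Matrix.smul_apply, smul_eq_mul]
  simp only [e]
  exact Finset.aestronglyMeasurable_fun_sum _ fun p _ => (hdet.mul (hadj _ _)).mul (hq _ _)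

theorem ae_mem_unit : ∀ᵐ t ∂unitMeasure, t ∈ Icc (0 : ℝ) 1 := ae_restrict_mem measurableSet_Icc

theorem exists_norm_le_of_continuousOn {S : ℝ → Matrix (Fin n) (Fin n) ℝ}
    (hS : ContinuousOn S (Icc 0 1)) : ∃ C : ℝ, 0 ≤ C ∧ ∀ t ∈ Icc (0 : ℝ) 1, ‖S t‖ ≤ C := by
  obtain ⟨C, hC⟩ := isCompact_Icc.exists_bound_of_continuousOn hS
  exact ⟨C, (norm_nonneg _).trans (hC 0 (by simp)), hC⟩

theorem aestronglyMeasurable_of_continuousOn {S : ℝ → Matrix (Fin n) (Fin n) ℝ}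
    (hS : ContinuousOn S (Icc 0 1)) : AEStronglyMeasurable S unitMeasure :=
  aestronglyMeasurable_of_entries fun i j =>
    ((continuous_apply j).comp (continuous_apply i) :
      Continuous fun M : Matrix (Fin n) (Fin n) ℝ => M i j).comp_continuousOn hS
      |>.aestronglyMeasurable measurableSet_Icc

theorem norm_lyapunov_le (A S : Matrix (Fin n) (Fin n) ℝ) :
    ‖A * S + S * A‖ ≤ 2 * (‖A‖ * ‖S‖) := by
  have := (norm_add_le (A * S) (S * A)).trans (add_le_add (norm_mul_le _ _) (norm_mul_le _ _))
  linarith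

theorem memLp_lyapunov {A S : ℝ → Matrix (Fin n) (Fin n) ℝ} (hA : MemLp A 2 unitMeasure)
    (hS : ContinuousOn S (Icc 0 1)) : MemLp (fun t => A t * S t + S t * A t) 2 unitMeasure := by
  obtain ⟨C, hC0, hC⟩ := exists_norm_le_of_continuousOn hS
  have hSm := aestronglyMeasurable_of_continuousOn hS
  refine (hA.norm.const_mul (2 * C)).mono ((hA.1.mul hSm).add (hSm.mul hA.1)) ?_
  filter_upwards [ae_mem_unit] with t ht
  refine (norm_lyapunov_le _ _).trans ?_
  rw [Real.norm_of_nonneg (by positivity)]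
  nlinarith [mul_le_mul_of_nonneg_left (hC t ht) (norm_nonneg (A t))]

theorem memLp_add_smul {A X : ℝ → Matrix (Fin n) (Fin n) ℝ} (c : ℝ) (hA : MemLp A 2 unitMeasure)
    (hX : MemLp X 2 unitMeasure) : MemLp (fun t => A t + c • X t) 2 unitMeasure :=
  memLp_matrix_iff.2 fun i j =>
    (memLp_matrix_iff.1 hA i j).add ((memLp_matrix_iff.1 hX i j).const_mul c)

theorem integrable_apply {X : ℝ → Matrix (Fin n) (Fin n) ℝ} (hX : MemLp X 2 unitMeasure)
    (i j : Fin n) : Integrable (fun t => X t i j) unitMeasure :=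
  (memLp_matrix_iff.1 hX i j).integrable one_le_two

theorem integrable_trace_mul {X Y : ℝ → Matrix (Fin n) (Fin n) ℝ} (hX : MemLp X 2 unitMeasure)
    (hY : MemLp Y 2 unitMeasure) : Integrable (fun t => (X t * Y t).trace) unitMeasure := by
  simp only [Matrix.trace, Matrix.diag, Matrix.mul_apply]
  exact integrable_finsetSum _ fun i _ => integrable_finsetSum _ fun j _ =>
    (memLp_matrix_iff.1 hX i j).integrable_mul (memLp_matrix_iff.1 hY j i)

/-! ### The cost functional -/

theorem memLp_g (hθ : 0 < θ) {A : ℝ → Matrix (Fin n) (Fin n) ℝ} (hA : MemLp A 2 unitMeasure)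
    (hs : ∀ᵐ t ∂unitMeasure, (A t).IsSymm) : MemLp (fun t => g θ (A t)) 2 unitMeasure := by
  have h1 : MemLp (fun t => g θ (0 : Matrix (Fin n) (Fin n) ℝ) + 2 * ‖A t‖) 2 unitMeasure := by
    generalize g θ (0 : Matrix (Fin n) (Fin n) ℝ) = c
    exact (memLp_const c).add (hA.norm.const_mul 2)
  refine h1.mono (aestronglyMeasurable_comp_symm (fun X hX => continuousAt_g hX) hA.1 hs) ?_
  filter_upwards [hs] with t ht
  rw [Real.norm_of_nonneg (g_nonneg hθ ht)]
  exact (g_le hθ ht).trans (le_abs_self _)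

theorem memLp_gradSq (hθ : 0 < θ) {A : ℝ → Matrix (Fin n) (Fin n) ℝ} (hA : MemLp A 2 unitMeasure)
    (hs : ∀ᵐ t ∂unitMeasure, (A t).IsSymm) : MemLp (fun t => gradSq θ (A t)) 2 unitMeasure := by
  refine ((memLp_g hθ hA hs).const_mul 2).mono
    (aestronglyMeasurable_comp_symm (fun X hX => continuousAt_gradSq hX) hA.1 hs) ?_
  filter_upwards [hs] with t ht
  exact (norm_gradSq_le hθ ht).trans (le_abs_self _)

theorem cost_eq (θ : ℝ) (A : ℝ → Matrix (Fin n) (Fin n) ℝ) :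
    cost θ A = ∫ t, g θ (A t) ^ 2 ∂unitMeasure := integral_zero_one_eq _

theorem integrable_g_sq (hθ : 0 < θ) {A : ℝ → Matrix (Fin n) (Fin n) ℝ}
    (hA : MemLp A 2 unitMeasure) (hs : ∀ᵐ t ∂unitMeasure, (A t).IsSymm) :
    Integrable (fun t => g θ (A t) ^ 2) unitMeasure := (memLp_g hθ hA hs).integrable_sq

/-- Convexity of the cost. -/
theorem cost_ge (hθ : 0 < θ) {A B : ℝ → Matrix (Fin n) (Fin n) ℝ} (hA : MemLp A 2 unitMeasure)
    (hB : MemLp B 2 unitMeasure) (hsA : ∀ᵐ t ∂unitMeasure, (A t).IsSymm)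
    (hsB : ∀ᵐ t ∂unitMeasure, (B t).IsSymm) :
    cost θ A + 2 * ∫ t, (gradSq θ (A t) * (B t - A t)).trace ∂unitMeasure ≤ cost θ B := by
  have hi : Integrable (fun t => (gradSq θ (A t) * (B t - A t)).trace) unitMeasure :=
    integrable_trace_mul (memLp_gradSq hθ hA hsA) (hB.sub hA)
  rw [cost_eq, cost_eq, ← integral_const_mul,
    ← integral_add (integrable_g_sq hθ hA hsA) (hi.const_mul 2)]
  refine integral_mono_ae ((integrable_g_sq hθ hA hsA).add (hi.const_mul 2))
    (integrable_g_sq hθ hB hsB) ?_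
  filter_upwards [hsA, hsB] with t h1 h2 using g_sq_ge hθ h1 h2

/-! ### Dropping the trace constraint -/

/-- The pair `(A, S)` is admissible except that the control need not be traceless. -/
structure IsRelaxed (S₀ S₁ : Matrix (Fin n) (Fin n) ℝ) (A S : ℝ → Matrix (Fin n) (Fin n) ℝ) :
    Prop where
  memLp : MemLp A 2 unitMeasure
  symm : ∀ᵐ t ∂unitMeasure, (A t).IsSymm
  posDef : ∀ t ∈ Icc (0 : ℝ) 1, (S t).PosDef
  dynamics : MatHasACDeriv S fun t => A t * S t + S t * A t
  initial : S 0 = S₀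
  terminal : S 1 = S₁

theorem IsAdmissible.isRelaxed {S₀ S₁ : Matrix (Fin n) (Fin n) ℝ}
    {A S : ℝ → Matrix (Fin n) (Fin n) ℝ} (h : IsAdmissible S₀ S₁ A S) : IsRelaxed S₀ S₁ A S where
  memLp := memLp_matrix_iff.2 h.memLp
  symm := h.symm
  posDef := h.posDef
  dynamics i j := ⟨(h.memH1 i j).1, by filter_upwards [h.dynamics] with t ht using ht i j⟩
  initial := h.initial
  terminal := h.terminal

/-- A relaxed pair becomes admissible after multiplying the state by the scalar that keeps its
determinant constant; the control loses its trace. Equality of the end point determinants makes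
this scalar equal to one at both ends. -/
theorem IsRelaxed.exists_isAdmissible {S₀ S₁ : Matrix (Fin n) (Fin n) ℝ}
    {A S : ℝ → Matrix (Fin n) (Fin n) ℝ} (h : IsRelaxed S₀ S₁ A S) (hdet : S₀.det = S₁.det) :
    ∃ T, IsAdmissible S₀ S₁ (fun t => A t - ((A t).trace / n) • 1) T := by
  have htrL : MemLp (fun t => (A t).trace) 2 unitMeasure :=
    memLp_finsetSum _ fun i _ => memLp_matrix_iff.1 h.memLp i i
  have htr : Integrable (fun t => (A t).trace) unitMeasure := htrL.integrable one_le_two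
  have hunit : ∀ t ∈ Icc (0 : ℝ) 1, IsUnit (S t).det := fun t ht =>
    (h.posDef t ht).det_pos.ne'.isUnit
  have hd := (HasACDeriv.of_integral (htr.const_mul (-2)) 0).exp.mul
    (h.dynamics.det_of_lyapunov hunit)
  have hd1 := hd.eq_of_deriv_zero (ae_of_all _ fun t => by ring) (t := 1) (by simp)
  simp only [intervalIntegral.integral_same, zero_add, Real.exp_zero, one_mul, h.initial,
    h.terminal, hdet] at hd1
  have hdet1 : S₁.det ≠ 0 := by
    rw [← h.terminal]; exact (h.posDef 1 (by simp)).det_pos.ne'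
  have hexp : Real.exp (∫ s in (0 : ℝ)..1, -2 * (A s).trace) = 1 :=
    mul_right_cancel₀ hdet1 (by rw [hd1, one_mul])
  have hzero : ∫ s in (0 : ℝ)..1, -2 * (A s).trace = 0 := Real.exp_eq_one_iff _ |>.1 hexp
  have hf := (HasACDeriv.of_integral (htr.const_mul (-2 / n)) 0).exp
  set f : ℝ → ℝ := fun t => Real.exp (0 + ∫ s in (0 : ℝ)..t, -2 / n * (A s).trace) with hfdef
  have hf0 : f 0 = 1 := by simp [hfdef]
  have hf1 : f 1 = 1 := by
    have : ∫ s in (0 : ℝ)..1, -2 / n * (A s).trace = 0 := by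
      have e : ∀ s, -2 / (n : ℝ) * (A s).trace = (n : ℝ)⁻¹ * (-2 * (A s).trace) := fun s => by ring
      simp only [e, intervalIntegral.integral_const_mul, hzero, mul_zero]
    rw [hfdef]
    beta_reduce
    rw [this, add_zero, Real.exp_zero]
  have hone : MemLp (fun t => ((A t).trace / n) • (1 : Matrix (Fin n) (Fin n) ℝ)) 2 unitMeasure := by
    refine memLp_matrix_iff.2 fun i j => ?_
    have := htrL.mul_const ((n : ℝ)⁻¹ * (1 : Matrix (Fin n) (Fin n) ℝ) i j)
    refine this.ae_eq (ae_of_all _ fun t => ?_)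
    simp only [Matrix.smul_apply, smul_eq_mul]; ring
  have hA' := h.memLp.sub hone
  have hT : MatHasACDeriv (fun t => f t • S t) (fun t =>
      (A t - ((A t).trace / n) • 1) * (f t • S t) + (f t • S t) * (A t - ((A t).trace / n) • 1)) := by
    refine (MatHasACDeriv.smul hf h.dynamics).congr_deriv (ae_of_all _ fun t => ?_)
    simp only [Matrix.sub_mul, Matrix.mul_sub, Matrix.mul_smul, Matrix.smul_mul, Matrix.one_mul,
      Matrix.mul_one, smul_add]
    module
  refine ⟨fun t => f t • S t, ?_⟩
  have hL := memLp_lyapunov hA' hT.continuousOn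
  exact
    { memLp := memLp_matrix_iff.1 hA'
      symm := by
        filter_upwards [h.symm] with t ht using ht.sub (Matrix.isSymm_one.smul _)
      traceless := by
        refine ae_of_all _ fun t => ?_
        rcases Nat.eq_zero_or_pos n with rfl | hn
        · simp
        · have : (n : ℝ) ≠ 0 := Nat.cast_ne_zero.2 hn.ne'
          simp [Matrix.trace_sub, Matrix.trace_smul, this]
      memH1 := fun i j => (hT i j).isH1 (memLp_matrix_iff.1 hL i j)
      posDef := fun t ht => (h.posDef t ht).smul (Real.exp_pos _)
      dynamics := hT.ae_deriv
      initial := by simp [hf0, h.initial]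
      terminal := by simp [hf1, h.terminal] }

/-- A minimizer also minimizes the cost over pairs whose control need not be traceless, because
`g` is invariant under adding multiples of the identity. -/
theorem IsMinimizer.cost_le_of_isRelaxed (hθ : 0 < θ) {S₀ S₁ : Matrix (Fin n) (Fin n) ℝ}
    (hdet : S₀.det = S₁.det) {A S B T : ℝ → Matrix (Fin n) (Fin n) ℝ}
    (h : IsMinimizer θ S₀ S₁ A S) (hB : IsRelaxed S₀ S₁ B T) : cost θ A ≤ cost θ B := by
  obtain ⟨T', hT'⟩ := hB.exists_isAdmissible hdet
  refine (h.2 _ _ hT').trans (le_of_eq ?_)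
  rw [cost_eq, cost_eq]
  refine integral_congr_ae ?_
  filter_upwards [hB.symm] with t ht
  rw [g_sub_smul_one hθ ht]

/-! ### The first variation -/

theorem tendsto_trace_mul {A B : Matrix (Fin n) (Fin n) ℝ} {X Y : ℝ → Matrix (Fin n) (Fin n) ℝ}
    {l : Filter ℝ} (hX : Tendsto X l (𝓝 A)) (hY : Tendsto Y l (𝓝 B)) :
    Tendsto (fun ε => (X ε * Y ε).trace) l (𝓝 (A * B).trace) := by
  have hent : ∀ i j, Continuous fun M : Matrix (Fin n) (Fin n) ℝ => M i j :=
    fun i j => (continuous_apply j).comp (continuous_apply i)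
  simp only [Matrix.trace, Matrix.diag, Matrix.mul_apply]
  exact tendsto_finsetSum _ fun i _ => tendsto_finsetSum _ fun j _ =>
    (((hent i j).tendsto A).comp hX).mul (((hent j i).tendsto B).comp hY)

theorem tendsto_trace_gradSq_mul {A X₀ : Matrix (Fin n) (Fin n) ℝ} (hA : A.IsSymm)
    {X : ℝ → Matrix (Fin n) (Fin n) ℝ} (hX : Tendsto X (𝓝 0) (𝓝 X₀)) :
    Tendsto (fun ε : ℝ => (gradSq θ (A + ε • X ε) * X ε).trace) (𝓝 0)
      (𝓝 (gradSq θ A * X₀).trace) := by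
  have hAlim : Tendsto (fun ε => A + ε • X ε) (𝓝 0) (𝓝 A) := by
    have := (tendsto_id (α := ℝ) (x := 𝓝 0)).smul hX
    rw [zero_smul] at this
    have h2 := (tendsto_const_nhds (x := A)).add this
    rwa [add_zero] at h2
  have hF : Tendsto (fun ε => gradSq θ (A + ε • X ε)) (𝓝 0) (𝓝 (gradSq θ A)) :=
    (continuousAt_gradSq (θ := θ) hA).tendsto.comp hAlim
  exact tendsto_trace_mul hF hX

theorem tendsto_trace_gradSq_mul_lyap {c δ : ℝ} (hc : 0 < c) (hδ : 0 < δ)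
    {A S H Z : Matrix (Fin n) (Fin n) ℝ} (hA : A.IsSymm)
    (hb : ∀ ε : ℝ, |ε| ≤ δ → BoundedBelow c (S + ε • H)) :
    Tendsto (fun ε : ℝ => (gradSq θ (A + ε • lyap (S + ε • H) Z) * lyap (S + ε • H) Z).trace)
      (𝓝 0) (𝓝 (gradSq θ A * lyap S Z).trace) := by
  have hnear : ∀ᶠ ε : ℝ in 𝓝 0, |ε| ≤ δ := by
    filter_upwards [Metric.closedBall_mem_nhds (0 : ℝ) hδ] with ε hε
    simpa [Real.dist_eq] using hε
  have hXlim : Tendsto (fun ε : ℝ => lyap (S + ε • H) Z) (𝓝 0) (𝓝 (lyap S Z)) := by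
    refine tendsto_iff_norm_sub_tendsto_zero.2 ?_
    refine squeeze_zero' (Eventually.of_forall fun _ => norm_nonneg _)
      (g := fun ε => c⁻¹ * ((|ε| * ‖H‖) * ‖lyap S Z‖)) ?_ ?_
    · filter_upwards [hnear] with ε hε
      have h0 := hb 0 (by simpa using hδ.le)
      rw [zero_smul, add_zero] at h0
      have := h0.norm_lyap_sub_le hc (hb ε hε) Z
      rwa [add_sub_cancel_left, norm_smul, Real.norm_eq_abs] at this
    · have : Continuous fun ε : ℝ => c⁻¹ * ((|ε| * ‖H‖) * ‖lyap S Z‖) := by fun_prop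
      have h2 := this.tendsto 0
      simp only [abs_zero, zero_mul, mul_zero] at h2
      exact h2
  exact tendsto_trace_gradSq_mul hA hXlim

theorem abs_trace_gradSq_mul_le (hθ : 0 < θ) {A X : Matrix (Fin n) (Fin n) ℝ} {ε r : ℝ}
    (hε : |ε| ≤ 1) (hs : (A + ε • X).IsSymm) (hX : ‖X‖ ≤ r) :
    |(gradSq θ (A + ε • X) * X).trace|
      ≤ 2 * (g θ (0 : Matrix (Fin n) (Fin n) ℝ) + 2 * (‖A‖ + r)) * r := by
  have h1 : ‖A + ε • X‖ ≤ ‖A‖ + r := by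
    refine (norm_add_le _ _).trans (add_le_add le_rfl ?_)
    rw [norm_smul, Real.norm_eq_abs]
    nlinarith [norm_nonneg X, abs_nonneg ε]
  have hg0 : 0 ≤ g θ (0 : Matrix (Fin n) (Fin n) ℝ) := g_nonneg hθ Matrix.isSymm_zero
  have hr : 0 ≤ r := (norm_nonneg X).trans hX
  refine (abs_trace_mul_le _ _).trans (mul_le_mul ?_ hX (norm_nonneg _) (by positivity))
  refine (norm_gradSq_le hθ hs).trans ?_
  have := g_le hθ hs
  linarith

/-- The Euler–Lagrange equation in weak form. The state is varied along `S + ε H`; the control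
that drives the varied state is exactly `A + ε X` with `X` the solution of the Lyapunov equation
with coefficient `S + ε H` and right-hand side `H' - A H - H A`. -/
theorem IsMinimizer.integral_gradSq_mul_lyap (hθ : 0 < θ) {S₀ S₁ : Matrix (Fin n) (Fin n) ℝ}
    (hdet : S₀.det = S₁.det) {A S H H' : ℝ → Matrix (Fin n) (Fin n) ℝ}
    (h : IsMinimizer θ S₀ S₁ A S) (hH : MatHasACDeriv H H') (hH' : MemLp H' 2 unitMeasure)
    (hsH : ∀ t ∈ Icc (0 : ℝ) 1, (H t).IsSymm) (hsH' : ∀ᵐ t ∂unitMeasure, (H' t).IsSymm)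
    (hH0 : H 0 = 0) (hH1 : H 1 = 0) :
    ∫ t, (gradSq θ (A t) * lyap (S t) (H' t - (A t * H t + H t * A t))).trace ∂unitMeasure = 0 := by
  have hR := h.1.isRelaxed
  have hScont : ContinuousOn S (Icc 0 1) := hR.dynamics.continuousOn
  have hHcont : ContinuousOn H (Icc 0 1) := hH.continuousOn
  obtain ⟨c, hc, hb⟩ := exists_boundedBelow hScont hR.posDef
  obtain ⟨C, hC0, hC⟩ := exists_norm_le_of_continuousOn hHcont
  set Z : ℝ → Matrix (Fin n) (Fin n) ℝ := fun t => H' t - (A t * H t + H t * A t) with hZ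
  have hZL : MemLp Z 2 unitMeasure := hH'.sub (memLp_lyapunov hR.memLp hHcont)
  have hsS : ∀ t ∈ Icc (0 : ℝ) 1, (S t).IsSymm := fun t ht => isSymm_of_posDef (hR.posDef t ht)
  have hsZ : ∀ᵐ t ∂unitMeasure, (Z t).IsSymm := by
    filter_upwards [hR.symm, hsH', ae_mem_unit] with t h1 h2 ht
    refine h2.sub ?_
    rw [Matrix.IsSymm, Matrix.transpose_add, Matrix.transpose_mul, Matrix.transpose_mul, h1.eq,
      (hsH t ht).eq, add_comm]
  obtain ⟨X, hX⟩ : ∃ X : ℝ → ℝ → Matrix (Fin n) (Fin n) ℝ,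
      ∀ ε t, X ε t = lyap (S t + ε • H t) (Z t) := ⟨_, fun _ _ => rfl⟩
  -- The range of `ε` in which the varied state stays uniformly positive definite.
  set δ : ℝ := min 1 (c / 2 / (C + 1)) with hδ
  have hδ0 : 0 < δ := by positivity
  have hc2 : 0 < c / 2 := by positivity
  have hpert : ∀ ε, |ε| ≤ δ → ∀ t ∈ Icc (0 : ℝ) 1, BoundedBelow (c / 2) (S t + ε • H t) := by
    intro ε hε t ht
    refine (hb t ht).add ?_
    rw [norm_smul, Real.norm_eq_abs]
    calc |ε| * ‖H t‖ ≤ c / 2 / (C + 1) * (C + 1) :=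
          mul_le_mul (hε.trans (min_le_right _ _)) (by linarith [hC t ht]) (norm_nonneg _)
            (by positivity)
      _ = c / 2 := by field_simp
  have hsP : ∀ ε : ℝ, ∀ t ∈ Icc (0 : ℝ) 1, (S t + ε • H t).IsSymm := fun ε t ht =>
    (hsS t ht).add ((hsH t ht).smul ε)
  have hXle : ∀ ε, |ε| ≤ δ → ∀ t ∈ Icc (0 : ℝ) 1, ‖X ε t‖ ≤ c⁻¹ * ‖Z t‖ := by
    intro ε hε t ht
    have := (hpert ε hε t ht).norm_lyap_le hc2 (Z t)
    rwa [show 2 * (c / 2) = c by ring, ← hX] at this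
  have hXm : ∀ ε : ℝ, AEStronglyMeasurable (X ε) unitMeasure := fun ε => by
    rw [show X ε = fun t => lyap (S t + ε • H t) (Z t) from funext (hX ε)]
    exact aestronglyMeasurable_lyap (hScont.add (hHcont.const_smul ε)) hZL.1
  have hXL : ∀ ε, |ε| ≤ δ → MemLp (X ε) 2 unitMeasure := fun ε hε => by
    refine (hZL.norm.const_mul c⁻¹).mono (hXm ε) ?_
    filter_upwards [ae_mem_unit] with t ht
    exact (hXle ε hε t ht).trans (le_abs_self _)
  have hXs : ∀ ε, |ε| ≤ δ → ∀ᵐ t ∂unitMeasure, (X ε t).IsSymm := fun ε hε => by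
    filter_upwards [ae_mem_unit, hsZ] with t ht hz
    rw [hX]
    exact (hpert ε hε t ht).lyap_isSymm hc2 (hsP ε t ht) hz
  have hAs : ∀ ε, |ε| ≤ δ → ∀ᵐ t ∂unitMeasure, (A t + ε • X ε t).IsSymm := fun ε hε => by
    filter_upwards [hR.symm, hXs ε hε] with t h1 h2 using h1.add (h2.smul ε)
  have hAL : ∀ ε, |ε| ≤ δ → MemLp (fun t => A t + ε • X ε t) 2 unitMeasure := fun ε hε =>
    memLp_add_smul ε hR.memLp (hXL ε hε)
  obtain ⟨ψ, hψ⟩ : ∃ ψ : ℝ → ℝ,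
      ∀ ε, ψ ε = ∫ t, (gradSq θ (A t + ε • X ε t) * X ε t).trace ∂unitMeasure := ⟨_, fun _ => rfl⟩
  have hsign : ∀ ε, |ε| ≤ δ → 0 ≤ ε * ψ ε := by
    intro ε hε
    have hrel : IsRelaxed S₀ S₁ (fun t => A t + ε • X ε t) (fun t => S t + ε • H t) :=
      { memLp := hAL ε hε
        symm := hAs ε hε
        posDef := fun t ht => (hpert ε hε t ht).posDef hc2 (hsP ε t ht)
        dynamics := by
          refine (hR.dynamics.add (hH.const_smul ε)).congr_deriv ?_
          filter_upwards [ae_mem_unit] with t ht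
          have e := (hpert ε hε t ht).lyap_spec hc2 (Z t)
          have e2 : H' t = X ε t * (S t + ε • H t) + (S t + ε • H t) * X ε t
              + (A t * H t + H t * A t) := by
            rw [hX, e]; exact (sub_add_cancel _ _).symm
          rw [e2]
          simp only [Matrix.add_mul, Matrix.mul_add, Matrix.smul_mul, Matrix.mul_smul, smul_add]
          abel
        initial := by rw [hH0, smul_zero, add_zero, hR.initial]
        terminal := by rw [hH1, smul_zero, add_zero, hR.terminal] }
    have h1 := h.cost_le_of_isRelaxed hθ hdet hrel
    have h2 := cost_ge hθ (hAL ε hε) hR.memLp (hAs ε hε) hR.symm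
    have h3 : ∫ t, (gradSq θ (A t + ε • X ε t) * (A t - (A t + ε • X ε t))).trace ∂unitMeasure
        = -(ε * ψ ε) := by
      rw [hψ, ← integral_const_mul, ← integral_neg]
      refine integral_congr_ae (ae_of_all _ fun t => ?_)
      simp only [sub_add_cancel_left, Matrix.mul_neg, Matrix.mul_smul, Matrix.trace_neg,
        Matrix.trace_smul, smul_eq_mul]
    rw [h3] at h2
    linarith
  have hlim : Tendsto ψ (𝓝 0) (𝓝 (∫ t, (gradSq θ (A t) * lyap (S t) (Z t)).trace ∂unitMeasure)) := by
    have hnear : ∀ᶠ ε : ℝ in 𝓝 0, |ε| ≤ δ := by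
      filter_upwards [Metric.closedBall_mem_nhds (0 : ℝ) hδ0] with ε hε
      simpa [Real.dist_eq] using hε
    rw [show ψ = fun ε => ∫ t, (gradSq θ (A t + ε • X ε t) * X ε t).trace ∂unitMeasure
      from funext hψ]
    refine tendsto_integral_filter_of_dominated_convergence
      (fun t => 2 * (g θ (0 : Matrix (Fin n) (Fin n) ℝ) + 2 * (‖A t‖ + c⁻¹ * ‖Z t‖))
        * (c⁻¹ * ‖Z t‖)) ?_ ?_ ?_ ?_
    · filter_upwards [hnear] with ε hε
      exact (integrable_trace_mul (memLp_gradSq hθ (hAL ε hε) (hAs ε hε)) (hXL ε hε)).1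
    · filter_upwards [hnear] with ε hε
      filter_upwards [ae_mem_unit, hAs ε hε] with t ht hst
      exact abs_trace_gradSq_mul_le hθ (hε.trans (min_le_left _ _)) hst (hXle ε hε t ht)
    · have h1 : MemLp (fun t => 2 * (g θ (0 : Matrix (Fin n) (Fin n) ℝ)
          + 2 * (‖A t‖ + c⁻¹ * ‖Z t‖))) 2 unitMeasure := by
        generalize g θ (0 : Matrix (Fin n) (Fin n) ℝ) = k
        exact ((memLp_const k).add
          ((hR.memLp.norm.add (hZL.norm.const_mul c⁻¹)).const_mul 2)).const_mul 2
      exact h1.integrable_mul (hZL.norm.const_mul c⁻¹)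
    · filter_upwards [ae_mem_unit, hR.symm] with t ht hst
      simp only [hX]
      exact tendsto_trace_gradSq_mul_lyap hc2 hδ0 hst fun ε hε => hpert ε hε t ht
  refine le_antisymm ?_ ?_
  rotate_left
  · refine ge_of_tendsto (hlim.mono_left (nhdsWithin_le_nhds (s := Ioi 0))) ?_
    filter_upwards [Ioc_mem_nhdsGT hδ0] with ε hε
    have := hsign ε (by rw [abs_of_pos hε.1]; exact hε.2)
    exact nonneg_of_mul_nonneg_right this hε.1
  · refine le_of_tendsto (hlim.mono_left (nhdsWithin_le_nhds (s := Iio 0))) ?_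
    filter_upwards [Ico_mem_nhdsLT (neg_neg_of_pos hδ0)] with ε hε
    have := hsign ε (by rw [abs_of_neg hε.2]; linarith [hε.1])
    have h2 : 0 ≤ (-ε) * (-ψ ε) := by linarith
    linarith [nonneg_of_mul_nonneg_right h2 (neg_pos.2 hε.2)]

theorem memLp_of_continuousOn {S : ℝ → Matrix (Fin n) (Fin n) ℝ}
    (hS : ContinuousOn S (Icc 0 1)) : MemLp S 2 unitMeasure := by
  obtain ⟨C, -, hC⟩ := exists_norm_le_of_continuousOn hS
  refine MemLp.of_bound (aestronglyMeasurable_of_continuousOn hS) C ?_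
  filter_upwards [ae_mem_unit] with t ht using hC t ht

theorem integrable_mul_apply {X Y : ℝ → Matrix (Fin n) (Fin n) ℝ} (hX : MemLp X 2 unitMeasure)
    (hY : MemLp Y 2 unitMeasure) (i j : Fin n) :
    Integrable (fun t => (X t * Y t) i j) unitMeasure := by
  simp only [Matrix.mul_apply]
  exact integrable_finsetSum _ fun k _ =>
    (memLp_matrix_iff.1 hX i k).integrable_mul (memLp_matrix_iff.1 hY k j)

theorem isSymm_lyapunov {A P : Matrix (Fin n) (Fin n) ℝ} (hA : A.IsSymm) (hP : P.IsSymm) :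
    (A * P + P * A).IsSymm := by
  rw [Matrix.IsSymm, Matrix.transpose_add, Matrix.transpose_mul, Matrix.transpose_mul, hA.eq,
    hP.eq, add_comm]

/-- The curve `∫₀ᵗ X'` is symmetric if `X'` is. -/
theorem isSymm_integral {X' : ℝ → Matrix (Fin n) (Fin n) ℝ}
    (hs : ∀ᵐ t ∂unitMeasure, (X' t).IsSymm) {t : ℝ} (ht : t ∈ Icc (0 : ℝ) 1) :
    (Matrix.of fun i j =>
      (0 : Matrix (Fin n) (Fin n) ℝ) i j + ∫ s in (0 : ℝ)..t, X' s i j).IsSymm := by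
  ext i j
  simp only [Matrix.transpose_apply, Matrix.of_apply, Matrix.zero_apply]
  congr 1
  refine intervalIntegral_congr_unit ?_ (by simp) ht
  filter_upwards [hs] with s h using h.apply i j

theorem integral_trace_const_mul_eq_zero {H H' : ℝ → Matrix (Fin n) (Fin n) ℝ}
    (hH : MatHasACDeriv H H') (hH0 : H 0 = 0) (hH1 : H 1 = 0) (m : Matrix (Fin n) (Fin n) ℝ) :
    ∫ t, (m * H' t).trace ∂unitMeasure = 0 := by
  have h := ((MatHasACDeriv.const m).mul hH).trace.integral_eq_sub (s := 0) (t := 1) (by simp)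
    (by simp)
  rw [integral_zero_one_eq, hH0, hH1] at h
  simpa using h

/-! ### The costate -/

/-- The Euler–Lagrange equation in strong form: the solution `Λ` of `Λ S + S Λ = g G` has an
absolutely continuous representative, which solves the adjoint equation. This is the du
Bois-Reymond argument, applied to the variation whose derivative is the deviation of
`Λ + ∫ (A Λ + Λ A)` from its mean. -/
theorem IsMinimizer.exists_costate (hθ : 0 < θ) {S₀ S₁ : Matrix (Fin n) (Fin n) ℝ}
    (hdet : S₀.det = S₁.det) {A S : ℝ → Matrix (Fin n) (Fin n) ℝ}
    (h : IsMinimizer θ S₀ S₁ A S) :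
    ∃ Λ : ℝ → Matrix (Fin n) (Fin n) ℝ,
      MatHasACDeriv Λ (fun t => -(A t * Λ t + Λ t * A t)) ∧
      (∀ t ∈ Icc (0 : ℝ) 1, (Λ t).IsSymm) ∧
      ∀ᵐ t ∂unitMeasure, Λ t * S t + S t * Λ t = gradSq θ (A t) := by
  have hR := h.1.isRelaxed
  have hScont : ContinuousOn S (Icc 0 1) := hR.dynamics.continuousOn
  obtain ⟨c, hc, hb⟩ := exists_boundedBelow hScont hR.posDef
  have hsS : ∀ t ∈ Icc (0 : ℝ) 1, (S t).IsSymm := fun t ht => isSymm_of_posDef (hR.posDef t ht)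
  have hFL := memLp_gradSq hθ hR.memLp hR.symm
  obtain ⟨P, hP⟩ : ∃ P : ℝ → Matrix (Fin n) (Fin n) ℝ, ∀ t, P t = lyap (S t) (gradSq θ (A t)) :=
    ⟨_, fun _ => rfl⟩
  have hPspec : ∀ t ∈ Icc (0 : ℝ) 1, P t * S t + S t * P t = gradSq θ (A t) := fun t ht => by
    rw [hP]; exact (hb t ht).lyap_spec hc _
  have hPs : ∀ᵐ t ∂unitMeasure, (P t).IsSymm := by
    filter_upwards [ae_mem_unit, hR.symm] with t ht hs
    rw [hP]; exact (hb t ht).lyap_isSymm hc (hsS t ht) (gradSq_isSymm hs)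
  have hPL : MemLp P 2 unitMeasure := by
    have hm : AEStronglyMeasurable P unitMeasure := by
      rw [show P = fun t => lyap (S t) (gradSq θ (A t)) from funext hP]
      exact aestronglyMeasurable_lyap hScont hFL.1
    refine (hFL.norm.const_mul (2 * c)⁻¹).mono hm ?_
    filter_upwards [ae_mem_unit] with t ht
    rw [hP]
    exact ((hb t ht).norm_lyap_le hc _).trans (le_abs_self _)
  obtain ⟨D, hD⟩ : ∃ D : ℝ → Matrix (Fin n) (Fin n) ℝ, ∀ t, D t = A t * P t + P t * A t :=
    ⟨_, fun _ => rfl⟩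
  have hDi : ∀ i j, Integrable (fun t => D t i j) unitMeasure := fun i j => by
    simp only [hD, Matrix.add_apply]
    exact (integrable_mul_apply hR.memLp hPL i j).add (integrable_mul_apply hPL hR.memLp i j)
  have hDs : ∀ᵐ t ∂unitMeasure, (D t).IsSymm := by
    filter_upwards [hR.symm, hPs] with t h1 h2
    rw [hD]; exact isSymm_lyapunov h1 h2
  have hB := MatHasACDeriv.of_integral hDi 0
  have hBs := fun t ht => isSymm_integral hDs (t := t) ht
  set Bm : ℝ → Matrix (Fin n) (Fin n) ℝ := fun t => Matrix.of fun i j =>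
    (0 : Matrix (Fin n) (Fin n) ℝ) i j + ∫ s in (0 : ℝ)..t, D s i j with hBm
  have hBL : MemLp Bm 2 unitMeasure := memLp_of_continuousOn hB.continuousOn
  have hKi : ∀ i j, MemLp (fun t => P t i j + Bm t i j) 2 unitMeasure := fun i j =>
    (memLp_matrix_iff.1 hPL i j).add (memLp_matrix_iff.1 hBL i j)
  obtain ⟨m, hm⟩ : ∃ m : Matrix (Fin n) (Fin n) ℝ,
      ∀ i j, m i j = ∫ t, (P t i j + Bm t i j) ∂unitMeasure :=
    ⟨Matrix.of fun i j => ∫ t, (P t i j + Bm t i j) ∂unitMeasure, fun _ _ => rfl⟩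
  have hms : m.IsSymm := by
    ext i j
    rw [Matrix.transpose_apply, hm, hm]
    refine integral_congr_ae ?_
    filter_upwards [hPs, ae_mem_unit] with t h1 ht
    exact congrArg₂ (· + ·) (h1.apply i j) ((hBs t ht).apply i j)
  obtain ⟨H', hH'⟩ : ∃ H' : ℝ → Matrix (Fin n) (Fin n) ℝ, ∀ t, H' t = P t + Bm t - m :=
    ⟨_, fun _ => rfl⟩
  have hH'L : MemLp H' 2 unitMeasure := memLp_matrix_iff.2 fun i j => by
    simp only [hH', Matrix.sub_apply, Matrix.add_apply]
    exact (hKi i j).sub (memLp_const _)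
  have hH's : ∀ᵐ t ∂unitMeasure, (H' t).IsSymm := by
    filter_upwards [hPs, ae_mem_unit] with t h1 ht
    rw [hH']; exact (h1.add (hBs t ht)).sub hms
  have hH := MatHasACDeriv.of_integral (fun i j => integrable_apply hH'L i j) 0
  have hHs := fun t ht => isSymm_integral hH's (t := t) ht
  set H : ℝ → Matrix (Fin n) (Fin n) ℝ := fun t => Matrix.of fun i j =>
    (0 : Matrix (Fin n) (Fin n) ℝ) i j + ∫ s in (0 : ℝ)..t, H' s i j with hHdef
  have hH0 : H 0 = 0 := by ext i j; simp [hHdef]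
  have hH1 : H 1 = 0 := by
    ext i j
    simp only [hHdef, Matrix.of_apply, Matrix.zero_apply, zero_add]
    rw [integral_zero_one_eq]
    simp only [hH', Matrix.sub_apply, Matrix.add_apply]
    rw [integral_sub ((hKi i j).integrable one_le_two) (integrable_const _), ← hm]
    simp
  have hEL := h.integral_gradSq_mul_lyap hθ hdet hH hH'L hHs hH's hH0 hH1
  have hZL : MemLp (fun t => H' t - (A t * H t + H t * A t)) 2 unitMeasure :=
    hH'L.sub (memLp_lyapunov hR.memLp hH.continuousOn)
  have hi1 := integrable_trace_mul hPL hZL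
  have h1 : ∫ t, (P t * (H' t - (A t * H t + H t * A t))).trace ∂unitMeasure = 0 := by
    rw [← hEL]
    refine integral_congr_ae ?_
    filter_upwards [ae_mem_unit] with t ht
    have e := (hb t ht).lyap_spec hc (H' t - (A t * H t + H t * A t))
    generalize lyap (S t) (H' t - (A t * H t + H t * A t)) = X at e ⊢
    rw [← e, ← hPspec t ht, Matrix.mul_add, Matrix.add_mul, Matrix.trace_add, Matrix.trace_add,
      ← Matrix.mul_assoc, ← Matrix.mul_assoc, Matrix.trace_mul_comm (P t * X), Matrix.mul_assoc (S t),
      add_comm]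
  have hBH := (hB.mul hH).trace
  have h2 := hBH.integral_eq_sub (s := 0) (t := 1) (by simp) (by simp)
  rw [integral_zero_one_eq, hH0, hH1, Matrix.mul_zero, Matrix.mul_zero, sub_self] at h2
  have h3 := integral_trace_const_mul_eq_zero hH hH0 hH1 m
  have hi3 := integrable_trace_mul (memLp_const (μ := unitMeasure) m) hH'L
  have h4 : ∫ t, ‖H' t‖ ^ 2 ∂unitMeasure = 0 := by
    have e : ∀ᵐ t ∂unitMeasure, ‖H' t‖ ^ 2 = (P t * (H' t - (A t * H t + H t * A t))).trace
        + (D t * H t + Bm t * H' t).trace - (m * H' t).trace := by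
      filter_upwards [hH's] with t hs
      have e1 : (P t * (A t * H t + H t * A t)).trace = (D t * H t).trace := by
        rw [hD, Matrix.mul_add, Matrix.add_mul, Matrix.trace_add, Matrix.trace_add,
          ← Matrix.mul_assoc, ← Matrix.mul_assoc, Matrix.trace_mul_comm (P t * H t),
          ← Matrix.mul_assoc, add_comm]
      have e2 : (H' t * H' t).trace = (P t * H' t).trace + (Bm t * H' t).trace
          - (m * H' t).trace := by
        have := congrArg (fun Y => (Y * H' t).trace) (hH' t)
        simpa only [Matrix.sub_mul, Matrix.add_mul, Matrix.trace_sub, Matrix.trace_add] using this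
      rw [norm_sq_eq_trace hs, e2, Matrix.mul_sub, Matrix.trace_sub, e1, Matrix.trace_add]
      ring
    have hi13 : Integrable (fun t => (P t * (H' t - (A t * H t + H t * A t))).trace
        + (D t * H t + Bm t * H' t).trace) unitMeasure := hi1.add hBH.integrable
    rw [integral_congr_ae e, integral_sub hi13 hi3,
      integral_add hi1 hBH.integrable, h1, h2, h3]
    simp
  have hzero : ∀ᵐ t ∂unitMeasure, P t = m - Bm t := by
    have := (integral_eq_zero_iff_of_nonneg (fun t => sq_nonneg ‖H' t‖)
      hH'L.norm.integrable_sq).1 h4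
    filter_upwards [this] with t ht
    have h5 : H' t = 0 := norm_eq_zero.1 (pow_eq_zero_iff two_ne_zero |>.1 ht)
    rw [hH', sub_eq_zero] at h5
    rw [← h5, add_sub_cancel_right]
  refine ⟨fun t => m + (-1 : ℝ) • Bm t, ?_, ?_, ?_⟩
  · refine ((MatHasACDeriv.const m).add (hB.const_smul (-1))).congr_deriv ?_
    filter_upwards [hzero] with t ht
    rw [hD, ht, zero_add, neg_one_smul, neg_one_smul, sub_eq_add_neg]
  · exact fun t ht => hms.add ((hBs t ht).smul _)
  · filter_upwards [hzero, ae_mem_unit] with t ht hm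
    rw [neg_one_smul, ← sub_eq_add_neg, ← ht, hPspec t hm]

/-! ### Recovering a continuous control from its momentum -/

theorem mem_closure_of_ae {E : Set ℝ} (hE : ∀ᵐ t ∂unitMeasure, t ∈ E) {t : ℝ}
    (ht : t ∈ Icc (0 : ℝ) 1) : t ∈ closure (E ∩ Icc 0 1) := by
  rw [Metric.mem_closure_iff]
  intro ε hε
  by_contra hcon
  push Not at hcon
  have h0 : volume (Ioo (max 0 (t - ε)) (min 1 (t + ε))) = 0 := by
    have h1 := ae_unitMeasure_iff.1 hE
    refine measure_mono_null ?_ h1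
    intro s hs
    have hs0 : s ∈ Icc (0 : ℝ) 1 :=
      ⟨(le_max_left _ _).trans hs.1.le, hs.2.le.trans (min_le_left _ _)⟩
    intro hsE
    have h2 := hcon s ⟨hsE hs0, hs0⟩
    rw [Real.dist_eq] at h2
    have h3 : t - ε < s := (le_max_right _ _).trans_lt hs.1
    have h4 : s < t + ε := hs.2.trans_le (min_le_right _ _)
    exact absurd h2 (not_le.2 (abs_lt.2 ⟨by linarith, by linarith⟩))
  rw [Real.volume_Ioo, ENNReal.ofReal_eq_zero] at h0
  have : max 0 (t - ε) < min 1 (t + ε) := by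
    rw [max_lt_iff, lt_min_iff, lt_min_iff]
    exact ⟨⟨one_pos, by linarith [ht.1]⟩, by linarith [ht.2], by linarith⟩
  linarith

theorem tendsto_apply {X : ℕ → Matrix (Fin n) (Fin n) ℝ} {Y : Matrix (Fin n) (Fin n) ℝ}
    (h : Tendsto X atTop (𝓝 Y)) (i j : Fin n) : Tendsto (fun k => X k i j) atTop (𝓝 (Y i j)) :=
  (((continuous_apply j).comp (continuous_apply i) :
      Continuous fun M : Matrix (Fin n) (Fin n) ℝ => M i j).tendsto Y).comp h

/-- Properness and strong monotonicity of `gradSq` turn a control whose momentum is continuous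
into a continuous control. -/
theorem exists_continuous_control (hθ : 0 < θ) {A N : ℝ → Matrix (Fin n) (Fin n) ℝ}
    (hN : ContinuousOn N (Icc 0 1)) (hs : ∀ᵐ t ∂unitMeasure, (A t).IsSymm)
    (htr : ∀ᵐ t ∂unitMeasure, (A t).trace = 0) (hF : ∀ᵐ t ∂unitMeasure, gradSq θ (A t) = N t) :
    ∃ A' : ℝ → Matrix (Fin n) (Fin n) ℝ, ContinuousOn A' (Icc 0 1) ∧
      (∀ t ∈ Icc (0 : ℝ) 1, (A' t).IsSymm ∧ (A' t).trace = 0 ∧ gradSq θ (A' t) = N t) ∧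
      ∀ᵐ t ∂unitMeasure, A t = A' t := by
  obtain ⟨M, -, hM⟩ := exists_norm_le_of_continuousOn hN
  obtain ⟨R, hR⟩ := exists_norm_le_of_norm_gradSq_le (n := n) hθ M
  obtain ⟨c, hc, hmono⟩ := exists_norm_sub_le_gradSq (n := n) hθ R
  have hex : ∀ t ∈ Icc (0 : ℝ) 1, ∃ X : Matrix (Fin n) (Fin n) ℝ,
      X.IsSymm ∧ X.trace = 0 ∧ gradSq θ X = N t := by
    intro t ht
    have hcl := mem_closure_of_ae (E := {t | (A t).IsSymm ∧ (A t).trace = 0 ∧ gradSq θ (A t) = N t})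
      (by filter_upwards [hs, htr, hF] with t h1 h2 h3 using ⟨h1, h2, h3⟩) ht
    obtain ⟨u, hu, hut⟩ := mem_closure_iff_seq_limit.1 hcl
    have hball : ∀ k, A (u k) ∈ Metric.closedBall (0 : Matrix (Fin n) (Fin n) ℝ) R := fun k => by
      rw [mem_closedBall_zero_iff]
      refine hR _ (hu k).1.1 (hu k).1.2.1 ?_
      rw [(hu k).1.2.2]
      exact hM _ (hu k).2
    obtain ⟨X, -, φ, hφ, hX⟩ := (isCompact_closedBall (0 : Matrix (Fin n) (Fin n) ℝ) R).tendsto_subseq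
      hball
    have hXs : X.IsSymm := by
      ext i j
      refine tendsto_nhds_unique (tendsto_apply hX j i) ?_
      refine (tendsto_apply hX i j).congr fun k => ?_
      exact ((hu (φ k)).1.1.apply i j).symm
    refine ⟨X, hXs, ?_, ?_⟩
    · have h1 : Tendsto (fun k => (A (u (φ k))).trace) atTop (𝓝 X.trace) :=
        tendsto_finsetSum _ fun i _ => tendsto_apply hX i i
      refine tendsto_nhds_unique h1 (tendsto_const_nhds.congr fun k => ?_)
      exact (hu (φ k)).1.2.1.symm
    · have h1 : Tendsto (fun k => gradSq θ (A (u (φ k)))) atTop (𝓝 (gradSq θ X)) :=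
        (continuousAt_gradSq hXs).tendsto.comp hX
      have hut' : Tendsto (fun k => u (φ k)) atTop (𝓝[Icc 0 1] t) :=
        tendsto_nhdsWithin_iff.2 ⟨hut.comp hφ.tendsto_atTop,
          Eventually.of_forall fun k => (hu (φ k)).2⟩
      have h2 : Tendsto (fun k => N (u (φ k))) atTop (𝓝 (N t)) := (hN t ht).tendsto.comp hut'
      ext i j
      refine tendsto_nhds_unique (tendsto_apply h1 i j) ((tendsto_apply h2 i j).congr fun k => ?_)
      rw [(hu (φ k)).1.2.2]
  choose! A' hA' using hex
  have hA'R : ∀ t ∈ Icc (0 : ℝ) 1, ‖A' t‖ ≤ R := fun t ht =>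
    hR _ (hA' t ht).1 (hA' t ht).2.1 (by rw [(hA' t ht).2.2]; exact hM t ht)
  refine ⟨A', fun t ht => ?_, hA', ?_⟩
  · refine tendsto_iff_norm_sub_tendsto_zero.2 ?_
    refine squeeze_zero' (Eventually.of_forall fun _ => norm_nonneg _)
      (g := fun s => c * ‖N s - N t‖) ?_ ?_
    · filter_upwards [self_mem_nhdsWithin] with s hs
      have := hmono _ _ (hA' s hs).1 (hA' t ht).1 (hA' s hs).2.1 (hA' t ht).2.1 (hA'R s hs)
        (hA'R t ht)
      rwa [(hA' s hs).2.2, (hA' t ht).2.2] at this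
    · have h1 : Tendsto (fun s => ‖N s - N t‖) (𝓝[Icc 0 1] t) (𝓝 0) :=
        tendsto_iff_norm_sub_tendsto_zero.1 (hN t ht)
      simpa using h1.const_mul c
  · filter_upwards [hs, htr, hF, ae_mem_unit] with t h1 h2 h3 ht
    have hAR : ‖A t‖ ≤ R := hR _ h1 h2 (by rw [h3]; exact hM t ht)
    have := hmono _ _ h1 (hA' t ht).1 h2 (hA' t ht).2.1 hAR (hA'R t ht)
    rw [h3, (hA' t ht).2.2, sub_self, norm_zero, mul_zero] at this
    exact sub_eq_zero.1 (norm_le_zero_iff.1 this)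

/-! ### The extremal system: existence along a minimizer -/

theorem HasACDeriv.hasDerivWithinAt {f f' : ℝ → ℝ} (hf : HasACDeriv f f')
    (hc : ContinuousOn f' (Icc 0 1)) {t : ℝ} (ht : t ∈ Icc (0 : ℝ) 1) :
    HasDerivWithinAt f (f' t) (Icc 0 1) t := by
  set φ : ℝ → ℝ := IccExtend (zero_le_one (α := ℝ)) ((Icc (0 : ℝ) 1).domRestrict f') with hφ
  have hφc : Continuous φ := (continuousOn_iff_continuous_domRestrict.1 hc).Icc_extend'
  have hφe : ∀ s ∈ Icc (0 : ℝ) 1, φ s = f' s := fun s hs => by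
    rw [hφ, IccExtend_of_mem _ _ hs]; rfl
  have h1 : HasDerivAt (fun s => f 0 + ∫ u in (0 : ℝ)..s, φ u) (φ t) t :=
    (hφc.integral_hasStrictDerivAt 0 t).hasDerivAt.const_add _
  rw [hφe t ht] at h1
  have e : ∀ s ∈ Icc (0 : ℝ) 1, f s = f 0 + ∫ u in (0 : ℝ)..s, φ u := fun s hs => by
    rw [intervalIntegral_congr_unit (g := f') (by
      filter_upwards [ae_mem_unit] with u hu using hφe u hu) (by simp) hs,
      hf.integral_eq_sub (by simp) hs]
    ring
  exact h1.hasDerivWithinAt.congr e (e t ht)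

theorem MatHasACDeriv.hasDerivOnUnit {X X' Y' : ℝ → Matrix (Fin n) (Fin n) ℝ}
    (hX : MatHasACDeriv X X') (hc : ContinuousOn X' (Icc 0 1))
    (e : ∀ t ∈ Icc (0 : ℝ) 1, X' t = Y' t) : HasDerivOnUnit X Y' := fun t ht i j => by
  have h1 : ContinuousOn (fun t => X' t i j) (Icc 0 1) :=
    ((continuous_apply j).comp (continuous_apply i) :
      Continuous fun M : Matrix (Fin n) (Fin n) ℝ => M i j).comp_continuousOn hc
  have := (hX i j).hasDerivWithinAt h1 ht
  rwa [e t ht] at this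

/-- The costate `Λ` of a minimizer yields a solution of the extremal system: `M = -(Λ S + S Λ)` and
`Ω = S Λ - Λ S` are the symmetric and the antisymmetric part of `-2 Λ S`. -/
theorem IsMinimizer.exists_isExtremal (hθ : 0 < θ) {S₀ S₁ : Matrix (Fin n) (Fin n) ℝ}
    (hdet : S₀.det = S₁.det) {A S : ℝ → Matrix (Fin n) (Fin n) ℝ}
    (h : IsMinimizer θ S₀ S₁ A S) :
    ∃ (Λ₀ : Matrix (Fin n) (Fin n) ℝ) (A' M Ω : ℝ → Matrix (Fin n) (Fin n) ℝ),
      Λ₀.IsSymm ∧ IsExtremal θ S₀ (Λ₀ * S₀) A' S M Ω ∧ ∀ᵐ t ∂unitMeasure, A t = A' t := by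
  have hR := h.1.isRelaxed
  obtain ⟨Λ, hΛ, hΛs, hΛF⟩ := h.exists_costate hθ hdet
  have hSc : ContinuousOn S (Icc 0 1) := hR.dynamics.continuousOn
  have hΛc : ContinuousOn Λ (Icc 0 1) := hΛ.continuousOn
  have hsS : ∀ t ∈ Icc (0 : ℝ) 1, (S t).IsSymm := fun t ht => isSymm_of_posDef (hR.posDef t ht)
  obtain ⟨A', hA'c, hA', hAA'⟩ := exists_continuous_control hθ
    (N := fun t => Λ t * S t + S t * Λ t) ((hΛc.mul hSc).add (hSc.mul hΛc)) hR.symm h.1.traceless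
    (by filter_upwards [hΛF] with t ht using ht.symm)
  have hS' : MatHasACDeriv S (fun t => A' t * S t + S t * A' t) :=
    hR.dynamics.congr_deriv (by filter_upwards [hAA'] with t ht using by rw [ht])
  have hΛ' : MatHasACDeriv Λ (fun t => (-1 : ℝ) • (A' t * Λ t + Λ t * A' t)) :=
    hΛ.congr_deriv (by filter_upwards [hAA'] with t ht using by rw [ht, neg_one_smul])
  have hSc' : ContinuousOn (fun t => A' t * S t + S t * A' t) (Icc 0 1) :=
    (hA'c.mul hSc).add (hSc.mul hA'c)
  have hΛc' : ContinuousOn (fun t => (-1 : ℝ) • (A' t * Λ t + Λ t * A' t)) (Icc 0 1) :=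
    ((hA'c.mul hΛc).add (hΛc.mul hA'c)).const_smul (-1 : ℝ)
  have h0 : (0 : ℝ) ∈ Icc (0 : ℝ) 1 := by simp
  have hL0 : ((-2 : ℝ) • Λ 0 * S₀)ᵀ = (-2 : ℝ) • (S₀ * Λ 0) := by
    rw [Matrix.transpose_mul, Matrix.transpose_smul, (hΛs 0 h0).eq, ← hR.initial, (hsS 0 h0).eq,
      Matrix.mul_smul]
  have htr0 : ((-2 : ℝ) • Λ 0 * S₀).trace = 0 := by
    have h1 := trace_gradSq (θ := θ) (hA' 0 h0).1
    rw [(hA' 0 h0).2.2, Matrix.trace_add, Matrix.trace_mul_comm (S 0), hR.initial] at h1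
    rw [Matrix.smul_mul, Matrix.trace_smul, smul_eq_mul]
    linarith
  refine ⟨(-2 : ℝ) • Λ 0, A', fun t => (-1 : ℝ) • (Λ t * S t + S t * Λ t),
    fun t => S t * Λ t + (-1 : ℝ) • (Λ t * S t), (hΛs 0 h0).smul _, ?_, hAA'⟩
  exact
    { symm := fun t ht => (hA' t ht).1
      traceless := fun t ht => (hA' t ht).2.1
      momentum := fun t ht => by
        rw [neg_one_smul, ← (hA' t ht).2.2, gradSq]
      deriv_S := hS'.hasDerivOnUnit hSc' fun _ _ => rfl
      deriv_M := by
        refine (((hΛ'.mul hS').add (hS'.mul hΛ')).const_smul (-1)).hasDerivOnUnit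
          ((((hΛc'.mul hSc).add (hΛc.mul hSc')).add
            ((hSc'.mul hΛc).add (hSc.mul hΛc'))).const_smul (-1 : ℝ)) fun t _ => ?_
        simp only [neg_one_smul]
        noncomm_ring
      deriv_Ω := by
        refine ((hS'.mul hΛ').add ((hΛ'.mul hS').const_smul (-1))).hasDerivOnUnit
          (((hSc'.mul hΛc).add (hSc.mul hΛc')).add
            (((hΛc'.mul hSc).add (hΛc.mul hSc')).const_smul (-1 : ℝ))) fun t ht => ?_
        -- The derivative is the commutator of `A` with `Λ S + S Λ = g G`, a function of `A`.
        have hcomm : (Λ t * S t + S t * Λ t) * A' t = A' t * (Λ t * S t + S t * Λ t) := by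
          rw [← (hA' t ht).2.2]; exact (gradSq_commute θ (A' t)).eq
        simp only [neg_one_smul]
        calc _ = A' t * (Λ t * S t + S t * Λ t) - (Λ t * S t + S t * Λ t) * A' t := by
              noncomm_ring
          _ = 0 := by rw [hcomm, sub_self]
      init_S := hR.initial
      init_M := by
        rw [tracelessSymPart, hL0, htr0, hR.initial, zero_div, zero_smul, sub_zero,
          Matrix.smul_mul, ← smul_add, smul_smul]
        norm_num
      init_Ω := by
        rw [skewPart, hL0, hR.initial, Matrix.smul_mul, ← smul_sub, smul_smul]
        norm_num [sub_eq_add_neg]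
        exact add_comm _ _ }

/-! ### Uniqueness for the extremal system -/

theorem HasDerivOnUnit.hasDerivWithinAt {F F' : ℝ → Matrix (Fin n) (Fin n) ℝ}
    (hF : HasDerivOnUnit F F') {t : ℝ} (ht : t ∈ Icc (0 : ℝ) 1) :
    HasDerivWithinAt F (F' t) (Icc 0 1) t := by
  have e : ∀ M : Matrix (Fin n) (Fin n) ℝ, M = ∑ i, ∑ j, M i j • Matrix.single i j (1 : ℝ) := by
    intro M
    conv_lhs => rw [Matrix.matrix_eq_sum_single M]
    exact Finset.sum_congr rfl fun i _ => Finset.sum_congr rfl fun j _ => by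
      rw [Matrix.smul_single, smul_eq_mul, mul_one]
  have h1 : HasDerivWithinAt (fun s => ∑ i, ∑ j, F s i j • Matrix.single i j (1 : ℝ))
      (∑ i, ∑ j, F' t i j • Matrix.single i j (1 : ℝ)) (Icc 0 1) t :=
    HasDerivWithinAt.fun_sum fun i _ => HasDerivWithinAt.fun_sum fun j _ =>
      (hF t ht i j).smul_const _
  rw [← e (F' t)] at h1
  exact h1.congr (fun s _ => e (F s)) (e (F t))

theorem HasDerivOnUnit.continuousOn {F F' : ℝ → Matrix (Fin n) (Fin n) ℝ}
    (hF : HasDerivOnUnit F F') : ContinuousOn F (Icc 0 1) := fun _ ht =>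
  (hF.hasDerivWithinAt ht).continuousWithinAt

/-- Grönwall uniqueness for matrix curves on `[0,1]`. -/
theorem HasDerivOnUnit.eq_of_norm_sub_le {F F' E E' : ℝ → Matrix (Fin n) (Fin n) ℝ}
    (hF : HasDerivOnUnit F F') (hE : HasDerivOnUnit E E') (h0 : F 0 = E 0) {K : ℝ}
    (hK : ∀ t ∈ Icc (0 : ℝ) 1, ‖F' t - E' t‖ ≤ K * ‖F t - E t‖) {t : ℝ}
    (ht : t ∈ Icc (0 : ℝ) 1) : F t = E t := by
  have h := eq_zero_of_abs_deriv_le_mul_abs_self_of_eq_zero_right (f := fun s => F s - E s)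
    (f' := fun s => F' s - E' s) (K := K) (a := 0) (b := 1)
    (hF.continuousOn.sub hE.continuousOn)
    (fun s hs => ((hF.hasDerivWithinAt (Ico_subset_Icc_self hs)).sub
      (hE.hasDerivWithinAt (Ico_subset_Icc_self hs))).mono_of_mem_nhdsWithin
        (Icc_mem_nhdsGE_of_mem hs)) (by rw [h0, sub_self])
    (fun s hs => hK s (Ico_subset_Icc_self hs)) t ht
  exact sub_eq_zero.1 h

/-- The momentum determines the control in a locally Lipschitz way, so that the extremal system is
an ordinary differential equation with locally Lipschitz right-hand side for `(S, M, Ω)`. -/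
theorem IsExtremal.unique (hθ : 0 < θ) {S₀ L₀ : Matrix (Fin n) (Fin n) ℝ}
    {A S M Ω B T N W : ℝ → Matrix (Fin n) (Fin n) ℝ} (h : IsExtremal θ S₀ L₀ A S M Ω)
    (h' : IsExtremal θ S₀ L₀ B T N W) {t : ℝ} (ht : t ∈ Icc (0 : ℝ) 1) :
    B t = A t ∧ T t = S t ∧ N t = M t ∧ W t = Ω t := by
  have hΩ : ∀ s ∈ Icc (0 : ℝ) 1, W s = Ω s := fun s hs =>
    h'.deriv_Ω.eq_of_norm_sub_le h.deriv_Ω (by rw [h'.init_Ω, h.init_Ω]) (K := 0)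
      (fun u _ => by simp) hs
  obtain ⟨k, hk0, hk⟩ := exists_norm_le_of_continuousOn h.deriv_Ω.continuousOn
  obtain ⟨m₁, hm₁0, hm₁⟩ := exists_norm_le_of_continuousOn h.deriv_M.continuousOn
  obtain ⟨m₂, hm₂0, hm₂⟩ := exists_norm_le_of_continuousOn h'.deriv_M.continuousOn
  obtain ⟨R, hR⟩ := exists_norm_le_of_norm_gradSq_le (n := n) hθ (m₁ + m₂)
  obtain ⟨c, hc, hmono⟩ := exists_norm_sub_le_gradSq (n := n) hθ R
  have hFA : ∀ s ∈ Icc (0 : ℝ) 1, gradSq θ (A s) = -M s := fun s hs => by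
    rw [h.momentum s hs, neg_neg, gradSq]
  have hFB : ∀ s ∈ Icc (0 : ℝ) 1, gradSq θ (B s) = -N s := fun s hs => by
    rw [h'.momentum s hs, neg_neg, gradSq]
  have hAR : ∀ s ∈ Icc (0 : ℝ) 1, ‖A s‖ ≤ R := fun s hs =>
    hR _ (h.symm s hs) (h.traceless s hs) (by
      rw [hFA s hs, norm_neg]; linarith [hm₁ s hs])
  have hBR : ∀ s ∈ Icc (0 : ℝ) 1, ‖B s‖ ≤ R := fun s hs =>
    hR _ (h'.symm s hs) (h'.traceless s hs) (by
      rw [hFB s hs, norm_neg]; linarith [hm₂ s hs])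
  have hBA : ∀ s ∈ Icc (0 : ℝ) 1, ‖B s - A s‖ ≤ c * ‖N s - M s‖ := fun s hs => by
    have := hmono _ _ (h'.symm s hs) (h.symm s hs) (h'.traceless s hs) (h.traceless s hs)
      (hBR s hs) (hAR s hs)
    rwa [hFA s hs, hFB s hs, neg_sub_neg, norm_sub_rev (M s)] at this
  have hM : ∀ s ∈ Icc (0 : ℝ) 1, N s = M s := fun s hs =>
    h'.deriv_M.eq_of_norm_sub_le h.deriv_M (by rw [h'.init_M, h.init_M]) (K := 2 * k * c)
      (fun u hu => by
        have e : W u * B u - B u * W u - (Ω u * A u - A u * Ω u)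
            = Ω u * (B u - A u) - (B u - A u) * Ω u := by rw [hΩ u hu]; noncomm_ring
        rw [e]
        have h1 := (norm_sub_le (Ω u * (B u - A u)) ((B u - A u) * Ω u)).trans
          (add_le_add (norm_mul_le _ _) (norm_mul_le _ _))
        have h2 := mul_le_mul (hk u hu) (hBA u hu) (norm_nonneg _) hk0
        linarith) hs
  have hA : ∀ s ∈ Icc (0 : ℝ) 1, B s = A s := fun s hs => by
    have := hBA s hs
    rw [hM s hs, sub_self, norm_zero, mul_zero] at this
    exact sub_eq_zero.1 (norm_le_zero_iff.1 this)
  have hS : ∀ s ∈ Icc (0 : ℝ) 1, T s = S s := fun s hs =>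
    h'.deriv_S.eq_of_norm_sub_le h.deriv_S (by rw [h'.init_S, h.init_S]) (K := 2 * R)
      (fun u hu => by
        have e : B u * T u + T u * B u - (A u * S u + S u * A u)
            = A u * (T u - S u) + (T u - S u) * A u := by rw [hA u hu]; noncomm_ring
        rw [e]
        refine (norm_lyapunov_le _ _).trans ?_
        have := mul_le_mul_of_nonneg_right (hAR u hu) (norm_nonneg (T u - S u))
        linarith) hs
  exact ⟨hA t ht, hS t ht, hM t ht, hΩ t ht⟩

/-! ### Compactness along an ultrafilter -/

theorem inner_toLp {f φ : ℝ → ℝ} (hf : MemLp f 2 unitMeasure) (hφ : MemLp φ 2 unitMeasure) :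
    inner ℝ (hf.toLp f) (hφ.toLp φ) = ∫ t, f t * φ t ∂unitMeasure := by
  rw [L2.inner_def]
  refine integral_congr_ae ?_
  filter_upwards [hf.coeFn_toLp, hφ.coeFn_toLp] with t h1 h2
  rw [h1, h2]; exact mul_comm _ _

/-- Bounded sequences in `L²` converge weakly along ultrafilters (Banach–Alaoglu and Riesz). -/
theorem exists_weak_limit (U : Ultrafilter ℕ) {f : ℕ → ℝ → ℝ} {C : ℝ}
    (hf : ∀ k, MemLp (f k) 2 unitMeasure) (hb : ∀ k, ∫ t, f k t ^ 2 ∂unitMeasure ≤ C) :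
    ∃ F : ℝ → ℝ, MemLp F 2 unitMeasure ∧ ∀ φ : ℝ → ℝ, MemLp φ 2 unitMeasure →
      Tendsto (fun k => ∫ t, f k t * φ t ∂unitMeasure) U (𝓝 (∫ t, F t * φ t ∂unitMeasure)) := by
  let u : ℕ → Lp ℝ 2 unitMeasure := fun k => (hf k).toLp (f k)
  have hu : ∀ k, ‖u k‖ ≤ Real.sqrt C := by
    intro k
    refine Real.le_sqrt_of_sq_le ?_
    rw [← real_inner_self_eq_norm_sq, inner_toLp]
    simpa only [sq] using hb k
  let v : ℕ → WeakDual ℝ (Lp ℝ 2 unitMeasure) := fun k =>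
    StrongDual.toWeakDual (InnerProductSpace.toDual ℝ _ (u k))
  have hv : ∀ k, v k ∈ WeakDual.toStrongDual ⁻¹'
      Metric.closedBall (0 : StrongDual ℝ (Lp ℝ 2 unitMeasure)) (Real.sqrt C) := by
    intro k
    rw [mem_preimage, mem_closedBall_zero_iff]
    exact ((InnerProductSpace.toDual ℝ _).norm_map (u k)).le.trans (hu k)
  obtain ⟨ℓ, -, hℓ⟩ := (WeakDual.isCompact_closedBall
    (0 : StrongDual ℝ (Lp ℝ 2 unitMeasure)) (Real.sqrt C)).ultrafilter_le_nhds' (U.map v)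
    (Filter.mem_map.2 (Filter.univ_mem' hv))
  have hlim : ∀ x, Tendsto (fun k => inner ℝ (u k) x) U (𝓝 (ℓ x)) := by
    intro x
    exact ((WeakDual.eval_continuous x).tendsto ℓ).comp (show Tendsto v U (𝓝 ℓ) from hℓ)
  let F := (InnerProductSpace.toDual ℝ (Lp ℝ 2 unitMeasure)).symm (WeakDual.toStrongDual ℓ)
  refine ⟨F, Lp.memLp F, fun φ hφ => ?_⟩
  have h := hlim (hφ.toLp φ)
  have e : ℓ (hφ.toLp φ) = ∫ t, F t * φ t ∂unitMeasure := by
    rw [← inner_toLp (Lp.memLp F) hφ, Lp.toLp_coeFn]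
    exact (InnerProductSpace.toDual_symm_apply (𝕜 := ℝ)).symm
  rw [e] at h
  refine h.congr fun k => ?_
  exact inner_toLp (hf k) hφ

/-- Bounded uniformly equicontinuous sequences converge uniformly along ultrafilters. -/
theorem exists_tendstoUniformlyOn (U : Ultrafilter ℕ) {f : ℕ → ℝ → ℝ} {C : ℝ}
    (hb : ∀ k, ∀ t ∈ Icc (0 : ℝ) 1, |f k t| ≤ C)
    (he : ∀ ε > 0, ∃ δ > 0, ∀ k, ∀ s ∈ Icc (0 : ℝ) 1, ∀ t ∈ Icc (0 : ℝ) 1, |s - t| < δ →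
      |f k s - f k t| ≤ ε) :
    ∃ F : ℝ → ℝ, ContinuousOn F (Icc 0 1) ∧ TendstoUniformlyOn f F U (Icc 0 1) := by
  have hpt : ∀ t, ∃ y, t ∈ Icc (0 : ℝ) 1 → Tendsto (fun k => f k t) U (𝓝 y) := by
    intro t
    by_cases ht : t ∈ Icc (0 : ℝ) 1
    · obtain ⟨y, -, hy⟩ := (isCompact_Icc (a := -C) (b := C)).ultrafilter_le_nhds'
        (U.map fun k => f k t) (Filter.mem_map.2 (Filter.univ_mem' fun k => abs_le.1 (hb k t ht)))
      exact ⟨y, fun _ => hy⟩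
    · exact ⟨0, fun h => absurd h ht⟩
  choose F hF using hpt
  have heF : ∀ ε > 0, ∃ δ > 0, ∀ s ∈ Icc (0 : ℝ) 1, ∀ t ∈ Icc (0 : ℝ) 1, |s - t| < δ →
      (∀ k, |f k s - f k t| ≤ ε) ∧ |F s - F t| ≤ ε := by
    intro ε hε
    obtain ⟨δ, hδ, H⟩ := he ε hε
    refine ⟨δ, hδ, fun s hs t ht hst => ⟨fun k => H k s hs t ht hst, ?_⟩⟩
    exact le_of_tendsto ((hF s hs).sub (hF t ht)).abs (Eventually.of_forall fun k => H k s hs t ht hst)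
  refine ⟨F, ?_, ?_⟩
  · refine Metric.continuousOn_iff.2 fun t ht ε hε => ?_
    obtain ⟨δ, hδ, H⟩ := heF (ε / 2) (half_pos hε)
    refine ⟨δ, hδ, fun s hs hst => ?_⟩
    rw [Real.dist_eq] at hst ⊢
    linarith [(H s hs t ht hst).2]
  · refine Metric.tendstoUniformlyOn_iff.2 fun ε hε => ?_
    obtain ⟨δ, hδ, H⟩ := heF (ε / 4) (by positivity)
    obtain ⟨T, hTI, hTf, hT⟩ :=
      finite_cover_balls_of_compact (isCompact_Icc (a := (0 : ℝ)) (b := 1)) hδ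
    have hev : ∀ᶠ k in (U : Filter ℕ), ∀ s ∈ T, |f k s - F s| < ε / 4 := by
      rw [hTf.eventually_all]
      intro s hs
      have := Metric.tendsto_nhds.1 (hF s (hTI hs)) (ε / 4) (by positivity)
      simpa only [Real.dist_eq] using this
    filter_upwards [hev] with k hk t ht
    obtain ⟨s, hs, hts⟩ := mem_iUnion₂.1 (hT ht)
    rw [Metric.mem_ball, Real.dist_eq] at hts
    obtain ⟨h1, h2⟩ := H t ht s (hTI hs) hts
    have h3 := hk s hs
    rw [Real.dist_eq]
    calc |F t - f k t| = |(F t - F s) - (f k t - f k s) - (f k s - F s)| := by congr 1; ring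
      _ ≤ |F t - F s| + |f k t - f k s| + |f k s - F s| :=
        (abs_sub _ _).trans (add_le_add (abs_sub _ _) le_rfl)
      _ < ε := by linarith [h1 k]

theorem intervalIntegral_eq_integral_indicator (φ : ℝ → ℝ) {t : ℝ} (ht : t ∈ Icc (0 : ℝ) 1) :
    ∫ s in (0 : ℝ)..t, φ s = ∫ s, (Ioc 0 t).indicator φ s ∂unitMeasure := by
  rw [integral_indicator measurableSet_Ioc, Measure.restrict_restrict measurableSet_Ioc,
    inter_eq_left.2 (Ioc_subset_Icc_self.trans (Icc_subset_Icc_right ht.2)),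
    intervalIntegral.integral_of_le ht.1]

theorem memLp_scalar_of_continuousOn {H : ℝ → ℝ} (hH : ContinuousOn H (Icc 0 1)) :
    MemLp H 2 unitMeasure := by
  obtain ⟨C, hC⟩ := isCompact_Icc.exists_bound_of_continuousOn hH
  refine MemLp.of_bound (hH.aestronglyMeasurable measurableSet_Icc) C ?_
  filter_upwards [ae_mem_unit] with t ht using hC t ht

theorem integral_abs_le {f : ℝ → ℝ} {C : ℝ} (hf : MemLp f 2 unitMeasure)
    (hb : ∫ t, f t ^ 2 ∂unitMeasure ≤ C) : ∫ t, |f t| ∂unitMeasure ≤ 1 + C := by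
  have h1 : ∫ t, |f t| ∂unitMeasure ≤ ∫ t, (1 + f t ^ 2) ∂unitMeasure :=
    integral_mono ((hf.integrable one_le_two).abs) ((integrable_const 1).add hf.integrable_sq)
      fun t => by
        have := sq_abs (f t)
        change |f t| ≤ 1 + f t ^ 2
        nlinarith [sq_nonneg (|f t| - 1), abs_nonneg (f t)]
  rw [integral_add (integrable_const 1) hf.integrable_sq] at h1
  simp only [integral_const, MeasurableSet.univ, measureReal_restrict_apply, univ_inter,
    Real.volume_real_Icc, sub_zero, zero_le_one, sup_of_le_left, smul_eq_mul, mul_one] at h1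
  linarith

/-- A product of a weakly and a uniformly convergent sequence converges weakly. -/
theorem tendsto_intervalIntegral_mul (U : Ultrafilter ℕ) {f h : ℕ → ℝ → ℝ} {F H : ℝ → ℝ} {C : ℝ}
    (hf : ∀ k, MemLp (f k) 2 unitMeasure) (hb : ∀ k, ∫ t, f k t ^ 2 ∂unitMeasure ≤ C)
    (hw : ∀ φ : ℝ → ℝ, MemLp φ 2 unitMeasure →
      Tendsto (fun k => ∫ t, f k t * φ t ∂unitMeasure) U (𝓝 (∫ t, F t * φ t ∂unitMeasure)))
    (hh : ∀ k, ContinuousOn (h k) (Icc 0 1)) (hH : ContinuousOn H (Icc 0 1))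
    (hu : TendstoUniformlyOn h H U (Icc 0 1)) {t : ℝ} (ht : t ∈ Icc (0 : ℝ) 1) :
    Tendsto (fun k => ∫ s in (0 : ℝ)..t, f k s * h k s) U (𝓝 (∫ s in (0 : ℝ)..t, F s * H s)) := by
  have hHL := memLp_scalar_of_continuousOn hH
  have hhL := fun k => memLp_scalar_of_continuousOn (hh k)
  have h1 : Tendsto (fun k => ∫ s in (0 : ℝ)..t, f k s * H s) U
      (𝓝 (∫ s in (0 : ℝ)..t, F s * H s)) := by
    have := hw _ (hHL.indicator (measurableSet_Ioc (a := (0 : ℝ)) (b := t)))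
    simp only [← Set.indicator_mul_right] at this
    simpa only [← intervalIntegral_eq_integral_indicator _ ht] using this
  have hC : 0 ≤ C := (integral_nonneg fun _ => sq_nonneg _).trans (hb 0)
  have h2 : Tendsto (fun k => ∫ s in (0 : ℝ)..t, f k s * (h k s - H s)) U (𝓝 0) := by
    refine Metric.tendsto_nhds.2 fun ε hε => ?_
    filter_upwards [Metric.tendstoUniformlyOn_iff.1 hu (ε / (2 + C)) (by positivity)] with k hk
    rw [Real.dist_eq, sub_zero, intervalIntegral_eq_integral_indicator _ ht]
    have hfi := ((hf k).integrable one_le_two).abs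
    have hle : |∫ s, (Ioc 0 t).indicator (fun s => f k s * (h k s - H s)) s ∂unitMeasure|
        ≤ ∫ s, ε / (2 + C) * |f k s| ∂unitMeasure := by
      refine (abs_integral_le_integral_abs).trans (integral_mono_ae ?_ (hfi.const_mul _) ?_)
      · exact (((hf k).integrable_mul ((hhL k).sub hHL)).indicator measurableSet_Ioc).abs
      · filter_upwards [ae_mem_unit] with s hs
        have h3 := hk s hs
        rw [Real.dist_eq, abs_sub_comm] at h3
        by_cases hm : s ∈ Ioc 0 t
        · rw [indicator_of_mem hm, abs_mul, mul_comm]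
          exact mul_le_mul_of_nonneg_right h3.le (abs_nonneg _)
        · rw [indicator_of_notMem hm, abs_zero]; positivity
    rw [integral_const_mul] at hle
    refine hle.trans_lt ?_
    calc ε / (2 + C) * ∫ s, |f k s| ∂unitMeasure ≤ ε / (2 + C) * (1 + C) :=
          mul_le_mul_of_nonneg_left (integral_abs_le (hf k) (hb k)) (by positivity)
      _ < ε := by rw [div_mul_eq_mul_div, div_lt_iff₀ (by positivity)]; nlinarith
  have h3 := h1.add h2
  rw [add_zero] at h3
  refine h3.congr fun k => ?_
  rw [← intervalIntegral.integral_add]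
  · exact intervalIntegral.integral_congr fun s _ => by ring
  · exact intervalIntegrable_of_integrable ((hf k).integrable_mul hHL) (by simp) ht
  · exact intervalIntegrable_of_integrable ((hf k).integrable_mul ((hhL k).sub hHL)) (by simp) ht

/-! ### Existence of a minimizer -/

open scoped MatrixOrder in
theorem norm_le_trace_of_posDef {S : Matrix (Fin n) (Fin n) ℝ} (hS : S.PosDef) :
    ‖S‖ ≤ S.trace := by
  obtain ⟨B, rfl⟩ := CStarAlgebra.nonneg_iff_eq_star_mul_self.mp hS.posSemidef.nonneg
  rw [Matrix.star_eq_conjTranspose, Matrix.conjTranspose_eq_transpose_of_trivial]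
  have h1 : ‖Bᵀ‖ = ‖B‖ := Matrix.frobenius_norm_transpose B
  have h2 : (Bᵀ * B).trace = ‖B‖ ^ 2 := by
    rw [norm_sq_eq_sum, Finset.sum_comm]
    simp only [Matrix.trace, Matrix.diag, Matrix.mul_apply, Matrix.transpose_apply, sq]
  rw [h2, sq]
  exact (norm_mul_le _ _).trans (by rw [h1])

/-- A priori bound for the state in terms of the energy of the control: the trace of the state,
which dominates its norm, grows at most at the rate `2 ‖A‖`. -/
theorem IsRelaxed.norm_state_le {S₀ S₁ : Matrix (Fin n) (Fin n) ℝ}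
    {A S : ℝ → Matrix (Fin n) (Fin n) ℝ} (h : IsRelaxed S₀ S₁ A S) {K : ℝ}
    (hK : ∫ t, ‖A t‖ ^ 2 ∂unitMeasure ≤ K) {t : ℝ} (ht : t ∈ Icc (0 : ℝ) 1) :
    ‖S t‖ ≤ S₀.trace * Real.exp (2 * (1 + K)) := by
  have hAi : Integrable (fun t => ‖A t‖) unitMeasure := h.memLp.norm.integrable one_le_two
  have hE := (HasACDeriv.of_integral (hAi.const_mul (-2)) 0).exp.mul h.dynamics.trace
  have h1 := hE.le_of_deriv_nonpos (by
    filter_upwards [ae_mem_unit] with s hs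
    have e : (A s * S s + S s * A s).trace = 2 * (A s * S s).trace := by
      rw [Matrix.trace_add, Matrix.trace_mul_comm (S s)]; ring
    have h2 := (le_abs_self _).trans (abs_trace_mul_le (A s) (S s))
    have h3 := mul_le_mul_of_nonneg_left (norm_le_trace_of_posDef (h.posDef s hs))
      (norm_nonneg (A s))
    rw [e, mul_assoc, ← mul_add]
    refine mul_nonpos_of_nonneg_of_nonpos (Real.exp_pos _).le ?_
    nlinarith) ht
  simp only [intervalIntegral.integral_same, zero_add, Real.exp_zero, one_mul, h.initial] at h1
  have h4 : ∫ s in (0 : ℝ)..t, ‖A s‖ ≤ 1 + K := by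
    rw [intervalIntegral_eq_integral_indicator _ ht]
    refine (integral_mono (hAi.indicator measurableSet_Ioc) hAi fun s =>
      indicator_le_self' (fun _ _ => norm_nonneg _) s).trans ?_
    have := integral_abs_le h.memLp.norm hK
    simpa only [abs_norm] using this
  have hτ : 0 ≤ S₀.trace := (norm_nonneg _).trans (norm_le_trace_of_posDef
    (h.initial ▸ h.posDef 0 (by simp)))
  refine (norm_le_trace_of_posDef (h.posDef t ht)).trans ?_
  rw [intervalIntegral.integral_const_mul, ← le_div_iff₀' (Real.exp_pos _), div_eq_mul_inv,
    ← Real.exp_neg] at h1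
  refine h1.trans (mul_le_mul_of_nonneg_left (Real.exp_le_exp.2 ?_) hτ)
  linarith

/-- A modulus of continuity for the state that depends on the energy of the control and a bound
for the state only. It comes from Young's inequality `2 ‖A‖ ≤ η ‖A‖² + η⁻¹`. -/
theorem IsRelaxed.abs_state_sub_le {S₀ S₁ : Matrix (Fin n) (Fin n) ℝ}
    {A S : ℝ → Matrix (Fin n) (Fin n) ℝ} (h : IsRelaxed S₀ S₁ A S) {K C η : ℝ} (hη : 0 < η)
    (hK : ∫ t, ‖A t‖ ^ 2 ∂unitMeasure ≤ K) (hC0 : 0 ≤ C) (hC : ∀ t ∈ Icc (0 : ℝ) 1, ‖S t‖ ≤ C)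
    {s t : ℝ} (hs : s ∈ Icc (0 : ℝ) 1) (ht : t ∈ Icc (0 : ℝ) 1) (i j : Fin n) :
    |S s i j - S t i j| ≤ C * (η * K + |s - t| / η) := by
  wlog hst : t ≤ s generalizing s t
  · rw [abs_sub_comm, abs_sub_comm s]
    exact this ht hs (le_of_not_ge hst)
  have hsub : Ioc t s ⊆ Icc 0 1 := Ioc_subset_Icc_self.trans (Icc_subset_Icc ht.1 hs.2)
  have hA2 : Integrable (fun u => ‖A u‖ ^ 2) unitMeasure := h.memLp.norm.integrable_sq
  rw [← (h.dynamics i j).integral_eq_sub ht hs, ← Real.norm_eq_abs]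
  have hi : ∀ {f : ℝ → ℝ}, Integrable f unitMeasure → IntervalIntegrable f volume t s :=
    fun hf => intervalIntegrable_of_integrable hf ht hs
  have h1 : ‖∫ u in t..s, (A u * S u + S u * A u) i j‖
      ≤ ∫ u in t..s, C * (η * ‖A u‖ ^ 2 + η⁻¹) := by
    refine intervalIntegral.norm_integral_le_of_norm_le hst ?_
      (hi (((hA2.const_mul η).add (integrable_const _)).const_mul C))
    refine ae_of_all _ fun u hu => ?_
    refine (abs_apply_le_norm _ i j).trans ((norm_lyapunov_le _ _).trans ?_)
    have h2 : 2 * ‖A u‖ ≤ η * ‖A u‖ ^ 2 + η⁻¹ := by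
      have h3 : η * ‖A u‖ ^ 2 + η⁻¹ - 2 * ‖A u‖ = η⁻¹ * (η * ‖A u‖ - 1) ^ 2 := by
        field_simp; ring
      have h4 : 0 ≤ η⁻¹ * (η * ‖A u‖ - 1) ^ 2 := by positivity
      linarith
    calc 2 * (‖A u‖ * ‖S u‖) ≤ 2 * (‖A u‖ * C) := by
          gcongr; exact hC u (hsub hu)
      _ = C * (2 * ‖A u‖) := by ring
      _ ≤ _ := mul_le_mul_of_nonneg_left h2 hC0
  refine h1.trans ?_
  rw [intervalIntegral.integral_const_mul, intervalIntegral.integral_add (hi (hA2.const_mul η))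
    (hi (integrable_const _)), intervalIntegral.integral_const_mul,
    intervalIntegral.integral_const, abs_of_nonneg (sub_nonneg.2 hst), smul_eq_mul, div_eq_mul_inv]
  gcongr
  rw [intervalIntegral.integral_of_le hst]
  exact (setIntegral_mono_set hA2 (ae_of_all _ fun u => sq_nonneg _)
    (LE.le.eventuallyLE hsub)).trans hK

/-- The linear interpolation of the boundary data is driven by a bounded control, the solution of
a Lyapunov equation. -/
theorem exists_isRelaxed {S₀ S₁ : Matrix (Fin n) (Fin n) ℝ} (h₀ : S₀.PosDef) (h₁ : S₁.PosDef) :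
    ∃ A S, IsRelaxed S₀ S₁ A S := by
  obtain ⟨S, hS⟩ : ∃ S : ℝ → Matrix (Fin n) (Fin n) ℝ, ∀ t, S t = S₀ + t • (S₁ - S₀) :=
    ⟨_, fun _ => rfl⟩
  have hSe : S = fun t => S₀ + t • (S₁ - S₀) := funext hS
  have hpos : ∀ t ∈ Icc (0 : ℝ) 1, (S t).PosDef := by
    intro t ht
    have e : S t = (1 - t) • S₀ + t • S₁ := by rw [hS]; module
    rw [e]
    rcases ht.1.eq_or_lt with h | h
    · rw [← h]; simpa using h₀
    · exact (h₁.smul h).posSemidef_add (h₀.posSemidef.smul (sub_nonneg.2 ht.2))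
  have hd : MatHasACDeriv S fun _ => S₁ - S₀ := by
    rw [hSe]
    refine ((MatHasACDeriv.const S₀).add
      (MatHasACDeriv.smul HasACDeriv.id (MatHasACDeriv.const (S₁ - S₀)))).congr_deriv ?_
    exact ae_of_all _ fun t => by simp
  obtain ⟨c, hc, hb⟩ := exists_boundedBelow hd.continuousOn hpos
  refine ⟨fun t => lyap (S t) (S₁ - S₀), S, ?_⟩
  exact
    { memLp := by
        refine MemLp.of_bound (aestronglyMeasurable_lyap hd.continuousOn
          aestronglyMeasurable_const) ((2 * c)⁻¹ * ‖S₁ - S₀‖) ?_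
        filter_upwards [ae_mem_unit] with t ht using (hb t ht).norm_lyap_le hc _
      symm := by
        filter_upwards [ae_mem_unit] with t ht
        exact (hb t ht).lyap_isSymm hc (isSymm_of_posDef (hpos t ht))
          ((isSymm_of_posDef h₁).sub (isSymm_of_posDef h₀))
      posDef := hpos
      dynamics := by
        refine hd.congr_deriv ?_
        filter_upwards [ae_mem_unit] with t ht using ((hb t ht).lyap_spec hc _).symm
      initial := by rw [hS, zero_smul, add_zero]
      terminal := by rw [hS, one_smul, add_sub_cancel] }

theorem cost_nonneg (θ : ℝ) (A : ℝ → Matrix (Fin n) (Fin n) ℝ) : 0 ≤ cost θ A := by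
  rw [cost_eq]; exact integral_nonneg fun _ => sq_nonneg _

theorem IsAdmissible.integral_norm_sq_le (hθ : 0 < θ) {S₀ S₁ : Matrix (Fin n) (Fin n) ℝ}
    {A S : ℝ → Matrix (Fin n) (Fin n) ℝ} (h : IsAdmissible S₀ S₁ A S) :
    ∫ t, ‖A t‖ ^ 2 ∂unitMeasure ≤ n * cost θ A := by
  have hA := h.isRelaxed.memLp
  rw [cost_eq, ← integral_const_mul]
  refine integral_mono_ae hA.norm.integrable_sq
    ((integrable_g_sq hθ hA h.symm).const_mul _) ?_
  filter_upwards [h.symm, h.traceless] with t h1 h2 using norm_sq_le_g_sq hθ h1 h2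

theorem IsAdmissible.det_eq {S₀ S₁ : Matrix (Fin n) (Fin n) ℝ}
    {A S : ℝ → Matrix (Fin n) (Fin n) ℝ} (h : IsAdmissible S₀ S₁ A S) {t : ℝ}
    (ht : t ∈ Icc (0 : ℝ) 1) : (S t).det = S₀.det := by
  rw [← h.initial]
  refine (h.isRelaxed.dynamics.det_of_lyapunov fun s hs =>
    (h.posDef s hs).det_pos.ne'.isUnit).eq_of_deriv_zero ?_ ht
  filter_upwards [h.traceless] with s hs
  rw [hs, mul_zero, zero_mul]

/-- Weak lower semicontinuity of the cost and weak compactness of sets of admissible pairs with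
bounded cost. The determinant is constant along the sequence, so that the limit state
cannot degenerate. -/
theorem exists_isRelaxed_cost_le (hθ : 0 < θ) {S₀ S₁ : Matrix (Fin n) (Fin n) ℝ} (h₀ : S₀.PosDef)
    {A S : ℕ → ℝ → Matrix (Fin n) (Fin n) ℝ} (h : ∀ k, IsAdmissible S₀ S₁ (A k) (S k)) {m : ℝ}
    (hm : Tendsto (fun k => cost θ (A k)) atTop (𝓝 m)) :
    ∃ B T, IsRelaxed S₀ S₁ B T ∧ cost θ B ≤ m := by
  -- Limits along an ultrafilter replace the successive extraction of subsequences.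
  let U : Ultrafilter ℕ := Filter.hyperfilter ℕ
  have hmU : Tendsto (fun k => cost θ (A k)) U (𝓝 m) :=
    hm.mono_left (Nat.hyperfilter_le_atTop)
  obtain ⟨c, hc⟩ := hm.bddAbove_range
  have hR := fun k => (h k).isRelaxed
  obtain ⟨K, hK⟩ : ∃ K : ℝ, ∀ k, ∫ t, ‖A k t‖ ^ 2 ∂unitMeasure ≤ K :=
    ⟨n * c, fun k => ((h k).integral_norm_sq_le hθ).trans
      (mul_le_mul_of_nonneg_left (hc (mem_range_self k)) (Nat.cast_nonneg n))⟩
  obtain ⟨C, hC⟩ : ∃ C : ℝ, ∀ k, ∀ t ∈ Icc (0 : ℝ) 1, ‖S k t‖ ≤ C :=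
    ⟨_, fun k t ht => (hR k).norm_state_le (hK k) ht⟩
  have hC0 : 0 ≤ C := (norm_nonneg _).trans (hC 0 0 (by simp))
  have hK0 : 0 ≤ K := (integral_nonneg fun _ => sq_nonneg _).trans (hK 0)
  have hAe : ∀ k i j, MemLp (fun t => A k t i j) 2 unitMeasure := fun k => (h k).memLp
  have hAK : ∀ i j k, ∫ t, A k t i j ^ 2 ∂unitMeasure ≤ K := fun i j k =>
    (integral_mono (hAe k i j).integrable_sq (hR k).memLp.norm.integrable_sq fun t => by
      rw [← sq_abs]
      exact pow_le_pow_left₀ (abs_nonneg _) (abs_apply_le_norm _ _ _) 2).trans (hK k)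
  choose F hFL hFw using fun i j => exists_weak_limit U (fun k => hAe k i j) (hAK i j)
  -- The upper triangle of the weak limit is reflected to make the limit control symmetric.
  let B : ℝ → Matrix (Fin n) (Fin n) ℝ := fun t => Matrix.of fun i j =>
    if i ≤ j then F i j t else F j i t
  have hBs : ∀ t, (B t).IsSymm := fun t => by
    ext i j
    simp only [B, Matrix.transpose_apply, Matrix.of_apply]
    rcases lt_trichotomy i j with hij | rfl | hij
    · rw [if_neg hij.not_ge, if_pos hij.le]
    · rfl
    · rw [if_pos hij.le, if_neg hij.not_ge]
  have hBe : ∀ i j, MemLp (fun t => B t i j) 2 unitMeasure ∧ ∀ φ : ℝ → ℝ,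
      MemLp φ 2 unitMeasure → Tendsto (fun k => ∫ t, A k t i j * φ t ∂unitMeasure) U
        (𝓝 (∫ t, B t i j * φ t ∂unitMeasure)) := by
    intro i j
    by_cases hij : i ≤ j
    · simp only [B, Matrix.of_apply, if_pos hij]
      exact ⟨hFL i j, hFw i j⟩
    · simp only [B, Matrix.of_apply, if_neg hij]
      refine ⟨hFL j i, fun φ hφ => (hFw j i φ hφ).congr fun k => integral_congr_ae ?_⟩
      filter_upwards [(h k).symm] with t ht
      rw [ht.apply]
  have hBL : MemLp B 2 unitMeasure := memLp_matrix_iff.2 fun i j => (hBe i j).1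
  have hSc := fun k => (hR k).dynamics.continuousOn
  have hSe : ∀ k i j, ContinuousOn (fun t => S k t i j) (Icc 0 1) := fun k i j =>
    ((hR k).dynamics i j).continuousOn
  have hlimS : ∀ i j, ∃ F : ℝ → ℝ, ContinuousOn F (Icc 0 1) ∧
      TendstoUniformlyOn (fun k t => S k t i j) F U (Icc 0 1) := by
    intro i j
    refine exists_tendstoUniformlyOn U (C := C) (fun k t ht =>
      (abs_apply_le_norm _ _ _).trans (hC k t ht)) fun ε hε => ?_
    have hη : 0 < ε / (2 * (C * K + 1)) := by positivity
    generalize hηe : ε / (2 * (C * K + 1)) = η at hη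
    refine ⟨ε * η / (2 * (C + 1)), by positivity, fun k s hs t ht hst => ?_⟩
    refine ((hR k).abs_state_sub_le hη (hK k) hC0 (hC k) hs ht i j).trans ?_
    have e1 : C * (η * K) ≤ ε / 2 := by
      rw [← hηe]
      have : C * (ε / (2 * (C * K + 1)) * K) = ε / 2 * (C * K / (C * K + 1)) := by
        field_simp
      rw [this]
      refine mul_le_of_le_one_right (by positivity) ((div_le_one (by positivity)).2 (by linarith))
    have e2 : C * (|s - t| / η) ≤ ε / 2 := by
      have : |s - t| / η ≤ ε / (2 * (C + 1)) := by
        rw [div_le_iff₀ hη]; refine hst.le.trans (le_of_eq ?_); ring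
      refine (mul_le_mul_of_nonneg_left this hC0).trans ?_
      rw [mul_div_assoc', div_le_iff₀ (by positivity)]
      nlinarith
    linarith
  choose T' hTc hTu using hlimS
  let T₁ : ℝ → Matrix (Fin n) (Fin n) ℝ := fun t => Matrix.of fun i j => T' i j t
  have hT1c : ContinuousOn T₁ (Icc 0 1) :=
    continuousOn_pi.2 fun i => continuousOn_pi.2 fun j => hTc i j
  have hTt : ∀ t ∈ Icc (0 : ℝ) 1, Tendsto (fun k => S k t) U (𝓝 (T₁ t)) := fun t ht =>
    tendsto_pi_nhds.2 fun i => tendsto_pi_nhds.2 fun j => (hTu i j).tendsto_at ht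
  -- The state equation passes to the limit in integrated form.
  have hint : ∀ t ∈ Icc (0 : ℝ) 1, ∀ i j,
      T₁ t i j = S₀ i j + ∫ s in (0 : ℝ)..t, (B s * T₁ s + T₁ s * B s) i j := by
    intro t ht i j
    have hexp : ∀ (X Y : ℝ → Matrix (Fin n) (Fin n) ℝ), MemLp X 2 unitMeasure →
        ContinuousOn Y (Icc 0 1) →
        ∫ s in (0 : ℝ)..t, (X s * Y s + Y s * X s) i j =
          ∑ l, ((∫ s in (0 : ℝ)..t, X s i l * Y s l j) + ∫ s in (0 : ℝ)..t, X s l j * Y s i l) := by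
      intro X Y hX hY
      have hYL := memLp_of_continuousOn hY
      have hI : ∀ a b c d, IntervalIntegrable (fun s => X s a b * Y s c d) volume 0 t :=
        fun a b c d => intervalIntegrable_of_integrable
          ((memLp_matrix_iff.1 hX a b).integrable_mul (memLp_matrix_iff.1 hYL c d)) (by simp) ht
      simp only [← intervalIntegral.integral_add (hI _ _ _ _) (hI _ _ _ _)]
      rw [← intervalIntegral.integral_finsetSum fun l _ => (hI _ _ _ _).add (hI _ _ _ _)]
      refine intervalIntegral.integral_congr fun s _ => ?_
      simp only [Matrix.add_apply, Matrix.mul_apply, ← Finset.sum_add_distrib]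
      exact Finset.sum_congr rfl fun l _ => by ring
    have hl : Tendsto (fun k => S₀ i j + ∫ s in (0 : ℝ)..t, (A k s * S k s + S k s * A k s) i j) U
        (𝓝 (S₀ i j + ∫ s in (0 : ℝ)..t, (B s * T₁ s + T₁ s * B s) i j)) := by
      refine tendsto_const_nhds.add ?_
      rw [hexp B T₁ hBL hT1c]
      simp only [fun k => hexp (A k) (S k) (hR k).memLp (hSc k)]
      refine tendsto_finsetSum _ fun l _ => ?_
      exact (tendsto_intervalIntegral_mul U (fun k => hAe k i l) (hAK i l) (hBe i l).2
        (fun k => hSe k l j) (hTc l j) (hTu l j) ht).add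
        (tendsto_intervalIntegral_mul U (fun k => hAe k l j) (hAK l j) (hBe l j).2
        (fun k => hSe k i l) (hTc i l) (hTu i l) ht)
    refine tendsto_nhds_unique ((hTu i j).tendsto_at ht) (hl.congr fun k => ?_)
    rw [((hR k).dynamics i j).integral_eq_sub (by simp) ht, (hR k).initial]
    ring
  have hpos : ∀ t ∈ Icc (0 : ℝ) 1, (T₁ t).PosDef := by
    intro t ht
    have hdet : (T₁ t).det = S₀.det := by
      refine tendsto_nhds_unique (((Continuous.matrix_det continuous_id).tendsto (T₁ t)).comp
        (hTt t ht)) (tendsto_const_nhds.congr fun k => ((h k).det_eq ht).symm)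
    have hps : (T₁ t).PosSemidef := by
      rw [Matrix.posSemidef_iff_dotProduct_mulVec]
      refine ⟨?_, fun x => ?_⟩
      · ext i j
        refine tendsto_nhds_unique ((hTu j i).tendsto_at ht) (((hTu i j).tendsto_at ht).congr
          fun k => ?_)
        exact ((isSymm_of_posDef ((h k).posDef t ht)).apply i j).symm
      · have hcont : Continuous fun M : Matrix (Fin n) (Fin n) ℝ => star x ⬝ᵥ M *ᵥ x := by
          fun_prop
        exact ge_of_tendsto ((hcont.tendsto (T₁ t)).comp (hTt t ht)) (Eventually.of_forall fun k =>
          ((h k).posDef t ht).posSemidef.dotProduct_mulVec_nonneg x)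
    exact hps.posDef_iff_det_ne_zero.2 (by rw [hdet]; exact h₀.det_pos.ne')
  have hL := memLp_lyapunov hBL hT1c
  obtain ⟨T, hT⟩ : ∃ T : ℝ → Matrix (Fin n) (Fin n) ℝ, T = fun t => Matrix.of fun i j =>
    S₀ i j + ∫ s in (0 : ℝ)..t, (B s * T₁ s + T₁ s * B s) i j := ⟨_, rfl⟩
  have hTT : ∀ t ∈ Icc (0 : ℝ) 1, T t = T₁ t := fun t ht => by
    ext i j
    rw [hint t ht i j, hT]; rfl
  have hS0 : ∀ k, S k 0 = S₀ := fun k => (hR k).initial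
  have hS1 : ∀ k, S k 1 = S₁ := fun k => (hR k).terminal
  refine ⟨B, T, ?_, ?_⟩
  · exact
      { memLp := hBL
        symm := ae_of_all _ hBs
        posDef := fun t ht => by rw [hTT t ht]; exact hpos t ht
        dynamics := by
          have := MatHasACDeriv.of_integral (X' := fun t => B t * T₁ t + T₁ t * B t)
            (fun i j => integrable_apply hL i j) S₀
          rw [← hT] at this
          refine this.congr_deriv ?_
          filter_upwards [ae_mem_unit] with t ht
          rw [hTT t ht]
        initial := by
          rw [hTT 0 (by simp)]
          refine tendsto_nhds_unique (hTt 0 (by simp)) ?_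
          simp only [hS0]; exact tendsto_const_nhds
        terminal := by
          rw [hTT 1 (by simp)]
          refine tendsto_nhds_unique (hTt 1 (by simp)) ?_
          simp only [hS1]; exact tendsto_const_nhds }
  · have hPL := memLp_gradSq hθ hBL (ae_of_all _ hBs)
    have hkey := fun k => cost_ge hθ hBL (hR k).memLp (ae_of_all _ hBs) (hR k).symm
    obtain ⟨P, hP⟩ : ∃ P : ℝ → Matrix (Fin n) (Fin n) ℝ, ∀ t, gradSq θ (B t) = P t :=
      ⟨_, fun _ => rfl⟩
    simp only [hP] at hPL hkey
    have htr : ∀ X : ℝ → Matrix (Fin n) (Fin n) ℝ, MemLp X 2 unitMeasure →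
        ∫ t, (P t * X t).trace ∂unitMeasure =
          ∑ i, ∑ l, ∫ t, X t l i * P t i l ∂unitMeasure := by
      intro X hX
      have hI : ∀ i l, Integrable (fun t => X t l i * P t i l) unitMeasure := fun i l =>
        (memLp_matrix_iff.1 hX l i).integrable_mul (memLp_matrix_iff.1 hPL i l)
      simp only [← integral_finsetSum _ fun l _ => hI _ l]
      rw [← integral_finsetSum _ fun i _ => integrable_finsetSum _ fun l _ => hI i l]
      refine integral_congr_ae (ae_of_all _ fun t => ?_)
      simp only [Matrix.trace, Matrix.diag, Matrix.mul_apply, mul_comm]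
    have hz : Tendsto (fun k => ∫ t, (P t * (A k t - B t)).trace ∂unitMeasure) U (𝓝 0) := by
      have e : ∀ k, ∫ t, (P t * (A k t - B t)).trace ∂unitMeasure
          = ∑ i, ∑ l, ∫ t, A k t l i * P t i l ∂unitMeasure
            - ∑ i, ∑ l, ∫ t, B t l i * P t i l ∂unitMeasure := by
        intro k
        rw [← htr _ (hR k).memLp, ← htr _ hBL, ← integral_sub
          (integrable_trace_mul hPL (hR k).memLp) (integrable_trace_mul hPL hBL)]
        refine integral_congr_ae (ae_of_all _ fun t => ?_)
        simp only [Matrix.mul_sub, Matrix.trace_sub]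
      simp only [e]
      rw [← sub_self (∑ i, ∑ l, ∫ t, B t l i * P t i l ∂unitMeasure)]
      exact (tendsto_finsetSum _ fun i _ => tendsto_finsetSum _ fun l _ =>
        (hBe l i).2 _ (memLp_matrix_iff.1 hPL i l)).sub tendsto_const_nhds
    have h5 := (hz.const_mul 2).const_add (cost θ B)
    rw [mul_zero, add_zero] at h5
    exact le_of_tendsto_of_tendsto' h5 hmU hkey

theorem exists_isMinimizer (hθ : 0 < θ) {S₀ S₁ : Matrix (Fin n) (Fin n) ℝ} (h₀ : S₀.PosDef)
    (h₁ : S₁.PosDef) (hdet : S₀.det = S₁.det) : ∃ A S, IsMinimizer θ S₀ S₁ A S := by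
  let E : Set ℝ := {c | ∃ A S, IsAdmissible S₀ S₁ A S ∧ cost θ A = c}
  have hne : E.Nonempty := by
    obtain ⟨A, S, h⟩ := exists_isRelaxed h₀ h₁
    obtain ⟨T, hT⟩ := h.exists_isAdmissible hdet
    exact ⟨_, _, _, hT, rfl⟩
  have hbd : BddBelow E := ⟨0, by rintro _ ⟨A, S, -, rfl⟩; exact cost_nonneg θ A⟩
  obtain ⟨u, -, hu, huE⟩ := exists_seq_tendsto_sInf hne hbd
  choose A S hAS hcost using huE
  obtain ⟨B, T, hB, hle⟩ := exists_isRelaxed_cost_le hθ h₀ hAS (by simpa only [hcost] using hu)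
  obtain ⟨T', hT'⟩ := hB.exists_isAdmissible hdet
  refine ⟨_, T', hT', fun B' T'' h' => ?_⟩
  have e : cost θ (fun t => B t - ((B t).trace / n) • 1) = cost θ B := by
    rw [cost_eq, cost_eq]
    refine integral_congr_ae ?_
    filter_upwards [hB.symm] with t ht
    rw [g_sub_smul_one hθ ht]
  rw [e]
  exact hle.trans (csInf_le hbd ⟨B', T'', h', rfl⟩)

end

end MinShear

theorem theorem1 (n : ℕ) (θ : ℝ) (hθ : 0 < θ) (S₀ S₁ : Matrix (Fin n) (Fin n) ℝ)
    (hS₀ : S₀.PosDef) (hS₁ : S₁.PosDef) (hdet : S₀.det = S₁.det) :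
    (∃ A S : ℝ → Matrix (Fin n) (Fin n) ℝ, MinShear.IsMinimizer θ S₀ S₁ A S) ∧
    ∀ A S : ℝ → Matrix (Fin n) (Fin n) ℝ, MinShear.IsMinimizer θ S₀ S₁ A S →
      ∃ Λ₀ L₀ : Matrix (Fin n) (Fin n) ℝ, Λ₀.IsSymm ∧ L₀ = Λ₀ * S₀ ∧
        ∃ A' M Ω : ℝ → Matrix (Fin n) (Fin n) ℝ,
          MinShear.IsExtremal θ S₀ L₀ A' S M Ω ∧
          (∀ᵐ t ∂MeasureTheory.volume.restrict (Set.Icc (0 : ℝ) 1), A t = A' t) ∧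
          ∀ B T N W : ℝ → Matrix (Fin n) (Fin n) ℝ,
            MinShear.IsExtremal θ S₀ L₀ B T N W →
            ∀ t ∈ Set.Icc (0 : ℝ) 1, B t = A' t ∧ T t = S t ∧ N t = M t ∧ W t = Ω t := by
  refine ⟨MinShear.exists_isMinimizer hθ hS₀ hS₁ hdet, fun A S h => ?_⟩
  obtain ⟨Λ₀, A', M, Ω, hΛ, hE, hA⟩ := h.exists_isExtremal hθ hdet
  exact ⟨Λ₀, Λ₀ * S₀, hΛ, rfl, A', M, Ω, hE, hA, fun B T N W hB t ht => hE.unique hθ hB ht⟩
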